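/- Let $\chi,\varphi\in C_c^\infty(\mathbb R^3;\mathbb R)$ be a Littlewood–Paley decomposition: $\operatorname{supp}\chi\subset\{|\xi|\le 4/3\}$, $\operatorname{supp}\varphi\subset\{3/4\le|\xi|\le 8/3\}$, and for all $\xi\in\mathbb R^3$ $$\chi(\xi)+\sum_{q\ge0}\varphi(2^{-q}\xi)=1,\qquad \tfrac13\le\chi^2(\xi)+\sum_{q\ge0}\varphi^2(2^{-q}\xi)\le1 .$$ Put $\Delta_{-1}w=\mathcal F^{-1}[\chi\,\mathcal F w]$ and $\Delta_qw=\mathcal F^{-1}[\varphi(2^{-q}\cdot)\mathcal F w]$ for $q\ge0$, where $\mathcal Fw(\xi)=\int e^{-ix\cdot\xi}w(x)\,dx$ (extended to $L^2$). For $0<T\le 1$ let $$\|v\|_{Q[0,T]}^2=\sum_{q\ge-1}\ \sup_{0\le t<T}\tfrac12\int_{\mathbb R^3}|\Delta_qv(x,t)|^2dx+\int_0^T\!\!\int_{\mathbb R^3}|\nabla v(x,t)|^2dx\,dt,$$ and let $V(Q[0,T])$ be the set of $v\in L^2(0,T;H^1(\mathbb R^3;\mathbb R^3))$ with $v(t)\in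 L^2(\mathbb R^3)$ for all $t\in[0,T)$ and $\|v\|_{Q[0,T]}<\infty$. For measurable $u:\mathbb R^3\times(0,1)\to\mathbb R^3$ let $$\|u\|_{L^{2,\infty}(0,1;L^\infty(\mathbb R^3))}=\sup\Big\{|E|^{-1/2}\int_E\|u(t)\|_{L^\infty(\mathbb R^3)}dt:\ E\subset(0,1)\text{ measurable},\ |E|>0\Big\}.$$ Proposition. There are constants $\epsilon>0$ and $C<\infty$, depending only on $\chi,\varphi$, such that the following holds. Let $u$ satisfy $\|u\|_{L^{2,\infty}(0,1;L^\infty(\mathbb R^3))}\le\epsilon$, let $t_1\in(0,1]$, and let $v\in V(Q[0,t_1])$ be a solution of the vorticity equation $$\partial_tv-\Delta v+\operatorname{div}(v\otimes u-u\otimes v)=0\quad\text{in }\mathbb R^3\times(0,t_1),\qquad v(0)=v_0,$$ where $\operatorname{div}u=0$ and $v=\operatorname{curl}u$ in the sense of distributions for almost every $t\in(0,t_1)$. Here $(\operatorname{div}B)_i=\sum_j\partial_jB_{ij}$, $(a\otimes b)_{ij}=a_ib_j$, and the equation is understood weakly: $v(0)=v_0$ almost everywhere and, for all $t\in[0,t_1)$,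 $\eta\in C_c^\infty(\mathbb R^3)$ and $i=1,2,3$, $$\int v_i(t)\,\eta\,dx=\int v_{0,i}\,\eta\,dx+\int_0^t\!\!\int\Big(v_i\,\Delta\eta+\sum_j(v_iu_j-u_iv_j)\,\partial_j\eta\Big)dx\,ds .$$ Then $$\|v\|_{Q[0,t_1]}^2\le C\,\|v_0\|_{L^2(\mathbb R^3)}^2 .$$ In particular $C$ does not depend on $u$, $v$, $v_0$ or $t_1$. -/

import Mathlib

open MeasureTheory Set
open scoped ENNReal NNReal ContDiff FourierTransform

noncomputable section

/-- Physical space `ℝ³` with the Euclidean norm and Lebesgue measure `volume`. -/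
abbrev R3 : Type := EuclideanSpace ℝ (Fin 3)

/-- `ℂ³` with its Hermitian norm; Littlewood-Paley blocks of real fields are taken here. -/
abbrev C3 : Type := EuclideanSpace ℂ (Fin 3)

/-- The `j`-th vector of the canonical basis of `ℝ³`. -/
def stdVec (j : Fin 3) : R3 := EuclideanSpace.single j (1 : ℝ)

/-! ### Littlewood-Paley decomposition -/

/-- A dyadic Littlewood-Paley decomposition of unity on `ℝ³`: `χ` is smooth and supported in
`|ξ| ≤ 4/3`, `φ` is smooth and supported in `3/4 ≤ |ξ| ≤ 8/3`, and for all `ξ`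
`χ(ξ) + ∑_{q ≥ 0} φ(2^{-q} ξ) = 1`, `1/3 ≤ χ(ξ)² + ∑_{q ≥ 0} φ(2^{-q} ξ)² ≤ 1`.
For every `ξ` only finitely many terms of the sums are nonzero. -/
structure LittlewoodPaley where
  χ : R3 → ℝ
  φ : R3 → ℝ
  χ_smooth : ContDiff ℝ ∞ χ
  φ_smooth : ContDiff ℝ ∞ φ
  χ_supp : tsupport χ ⊆ Metric.closedBall 0 (4 / 3)
  φ_supp : tsupport φ ⊆ Metric.closedBall 0 (8 / 3) \ Metric.ball 0 (3 / 4)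
  sum_eq_one : ∀ ξ : R3, χ ξ + ∑' q : ℕ, φ (((2 : ℝ) ^ q)⁻¹ • ξ) = 1
  one_third_le : ∀ ξ : R3, 1 / 3 ≤ χ ξ ^ 2 + ∑' q : ℕ, φ (((2 : ℝ) ^ q)⁻¹ • ξ) ^ 2
  sum_sq_le_one : ∀ ξ : R3, χ ξ ^ 2 + ∑' q : ℕ, φ (((2 : ℝ) ^ q)⁻¹ • ξ) ^ 2 ≤ 1

namespace LittlewoodPaley

/-- Symbol, in the angular frequency `ξ`, of the blocks. The index is shifted by one:
`0` stands for `Δ_{-1}` and `q + 1` stands for `Δ_q`, `q ≥ 0`. -/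
def symbol (D : LittlewoodPaley) : ℕ → R3 → ℝ
  | 0 => D.χ
  | q + 1 => fun ξ => D.φ (((2 : ℝ) ^ q)⁻¹ • ξ)

/-- The same symbol as a function of the variable `k` of Mathlib's Fourier transform,
whose character is `exp (-2 π i ⟨x, k⟩)`, so that `ξ = 2 π k`. -/
def multiplier (D : LittlewoodPaley) (n : ℕ) (k : R3) : ℂ :=
  ((D.symbol n ((2 * Real.pi) • k) : ℝ) : ℂ)

theorem memLp_multiplier (D : LittlewoodPaley) (n : ℕ) :
    MemLp (D.multiplier n) ∞ (volume : Measure R3) := by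
  have hχ : HasCompactSupport D.χ :=
    HasCompactSupport.of_support_subset_isCompact (isCompact_closedBall (0 : R3) (4 / 3))
      ((subset_tsupport _).trans D.χ_supp)
  have hφ : HasCompactSupport D.φ :=
    HasCompactSupport.of_support_subset_isCompact (isCompact_closedBall (0 : R3) (8 / 3))
      (((subset_tsupport _).trans D.φ_supp).trans sdiff_subset)
  obtain ⟨A, hA⟩ := hχ.exists_bound_of_continuous D.χ_smooth.continuous
  obtain ⟨B, hB⟩ := hφ.exists_bound_of_continuous D.φ_smooth.continuous
  have hc : Continuous (D.multiplier n) := by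
    have h1 := D.χ_smooth.continuous
    have h2 := D.φ_smooth.continuous
    cases n with
    | zero => unfold multiplier symbol; fun_prop
    | succ q => unfold multiplier symbol; fun_prop
  refine memLp_top_of_bound hc.aestronglyMeasurable (max A B) (Filter.Eventually.of_forall ?_)
  intro k
  cases n with
  | zero => exact (by simpa [multiplier, symbol] using hA _ : _ ≤ A).trans (le_max_left _ _)
  | succ q => exact (by simpa [multiplier, symbol] using hB _ : _ ≤ B).trans (le_max_right _ _)

/-- The block `𝓕⁻¹ [symbol · 𝓕 f]` of `f ∈ L²(ℝ³; ℂ³)`; `𝓕` is the Fourier transform on `L²`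
and the product is the one of an `L^∞` function with an `L²` function. -/
def block (D : LittlewoodPaley) (n : ℕ) (f : Lp C3 2 (volume : Measure R3)) :
    Lp C3 2 (volume : Measure R3) :=
  𝓕⁻ (((D.memLp_multiplier n).toLp (D.multiplier n) • 𝓕 f : Lp C3 2 (volume : Measure R3)))

end LittlewoodPaley

/-- A real vector field regarded as a complex one. -/
def complexify (w : R3 → R3) : R3 → C3 := fun x => WithLp.toLp 2 fun i => ((w x i : ℝ) : ℂ)

open Classical in
/-- `‖Δ w‖²_{L²}` for the block with (shifted) index `n`; it is `∞` if `w ∉ L²`. -/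
def LittlewoodPaley.blockNormSq (D : LittlewoodPaley) (n : ℕ) (w : R3 → R3) : ℝ≥0∞ :=
  if h : MemLp (complexify w) 2 volume then ‖D.block n (h.toLp (complexify w))‖ₑ ^ 2 else ⊤

/-! ### Weak derivatives -/

/-- Scalar test functions on `ℝ³`. -/
def IsTest (η : R3 → ℝ) : Prop := ContDiff ℝ ∞ η ∧ HasCompactSupport η

/-- `g` is the weak partial derivative `∂_j w`. -/
def HasWeakPartial (j : Fin 3) (w g : R3 → R3) : Prop :=
  LocallyIntegrable w ∧ LocallyIntegrable g ∧
    ∀ η, IsTest η → ∫ x, fderiv ℝ η x (stdVec j) • w x = -∫ x, η x • g x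

/-- `∫ |∇w|² dx`, as an element of `[0, ∞]`; it is `∞` if `w` has no weak gradient. (The weak
gradient is unique almost everywhere, so the infimum runs over a single value.) -/
def gradNormSq (w : R3 → R3) : ℝ≥0∞ :=
  ⨅ (G : Fin 3 → R3 → R3) (_ : ∀ j, HasWeakPartial j w (G j)), ∑ j, ∫⁻ x, ‖G j x‖ₑ ^ 2

/-- `div w = 0` in the sense of distributions. -/
def IsWeaklyDivFree (w : R3 → R3) : Prop :=
  LocallyIntegrable w ∧ ∀ η, IsTest η → ∫ x, fderiv ℝ η x (w x) = 0

/-- `z = curl w` in the sense of distributions: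
`z_i = ∂_{i+1} w_{i+2} - ∂_{i+2} w_{i+1}`, indices modulo `3`. -/
def IsWeakCurl (w z : R3 → R3) : Prop :=
  LocallyIntegrable w ∧ LocallyIntegrable z ∧
    ∀ η, IsTest η → ∀ i : Fin 3,
      ∫ x, z x i * η x =
        -∫ x, (w x (i + 2) * fderiv ℝ η x (stdVec (i + 1))
          - w x (i + 1) * fderiv ℝ η x (stdVec (i + 2)))

/-! ### Function spaces in space-time. Fields are written `v t x`. -/

/-- Measurability in space-time on `(0,T) × ℝ³`. -/
def SpaceTimeMeasurable (T : ℝ) (v : ℝ → R3 → R3) : Prop :=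
  AEStronglyMeasurable (fun p : ℝ × R3 => v p.1 p.2)
    (((volume : Measure ℝ).restrict (Ioo 0 T)).prod (volume : Measure R3))

/-- `v ∈ L²(0,T; H¹(ℝ³))`. -/
def MemL2H1 (T : ℝ) (v : ℝ → R3 → R3) : Prop :=
  SpaceTimeMeasurable T v ∧ ∃ G : Fin 3 → ℝ → R3 → R3,
    (∀ j, SpaceTimeMeasurable T (G j)) ∧
    (∀ᵐ t ∂(volume.restrict (Ioo 0 T)), ∀ j, HasWeakPartial j (v t) (G j t)) ∧
    ∫⁻ t in Ioo 0 T, ∫⁻ x, (‖v t x‖ₑ ^ 2 + ∑ j, ‖G j t x‖ₑ ^ 2) < ⊤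

/-- `‖v‖²_{Q[0,T]} = ∑_{q ≥ -1} sup_{0 ≤ t < T} ½ ‖Δ_q v(t)‖²_{L²} + ∫_0^T ∫ |∇v|² dx dt`. -/
def qNormSq (D : LittlewoodPaley) (T : ℝ) (v : ℝ → R3 → R3) : ℝ≥0∞ :=
  (∑' n : ℕ, ⨆ t ∈ Ico 0 T, 2⁻¹ * D.blockNormSq n (v t)) + ∫⁻ t in Ioo 0 T, gradNormSq (v t)

/-- `v ∈ V(Q[0,T])`. -/
def MemVQ (D : LittlewoodPaley) (T : ℝ) (v : ℝ → R3 → R3) : Prop :=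
  MemL2H1 T v ∧ (∀ t ∈ Ico 0 T, MemLp (v t) 2 volume) ∧ qNormSq D T v < ⊤

/-- The norm of the Lorentz space `L^{2,∞}(0,1)`,
`sup { |E|^{-1/2} ∫_E f dt : E ⊆ (0,1) measurable, |E| > 0 }`, for `f ≥ 0`. -/
def lorentzNorm (f : ℝ → ℝ≥0∞) : ℝ≥0∞ :=
  ⨆ (E : Set ℝ) (_ : MeasurableSet E) (_ : E ⊆ Ioo 0 1) (_ : 0 < volume E),
    (∫⁻ t in E, f t) / volume E ^ (1 / 2 : ℝ)

/-- `‖u‖_{L^{2,∞}(0,1; L^∞(ℝ³))}`. -/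
def lorentzSupNorm (u : ℝ → R3 → R3) : ℝ≥0∞ :=
  lorentzNorm fun t => eLpNorm (u t) ∞ volume

/-! ### The vorticity equation -/

/-- `v` solves on `[0,T)` the Cauchy problem for the vorticity equation
`∂_t v - Δ v + div (v ⊗ u - u ⊗ v) = 0`, `v(0) = v₀`, where `v = curl u` and `div u = 0`.
Here `(a ⊗ b)_{ij} = a_i b_j` and `(div B)_i = ∑_j ∂_j B_{ij}`. The equation is integrated in
time and tested against `η ∈ C_c^∞(ℝ³)` in each component: this is the distributional form of
the equation together with the choice of the representative of `v` that is weakly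
continuous in time, for which the values `v(t)`, `0 ≤ t < T`, have a meaning. -/
structure IsVorticitySolution (T : ℝ) (u v : ℝ → R3 → R3) (v₀ : R3 → R3) : Prop where
  div_free : ∀ᵐ t ∂(volume.restrict (Ioo 0 T)), IsWeaklyDivFree (u t)
  curl_eq : ∀ᵐ t ∂(volume.restrict (Ioo 0 T)), IsWeakCurl (u t) (v t)
  initial : v 0 =ᵐ[volume] v₀
  equation : ∀ t ∈ Ico 0 T, ∀ η, IsTest η → ∀ i : Fin 3,
    (∫ x, v t x i * η x) = (∫ x, v₀ x i * η x) +
      ∫ s in (0 : ℝ)..t, ∫ x, (v s x i * Laplacian.laplacian η x +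
        ∑ j, (v s x i * u s x j - u s x i * v s x j) * fderiv ℝ η x (stdVec j))

end

open scoped SchwartzMap LineDeriv ComplexConjugate

/-! ### Plancherel theory for representatives of `L²` fields -/

/-- `f` and `F` are square integrable and `F` is the Fourier transform of `f`. -/
def FPair (f F : R3 → C3) : Prop :=
  ∃ (hf : MemLp f 2 (volume : Measure R3)) (hF : MemLp F 2 (volume : Measure R3)),
    𝓕 (hf.toLp f) = hF.toLp F

namespace FPair

theorem memLp_left {f F : R3 → C3} (h : FPair f F) : MemLp f 2 (volume : Measure R3) := h.1

theorem memLp_right {f F : R3 → C3} (h : FPair f F) : MemLp F 2 (volume : Measure R3) := h.2.1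

theorem exists_right {f : R3 → C3} (hf : MemLp f 2 (volume : Measure R3)) : ∃ F, FPair f F :=
  ⟨(𝓕 (hf.toLp f) : Lp C3 2 (volume : Measure R3)), hf, Lp.memLp _, by rw [Lp.toLp_coeFn]⟩

theorem exists_left {F : R3 → C3} (hF : MemLp F 2 (volume : Measure R3)) : ∃ f, FPair f F :=
  ⟨(𝓕⁻ (hF.toLp F) : Lp C3 2 (volume : Measure R3)), Lp.memLp _, hF, by
    rw [Lp.toLp_coeFn, FourierTransform.fourier_fourierInv_eq]⟩

theorem congr {f F f' F' : R3 → C3} (h : FPair f F) (hf : f =ᵐ[volume] f')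
    (hF : F =ᵐ[volume] F') : FPair f' F' := by
  obtain ⟨h1, h2, h3⟩ := h
  refine ⟨h1.ae_eq hf, h2.ae_eq hF, ?_⟩
  rw [← MemLp.toLp_congr h1 (h1.ae_eq hf) hf, ← MemLp.toLp_congr h2 (h2.ae_eq hF) hF, h3]

theorem add {f F g G : R3 → C3} (h : FPair f F) (h' : FPair g G) :
    FPair (fun x => f x + g x) (fun x => F x + G x) := by
  obtain ⟨h1, h2, h3⟩ := h
  obtain ⟨h1', h2', h3'⟩ := h'
  refine ⟨h1.add h1', h2.add h2', ?_⟩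
  have e1 := MemLp.toLp_add h1 h1'
  have e2 := MemLp.toLp_add h2 h2'
  refine (congrArg 𝓕 e1).trans (Eq.trans ?_ e2.symm)
  rw [FourierTransform.fourier_add, h3, h3']

theorem smul {f F : R3 → C3} (c : ℂ) (h : FPair f F) :
    FPair (fun x => c • f x) (fun x => c • F x) := by
  obtain ⟨h1, h2, h3⟩ := h
  refine ⟨h1.const_smul c, h2.const_smul c, ?_⟩
  have e1 := MemLp.toLp_const_smul c h1
  have e2 := MemLp.toLp_const_smul c h2
  refine (congrArg 𝓕 e1).trans (Eq.trans ?_ e2.symm)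
  rw [FourierTransform.fourier_smul, h3]

theorem sub {f F g G : R3 → C3} (h : FPair f F) (h' : FPair g G) :
    FPair (fun x => f x - g x) (fun x => F x - G x) := by
  have := h.add (h'.smul (-1))
  simpa [sub_eq_add_neg] using this

/-- The multiplication formula, obtained from the agreement of the `L²` transform with the transform
of tempered distributions. Together with `ae_eq_of_schwartz` it identifies transforms without
approximating `f` by integrable functions. -/
theorem pairing {f F : R3 → C3} (h : FPair f F) (g : 𝓢(R3, ℂ)) :
    ∫ x, 𝓕 g x • f x = ∫ x, g x • F x := by
  obtain ⟨h1, h2, h3⟩ := h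
  have e := DFunLike.congr_fun (Lp.fourier_toTemperedDistribution_eq (h1.toLp f)) g
  rw [TemperedDistribution.fourier_apply, Lp.toTemperedDistribution_apply,
    Lp.toTemperedDistribution_apply, h3] at e
  refine (integral_congr_ae ?_).trans (e.trans (integral_congr_ae ?_))
  · filter_upwards [h1.coeFn_toLp] with x hx
    rw [hx]
  · filter_upwards [h2.coeFn_toLp] with x hx
    rw [hx]

theorem inner_integral {f F g G : R3 → C3} (h : FPair f F) (h' : FPair g G) :
    ∫ x, inner ℂ (f x) (g x) = ∫ x, inner ℂ (F x) (G x) := by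
  obtain ⟨h1, h2, h3⟩ := h
  obtain ⟨h1', h2', h3'⟩ := h'
  have e := Lp.inner_fourier_eq (h1.toLp f) (h1'.toLp g)
  rw [h3, h3', L2.inner_def, L2.inner_def] at e
  refine (integral_congr_ae ?_).trans (e.symm.trans (integral_congr_ae ?_))
  · filter_upwards [h1.coeFn_toLp, h1'.coeFn_toLp] with x hx hx'
    rw [hx, hx']
  · filter_upwards [h2.coeFn_toLp, h2'.coeFn_toLp] with x hx hx'
    rw [hx, hx']

end FPair

theorem enorm_toLp_sq {f : R3 → C3} (hf : MemLp f 2 (volume : Measure R3)) :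
    ‖hf.toLp f‖ₑ ^ 2 = ∫⁻ x, ‖f x‖ₑ ^ 2 := by
  rw [Lp.enorm_toLp]
  have := eLpNorm_nnreal_pow_eq_lintegral (f := f) (μ := volume) (p := 2) (by norm_num)
  simpa using this

theorem FPair.lintegral_eq {f F : R3 → C3} (h : FPair f F) :
    ∫⁻ x, ‖f x‖ₑ ^ 2 = ∫⁻ x, ‖F x‖ₑ ^ 2 := by
  obtain ⟨h1, h2, h3⟩ := h
  rw [← enorm_toLp_sq h1, ← enorm_toLp_sq h2, ← h3, ← ofReal_norm, ← ofReal_norm,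
    Lp.norm_fourier_eq]

/-- Locally integrable functions which agree against all Schwartz functions agree a.e. -/
theorem ae_eq_of_schwartz {f g : R3 → C3} (hf : LocallyIntegrable f)
    (hg : LocallyIntegrable g)
    (h : ∀ φ : 𝓢(R3, ℂ), ∫ x, φ x • f x = ∫ x, φ x • g x) : f =ᵐ[volume] g := by
  refine ae_eq_of_integral_contDiff_smul_eq hf hg ?_
  intro η h1 h2
  have hg₁ : HasCompactSupport (Complex.ofRealCLM ∘ η) := h2.comp_left rfl
  have hg₂ : ContDiff ℝ ∞ (Complex.ofRealCLM ∘ η) := by fun_prop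
  have := h (hg₁.toSchwartzMap hg₂)
  simpa using this

/-- The inverse Fourier integral of an integrable, square integrable function. -/
theorem FPair.fourierInv_integral {a : R3 → C3} (ha : Integrable a)
    (ha2 : MemLp a 2 (volume : Measure R3)) : FPair (𝓕⁻ a) a := by
  obtain ⟨f, hf⟩ := FPair.exists_left ha2
  refine hf.congr ?_ (Filter.EventuallyEq.refl _ _)
  refine ae_eq_of_integral_contDiff_smul_eq (hf.memLp_left.locallyIntegrable (by norm_num))
    ?_ ?_
  · refine Continuous.locallyIntegrable ?_
    have : Continuous (𝓕 a) := VectorFourier.fourierIntegral_continuous Real.continuous_fourierChar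
      (by exact continuous_inner) ha
    have e : 𝓕⁻ a = fun x => 𝓕 a (-x) := by
      ext1 x; exact Real.fourierInv_eq_fourier_neg a x
    rw [e]
    exact this.comp continuous_neg
  · intro η h1 h2
    have hg₁ : HasCompactSupport (Complex.ofRealCLM ∘ η) := h2.comp_left rfl
    have hg₂ : ContDiff ℝ ∞ (Complex.ofRealCLM ∘ η) := by fun_prop
    -- The abstract `L²` preimage `f` and the pointwise integral `𝓕⁻ a` are compared as
    -- distributions. Both pairings with `g` are moved to the frequency side, where they coincide.
    let g : 𝓢(R3, ℂ) := hg₁.toSchwartzMap hg₂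
    have e1 : ∫ x, η x • f x = ∫ x, g x • f x := by simp [g]
    have e2 : ∫ x, η x • 𝓕⁻ a x = ∫ x, g x • 𝓕⁻ a x := by simp [g]
    rw [e1, e2]
    have e3 := hf.pairing (𝓕⁻ g)
    rw [FourierTransform.fourier_fourierInv_eq] at e3
    rw [e3]
    have e4 := VectorFourier.integral_fourierIntegral_smul_eq_flip
      (μ := (volume : Measure R3)) (ν := (volume : Measure R3)) (L := -innerₗ R3)
      (f := (g : R3 → ℂ)) (g := a) Real.continuous_fourierChar (by simpa [Pi.neg_def] using (continuous_inner (𝕜 := ℝ) (E := R3)).fun_neg) g.integrable ha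
    have e5 : (-innerₗ R3).flip = -innerₗ R3 := by
      ext x y
      simp [real_inner_comm]
    rw [e5] at e4
    rw [SchwartzMap.fourierInv_coe]
    exact e4

/-! ### Convolution with Schwartz kernels -/

/-- Convolution of a scalar kernel with a vector field. -/
noncomputable def conv (K : R3 → ℂ) (f : R3 → C3) (x : R3) : C3 := ∫ y, K (x - y) • f y

/-- The Schwartz function `y ↦ K (x - y)`. -/
noncomputable def reflShift (K : 𝓢(R3, ℂ)) (x : R3) : 𝓢(R3, ℂ) :=
  SchwartzMap.compSubConstCLM ℂ x
    (SchwartzMap.compCLMOfContinuousLinearEquiv ℂ (ContinuousLinearEquiv.neg ℝ) K)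

@[simp]
theorem reflShift_apply (K : 𝓢(R3, ℂ)) (x y : R3) : reflShift K x y = K (x - y) := by
  simp [reflShift]

theorem fourierInv_reflShift (K : 𝓢(R3, ℂ)) (x k : R3) :
    𝓕⁻ (reflShift K x) k = Real.fourierChar (inner ℝ k x) • 𝓕 K k := by
  rw [SchwartzMap.fourierInv_coe, SchwartzMap.fourier_coe, Real.fourierInv_eq, Real.fourier_eq,
    ← integral_sub_left_eq_self _ _ x, Circle.smul_def, ← integral_smul]
  refine integral_congr_ae (Filter.Eventually.of_forall fun y => ?_)
  simp only [reflShift_apply, sub_sub_cancel, inner_sub_left, Circle.smul_def]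
  rw [sub_eq_add_neg, AddChar.map_add_eq_mul, real_inner_comm k x, smul_smul, Circle.coe_mul]

theorem SchwartzMap.integrable_smul_memLp_two (g : 𝓢(R3, ℂ)) {F : R3 → C3}
    (hF : MemLp F 2 (volume : Measure R3)) : Integrable fun k => g k • F k := by
  have := hF.smul (p := 2) (q := 2) (r := 1) (g.memLp 2)
  exact memLp_one_iff_integrable.1 this

theorem SchwartzMap.memLp_smul_memLp_two (g : 𝓢(R3, ℂ)) {F : R3 → C3}
    (hF : MemLp F 2 (volume : Measure R3)) :
    MemLp (fun k => g k • F k) 2 (volume : Measure R3) :=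
  hF.smul (p := ∞) (q := 2) (r := 2) (g.memLp ∞)

/-- The value at `x` is the pairing of `f` with the Schwartz function `y ↦ K (x - y)`, so the
multiplication formula applies for every `x`, not just almost every one. Blocks of `v(t)` thereby
have values at each point, and these can be followed in time. -/
theorem conv_eq_fourierInv (K : 𝓢(R3, ℂ)) {f F : R3 → C3} (h : FPair f F) :
    conv K f = 𝓕⁻ (fun k => 𝓕 K k • F k) := by
  ext1 x
  have e := h.pairing (𝓕⁻ (reflShift K x))
  rw [FourierTransform.fourier_fourierInv_eq] at e
  simp only [reflShift_apply] at e
  rw [conv, e, Real.fourierInv_eq]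
  refine integral_congr_ae (Filter.Eventually.of_forall fun k => ?_)
  simp only [fourierInv_reflShift, Circle.smul_def, smul_assoc]

theorem FPair.conv (K : 𝓢(R3, ℂ)) {f F : R3 → C3} (h : FPair f F) :
    FPair (conv K f) (fun k => 𝓕 K k • F k) := by
  rw [conv_eq_fourierInv K h]
  exact FPair.fourierInv_integral ((𝓕 K).integrable_smul_memLp_two h.memLp_right)
    ((𝓕 K).memLp_smul_memLp_two h.memLp_right)

theorem fourier_lineDeriv_apply (K : 𝓢(R3, ℂ)) (j : Fin 3) (k : R3) :
    𝓕 (∂_{stdVec j} K) k = (2 * Real.pi * Complex.I * (k j : ℂ)) * 𝓕 K k := by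
  rw [SchwartzMap.fourier_lineDerivOp_eq, smul_apply,
    SchwartzMap.smulLeftCLM_apply_apply (by fun_prop)]
  have : inner ℝ k (stdVec j) = k j := by
    simp [stdVec, EuclideanSpace.inner_single_right]
  rw [this]
  simp [mul_assoc]

/-- The Laplacian of a kernel. -/
noncomputable def lapK (K : 𝓢(R3, ℂ)) : 𝓢(R3, ℂ) := ∑ j, ∂_{stdVec j} (∂_{stdVec j} K)

theorem lapK_apply (K : 𝓢(R3, ℂ)) (x : R3) :
    lapK K x = ∑ j, (∂_{stdVec j} (∂_{stdVec j} K)) x := by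
  simp [lapK]

theorem fourier_lapK_apply (K : 𝓢(R3, ℂ)) (k : R3) :
    𝓕 (lapK K) k = -(((2 * Real.pi) ^ 2 * ‖k‖ ^ 2 : ℝ) : ℂ) * 𝓕 K k := by
  have h : 𝓕 (lapK K) = ∑ j, 𝓕 (∂_{stdVec j} (∂_{stdVec j} K)) := by
    have := map_sum (FourierTransform.fourierCLM ℂ 𝓢(R3, ℂ))
      (fun j => ∂_{stdVec j} (∂_{stdVec j} K)) Finset.univ
    simpa [lapK] using this
  rw [h, sum_apply]
  simp only [fourier_lineDeriv_apply]
  rw [EuclideanSpace.norm_sq_eq]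
  simp only [Fin.sum_univ_three, Real.norm_eq_abs, sq_abs]
  push_cast
  linear_combination ((2 * (Real.pi : ℂ)) ^ 2 * ((k 0 : ℂ) ^ 2 + (k 1 : ℂ) ^ 2 + (k 2 : ℂ) ^ 2) * 𝓕 K k) * Complex.I_sq

theorem norm_complexify (w : R3 → R3) (x : R3) : ‖complexify w x‖ = ‖w x‖ := by
  simp [complexify, EuclideanSpace.norm_eq]

theorem enorm_complexify (w : R3 → R3) (x : R3) : ‖complexify w x‖ₑ = ‖w x‖ₑ := by
  rw [← ofReal_norm, ← ofReal_norm, norm_complexify]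

/-- The inclusion of `ℝ³` into `ℂ³`. -/
noncomputable def toC3 (a : R3) : C3 := WithLp.toLp 2 fun i => ((a i : ℝ) : ℂ)

theorem continuous_toC3 : Continuous toC3 := by
  unfold toC3; fun_prop

theorem memLp_complexify {w : R3 → R3} {p : ℝ≥0∞} (hw : MemLp w p (volume : Measure R3)) :
    MemLp (complexify w) p (volume : Measure R3) :=
  hw.of_le (continuous_toC3.comp_aestronglyMeasurable hw.1)
    (Filter.Eventually.of_forall fun x => (norm_complexify w x).le)

/-- `∫ |K * w|² dx` for a real vector field `w`. -/
noncomputable def convSq (K : 𝓢(R3, ℂ)) (w : R3 → R3) : ℝ≥0∞ :=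
  ∫⁻ x, ‖conv K (complexify w) x‖ₑ ^ 2

theorem convSq_eq {w : R3 → R3} {V : R3 → C3} (h : FPair (complexify w) V) (K : 𝓢(R3, ℂ)) :
    convSq K w = ∫⁻ k, ‖𝓕 K k‖ₑ ^ 2 * ‖V k‖ₑ ^ 2 := by
  rw [convSq, (h.conv K).lintegral_eq]
  simp only [enorm_smul, mul_pow]

/-! ### Blocks as convolutions, almost orthogonality, Bernstein inequalities -/

namespace LittlewoodPaley

variable (D : LittlewoodPaley)

theorem contDiff_multiplier (n : ℕ) : ContDiff ℝ ∞ (D.multiplier n) := by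
  have h1 := D.χ_smooth
  have h2 := D.φ_smooth
  cases n with
  | zero => unfold multiplier symbol; exact Complex.ofRealCLM.contDiff.comp (h1.comp (by fun_prop))
  | succ q =>
    unfold multiplier symbol
    exact Complex.ofRealCLM.contDiff.comp (h2.comp (by fun_prop))

theorem norm_le_of_symbol_ne_zero {n : ℕ} {ξ : R3} (h : D.symbol n ξ ≠ 0) :
    ‖ξ‖ ≤ 4 / 3 * 2 ^ n := by
  cases n with
  | zero =>
    have := D.χ_supp (subset_tsupport _ h)
    simpa using this
  | succ q =>
    have := (D.φ_supp (subset_tsupport _ h)).1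
    rw [mem_closedBall_zero_iff, norm_smul, norm_inv, norm_pow, Real.norm_ofNat,
      inv_mul_le_iff₀ (by positivity)] at this
    rw [pow_succ]
    linarith

theorem le_norm_of_symbol_ne_zero {n : ℕ} {ξ : R3} (h : D.symbol n ξ ≠ 0) (hn : n ≠ 0) :
    3 / 8 * 2 ^ n ≤ ‖ξ‖ := by
  cases n with
  | zero => exact absurd rfl hn
  | succ q =>
    have := (D.φ_supp (subset_tsupport _ h)).2
    rw [mem_ball_zero_iff, norm_smul, norm_inv, norm_pow, Real.norm_ofNat, not_lt,
      le_inv_mul_iff₀ (by positivity)] at this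
    rw [pow_succ]
    linarith

theorem norm_le_of_multiplier_ne_zero {n : ℕ} {k : R3} (h : D.multiplier n k ≠ 0) :
    2 * Real.pi * ‖k‖ ≤ 4 / 3 * 2 ^ n := by
  have := D.norm_le_of_symbol_ne_zero (n := n) (ξ := (2 * Real.pi) • k)
    (by simpa [multiplier] using h)
  rwa [norm_smul, Real.norm_of_nonneg (by positivity)] at this

theorem le_norm_of_multiplier_ne_zero {n : ℕ} {k : R3} (h : D.multiplier n k ≠ 0) (hn : n ≠ 0) :
    3 / 8 * 2 ^ n ≤ 2 * Real.pi * ‖k‖ := by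
  have := D.le_norm_of_symbol_ne_zero (n := n) (ξ := (2 * Real.pi) • k)
    (by simpa [multiplier] using h) hn
  rwa [norm_smul, Real.norm_of_nonneg (by positivity)] at this

theorem hasCompactSupport_multiplier (n : ℕ) : HasCompactSupport (D.multiplier n) := by
  refine HasCompactSupport.of_support_subset_isCompact
    (isCompact_closedBall (0 : R3) (4 / 3 * 2 ^ n)) fun k hk => ?_
  have := D.norm_le_of_multiplier_ne_zero hk
  rw [mem_closedBall_zero_iff]
  have h1 : 1 * ‖k‖ ≤ 2 * Real.pi * ‖k‖ := by
    gcongr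
    linarith [Real.pi_gt_three]
  linarith

theorem sum_symbol_sq (ξ : R3) :
    ∑' n, ENNReal.ofReal (D.symbol n ξ ^ 2) =
      ENNReal.ofReal (D.χ ξ ^ 2 + ∑' q : ℕ, D.φ (((2 : ℝ) ^ q)⁻¹ • ξ) ^ 2) := by
  have hs : Summable fun q : ℕ => D.φ (((2 : ℝ) ^ q)⁻¹ • ξ) ^ 2 := by
    obtain ⟨N, hN⟩ := pow_unbounded_of_one_lt (‖ξ‖ / (3 / 8)) (one_lt_two : (1 : ℝ) < 2)
    refine summable_of_ne_finset_zero (s := Finset.range N) fun q hq => ?_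
    by_contra hne
    have h0 : D.symbol (q + 1) ξ ≠ 0 := fun h => hne (by simp only [symbol] at h; simp [h])
    have h1 := D.le_norm_of_symbol_ne_zero h0 (by simp)
    have h2 : (2 : ℝ) ^ N ≤ 2 ^ (q + 1) := by
      gcongr
      · norm_num
      · simp at hq; omega
    rw [div_lt_iff₀ (by norm_num)] at hN
    linarith
  rw [ENNReal.ofReal_add (by positivity) (tsum_nonneg fun _ => by positivity),
    ENNReal.ofReal_tsum_of_nonneg (fun _ => by positivity) hs,
    tsum_eq_zero_add' ENNReal.summable]
  rfl

theorem enorm_multiplier_sq (n : ℕ) (k : R3) :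
    ‖D.multiplier n k‖ₑ ^ 2 = ENNReal.ofReal (D.symbol n ((2 * Real.pi) • k) ^ 2) := by
  rw [multiplier, ← ofReal_norm, ← ENNReal.ofReal_pow (norm_nonneg _), Complex.norm_real,
    Real.norm_eq_abs, sq_abs]

theorem sum_multiplier_sq_le (k : R3) : ∑' n, ‖D.multiplier n k‖ₑ ^ 2 ≤ 1 := by
  simp only [enorm_multiplier_sq, sum_symbol_sq]
  exact ENNReal.ofReal_le_one.2 (D.sum_sq_le_one _)

theorem one_le_sum_multiplier_sq (k : R3) : 1 ≤ 3 * ∑' n, ‖D.multiplier n k‖ₑ ^ 2 := by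
  simp only [enorm_multiplier_sq, sum_symbol_sq]
  rw [show (3 : ℝ≥0∞) = ENNReal.ofReal 3 by simp, ← ENNReal.ofReal_mul (by norm_num),
    ENNReal.one_le_ofReal]
  linarith [D.one_third_le ((2 * Real.pi) • k)]

theorem enorm_multiplier_le (n : ℕ) (k : R3) : ‖D.multiplier n k‖ₑ ≤ 1 := by
  have h : ‖D.multiplier n k‖ₑ ^ 2 ≤ 1 := (ENNReal.le_tsum n).trans (D.sum_multiplier_sq_le k)
  by_contra hc
  rw [not_le] at hc
  exact absurd h (not_le.2 (one_lt_pow₀ hc (by norm_num)))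

/-- The convolution kernel of the `n`-th block. -/
noncomputable def kern (n : ℕ) : 𝓢(R3, ℂ) :=
  𝓕⁻ ((D.hasCompactSupport_multiplier n).toSchwartzMap (D.contDiff_multiplier n))

theorem fourier_kern (n : ℕ) (k : R3) : 𝓕 (D.kern n) k = D.multiplier n k := by
  rw [kern, FourierTransform.fourier_fourierInv_eq]
  rfl

/-- Passes from the blocks defined on `L²` classes to convolution with a fixed Schwartz kernel, the
form in which the equation can be tested. -/
theorem blockNormSq_eq (n : ℕ) {w : R3 → R3} (hw : MemLp w 2 (volume : Measure R3)) :
    D.blockNormSq n w = convSq (D.kern n) w := by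
  have h := memLp_complexify hw
  obtain ⟨V, hV⟩ := FPair.exists_right h
  rw [convSq_eq hV, blockNormSq, dif_pos h, block]
  obtain ⟨h1, h2, h3⟩ := hV
  rw [h3, ← ofReal_norm,
    show ∀ f : Lp C3 2 (volume : Measure R3), ‖𝓕⁻ f‖ = ‖f‖ from
      fun f => (Lp.fourierTransformₗᵢ R3 C3).symm.norm_map f, ofReal_norm,
    Lp.enorm_def]
  have e := eLpNorm_nnreal_pow_eq_lintegral (μ := (volume : Measure R3)) (p := 2)
    (f := ⇑((D.memLp_multiplier n).toLp (D.multiplier n) • h2.toLp V :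
      Lp C3 2 (volume : Measure R3))) (by norm_num)
  simp only [ENNReal.coe_ofNat, NNReal.coe_ofNat, ENNReal.rpow_ofNat] at e
  rw [e]
  refine lintegral_congr_ae ?_
  filter_upwards [Lp.coeFn_lpSMul (r := 2) ((D.memLp_multiplier n).toLp (D.multiplier n))
    (h2.toLp V), (D.memLp_multiplier n).coeFn_toLp, h2.coeFn_toLp] with k e1 e2 e3
  rw [e1, Pi.smul_apply', e2, e3, fourier_kern, enorm_smul, mul_pow]

/-- `∫ |∇ Δₙ w|² dx`. -/
noncomputable def gradSq (n : ℕ) (w : R3 → R3) : ℝ≥0∞ :=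
  ∑ j, convSq (∂_{stdVec j} (D.kern n)) w

theorem convSq_kern_eq (n : ℕ) {w : R3 → R3} {V : R3 → C3} (h : FPair (complexify w) V) :
    convSq (D.kern n) w = ∫⁻ k, ‖D.multiplier n k‖ₑ ^ 2 * ‖V k‖ₑ ^ 2 := by
  rw [convSq_eq h]
  simp only [fourier_kern]

theorem _root_.FPair.aemeasurable_sq {f V : R3 → C3} (h : FPair f V) :
    AEMeasurable (fun k => ‖V k‖ₑ ^ 2) := h.memLp_right.1.enorm.pow_const 2

theorem measurable_multiplier (n : ℕ) : Measurable (D.multiplier n) :=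
  (D.contDiff_multiplier n).continuous.measurable

theorem _root_.sum_enorm_lineDeriv_sq (K : 𝓢(R3, ℂ)) (k : R3) :
    ∑ j, ‖𝓕 (∂_{stdVec j} K) k‖ₑ ^ 2 =
      ENNReal.ofReal ((2 * Real.pi * ‖k‖) ^ 2) * ‖𝓕 K k‖ₑ ^ 2 := by
  simp only [fourier_lineDeriv_apply, enorm_mul, mul_pow (_ * _ : ℝ≥0∞)]
  rw [← Finset.sum_mul, mul_pow (2 * Real.pi), EuclideanSpace.norm_sq_eq]
  simp only [Real.norm_eq_abs, sq_abs]
  congr 1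
  rw [ENNReal.ofReal_mul (by positivity), ENNReal.ofReal_sum_of_nonneg (fun _ _ => by positivity),
    Finset.mul_sum]
  refine Finset.sum_congr rfl fun j _ => ?_
  have e1 : ‖(k j : ℂ)‖ₑ ^ 2 = ENNReal.ofReal (k j ^ 2) := by
    rw [← ofReal_norm, ← ENNReal.ofReal_pow (norm_nonneg _), Complex.norm_real, Real.norm_eq_abs,
      sq_abs]
  have e2 : (‖(2 : ℂ)‖ₑ * ‖(Real.pi : ℂ)‖ₑ) ^ 2 * ‖Complex.I‖ₑ ^ 2
      = ENNReal.ofReal ((2 * Real.pi) ^ 2) := by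
    rw [← mul_pow, ← enorm_mul, ← enorm_mul, ← ofReal_norm,
      ← ENNReal.ofReal_pow (norm_nonneg _)]
    simp [abs_of_pos Real.pi_pos]
  rw [e1, e2]

theorem gradSq_eq (n : ℕ) {w : R3 → R3} {V : R3 → C3} (h : FPair (complexify w) V) :
    D.gradSq n w = ∫⁻ k, ‖D.multiplier n k‖ₑ ^ 2 *
      (ENNReal.ofReal ((2 * Real.pi * ‖k‖) ^ 2) * ‖V k‖ₑ ^ 2) := by
  simp only [gradSq, convSq_eq h]
  rw [← lintegral_finsetSum']
  · refine lintegral_congr fun k => ?_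
    rw [← Finset.sum_mul, sum_enorm_lineDeriv_sq, fourier_kern]
    ring
  · intro j _
    exact ((𝓕 (∂_{stdVec j} (D.kern n))).continuous.enorm.measurable.pow_const 2).aemeasurable.mul
      h.aemeasurable_sq

/-- Upper half of almost orthogonality, from the bound of the squared symbols by one. The density
`g` is arbitrary because it is used both for `|V|²` and for `|ξ|² |V|²`. -/
theorem tsum_lintegral_multiplier {g : R3 → ℝ≥0∞} (hg : AEMeasurable g) :
    ∑' n, ∫⁻ k, ‖D.multiplier n k‖ₑ ^ 2 * g k ≤ ∫⁻ k, g k := by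
  rw [← lintegral_tsum fun n =>
    ((D.measurable_multiplier n).enorm.pow_const 2).aemeasurable.fun_mul hg]
  refine lintegral_mono fun k => ?_
  simp only [ENNReal.tsum_mul_right]
  calc _ ≤ 1 * g k := by gcongr; exact D.sum_multiplier_sq_le k
    _ = g k := one_mul _

theorem lintegral_le_tsum_multiplier {g : R3 → ℝ≥0∞} (hg : AEMeasurable g) :
    ∫⁻ k, g k ≤ 3 * ∑' n, ∫⁻ k, ‖D.multiplier n k‖ₑ ^ 2 * g k := by
  rw [← lintegral_tsum fun n =>
    ((D.measurable_multiplier n).enorm.pow_const 2).aemeasurable.fun_mul hg,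
    ← lintegral_const_mul' _ _ (by norm_num)]
  refine lintegral_mono fun k => ?_
  simp only [ENNReal.tsum_mul_right]
  calc g k = 1 * g k := (one_mul _).symm
    _ ≤ (3 * ∑' n, ‖D.multiplier n k‖ₑ ^ 2) * g k := by
      gcongr; exact D.one_le_sum_multiplier_sq k
    _ = _ := by ring

theorem tsum_convSq_le {w : R3 → R3} (hw : MemLp w 2 (volume : Measure R3)) :
    ∑' n, convSq (D.kern n) w ≤ eLpNorm w 2 volume ^ 2 := by
  obtain ⟨V, hV⟩ := FPair.exists_right (memLp_complexify hw)
  simp only [D.convSq_kern_eq _ hV]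
  refine (D.tsum_lintegral_multiplier hV.aemeasurable_sq).trans ?_
  rw [← hV.lintegral_eq]
  have e := eLpNorm_nnreal_pow_eq_lintegral (μ := (volume : Measure R3)) (p := 2)
    (f := w) (by norm_num)
  simp only [ENNReal.coe_ofNat, NNReal.coe_ofNat, ENNReal.rpow_ofNat] at e
  simp only [e, enorm_complexify]
  exact le_rfl

theorem lintegral_sq_le_tsum_convSq {w : R3 → R3} (hw : MemLp w 2 (volume : Measure R3)) :
    ∫⁻ x, ‖w x‖ₑ ^ 2 ≤ 3 * ∑' n, convSq (D.kern n) w := by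
  obtain ⟨V, hV⟩ := FPair.exists_right (memLp_complexify hw)
  simp only [D.convSq_kern_eq _ hV]
  refine le_trans ?_ (D.lintegral_le_tsum_multiplier hV.aemeasurable_sq)
  rw [← hV.lintegral_eq]
  simp only [enorm_complexify]
  exact le_rfl

/-- On the support of block `n ≥ 1` one has `|ξ| ≥ (3/8) 2^n`, and `64/9 ≤ 8`. Block `0` contains
the zero frequency, so its gradient controls nothing; the extra term on the right is there for it.
-/
theorem four_pow_mul_convSq_le (n : ℕ) {w : R3 → R3} (hw : MemLp w 2 (volume : Measure R3)) :
    4 ^ n * convSq (D.kern n) w ≤ 8 * D.gradSq n w + convSq (D.kern n) w := by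
  obtain rfl | hn := eq_or_ne n 0
  · simp
  refine le_trans ?_ le_self_add
  obtain ⟨V, hV⟩ := FPair.exists_right (memLp_complexify hw)
  rw [D.convSq_kern_eq _ hV, D.gradSq_eq _ hV, ← lintegral_const_mul' _ _ (by norm_num),
    ← lintegral_const_mul' _ _ (by norm_num)]
  refine lintegral_mono fun k => ?_
  by_cases hk : D.multiplier n k = 0
  · simp [hk]
  have h1 := D.le_norm_of_multiplier_ne_zero hk hn
  have h2 : (4 : ℝ≥0∞) ^ n ≤ 8 * ENNReal.ofReal ((2 * Real.pi * ‖k‖) ^ 2) := by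
    rw [show (8 : ℝ≥0∞) = ENNReal.ofReal 8 by simp, show (4 : ℝ≥0∞) = ENNReal.ofReal 4 by simp,
      ← ENNReal.ofReal_mul (by norm_num), ← ENNReal.ofReal_pow (by norm_num)]
    refine ENNReal.ofReal_le_ofReal ?_
    have h3 : (3 / 8 * (2 : ℝ) ^ n) ^ 2 ≤ (2 * Real.pi * ‖k‖) ^ 2 := by gcongr
    rw [mul_pow, ← pow_mul, mul_comm n 2, pow_mul] at h3
    norm_num at h3
    have : (0 : ℝ) < 4 ^ n := by positivity
    linarith
  calc _ ≤ (8 * ENNReal.ofReal ((2 * Real.pi * ‖k‖) ^ 2)) *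
        (‖D.multiplier n k‖ₑ ^ 2 * ‖V k‖ₑ ^ 2) := by gcongr
    _ = _ := by ring

theorem gradSq_le (n : ℕ) {w : R3 → R3} (hw : MemLp w 2 (volume : Measure R3)) :
    D.gradSq n w ≤ 2 * 4 ^ n * convSq (D.kern n) w := by
  obtain ⟨V, hV⟩ := FPair.exists_right (memLp_complexify hw)
  rw [D.convSq_kern_eq _ hV, D.gradSq_eq _ hV,
    ← lintegral_const_mul' _ _ (ENNReal.mul_ne_top (by norm_num) (by simp))]
  refine lintegral_mono fun k => ?_
  by_cases hk : D.multiplier n k = 0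
  · simp [hk]
  have h1 := D.norm_le_of_multiplier_ne_zero hk
  have h2 : ENNReal.ofReal ((2 * Real.pi * ‖k‖) ^ 2) ≤ 2 * (4 : ℝ≥0∞) ^ n := by
    have e : (2 : ℝ≥0∞) * 4 ^ n = ENNReal.ofReal (2 * 4 ^ n) := by
      rw [ENNReal.ofReal_mul (by norm_num), ENNReal.ofReal_pow (by norm_num)]
      simp
    rw [e]
    refine ENNReal.ofReal_le_ofReal ?_
    -- The constant `2` of the statement exceeds `(4/3)² = 16/9`.
    have h3 : (2 * Real.pi * ‖k‖) ^ 2 ≤ (4 / 3 * (2 : ℝ) ^ n) ^ 2 := by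
      have := Real.pi_pos
      gcongr
    rw [mul_pow (4 / 3 : ℝ), ← pow_mul, mul_comm n 2, pow_mul] at h3
    norm_num at h3
    have : (0 : ℝ) < 4 ^ n := by positivity
    linarith
  calc _ ≤ ‖D.multiplier n k‖ₑ ^ 2 * (2 * 4 ^ n * ‖V k‖ₑ ^ 2) := by gcongr
    _ = _ := by ring

/-- High frequencies are controlled by the blocks of comparable or larger index. -/
theorem lintegral_high_le (n : ℕ) {w : R3 → R3} {V : R3 → C3} (h : FPair (complexify w) V)
    {S : Set R3} (hS : MeasurableSet S)
    (hS' : ∀ k ∈ S, n = 0 ∨ 2 ^ n / 16 ≤ 2 * Real.pi * ‖k‖) :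
    ∫⁻ k in S, ‖V k‖ₑ ^ 2 ≤ 3 * ∑' j, if n ≤ j + 4 then convSq (D.kern j) w else 0 := by
  rw [← lintegral_indicator hS]
  refine (D.lintegral_le_tsum_multiplier (h.aemeasurable_sq.indicator hS)).trans ?_
  gcongr with j
  split_ifs with hj
  · rw [D.convSq_kern_eq _ h]
    gcongr with k
    exact indicator_le_self _ _ _
  · refine le_of_eq ?_
    rw [lintegral_eq_zero_iff']
    · refine Filter.Eventually.of_forall fun k => ?_
      by_cases hk : k ∈ S
      · have hm : D.multiplier j k = 0 := by
          by_contra hm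
          have h1 := D.norm_le_of_multiplier_ne_zero hm
          obtain rfl | h2 := hS' k hk
          · simp at hj
          -- When `j + 5 ≤ n`, block `j` lives in `|ξ| ≤ (4/3) 2^{n-5} = 2^n / 24 < 2^n / 16` and so
          -- misses `S`. This is the origin of the offset `4`.
          have h3 : (2 : ℝ) ^ (j + 5) ≤ 2 ^ n := by
            gcongr
            · norm_num
            · omega
          rw [pow_add] at h3
          have : (0 : ℝ) < 2 ^ j := by positivity
          linarith
        simp [hm]
      · simp [hk]
    · exact ((D.measurable_multiplier j).enorm.pow_const 2).aemeasurable.mul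
        (h.aemeasurable_sq.indicator hS)

end LittlewoodPaley

/-! ### From compactly supported tests to Schwartz tests -/

/-- The weight `(1 + |x|)⁻⁴`, which is integrable on `ℝ³` and dominates Schwartz functions. -/
noncomputable def weight (x : R3) : ℝ := ((1 + ‖x‖) ^ 4)⁻¹

theorem weight_pos (x : R3) : 0 < weight x := by
  unfold weight; positivity

theorem weight_le_one (x : R3) : weight x ≤ 1 := by
  unfold weight
  exact inv_le_one_of_one_le₀ (one_le_pow₀ (by linarith [norm_nonneg x]))

theorem continuous_weight : Continuous weight := by
  unfold weight
  exact Continuous.inv₀ (by fun_prop) fun x => by positivity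

theorem integrable_weight : Integrable weight (volume : Measure R3) := by
  have h := integrable_one_add_norm (E := R3) (μ := volume) (r := 4) (by
    simp; norm_num)
  refine h.congr (Filter.Eventually.of_forall fun x => ?_)
  have : (0 : ℝ) ≤ 1 + ‖x‖ := by positivity
  simp only [weight]
  rw [Real.rpow_neg this]
  norm_cast

theorem memLp_weight_two : MemLp weight 2 (volume : Measure R3) := by
  refine (memLp_two_iff_integrable_sq continuous_weight.aestronglyMeasurable).2 ?_
  refine integrable_weight.mono' (continuous_weight.pow 2).aestronglyMeasurable
    (Filter.Eventually.of_forall fun x => ?_)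
  rw [Real.norm_of_nonneg (by positivity), sq]
  exact mul_le_of_le_one_left (weight_pos x).le (weight_le_one x)

theorem SchwartzMap.exists_iteratedFDeriv_le_weight {F : Type*} [NormedAddCommGroup F]
    [NormedSpace ℝ F] (f : 𝓢(R3, F)) :
    ∃ C : ℝ, 0 ≤ C ∧ ∀ i ≤ 2, ∀ x, ‖iteratedFDeriv ℝ i f x‖ ≤ C * weight x := by
  refine ⟨2 ^ 4 * ((Finset.Iic (4, 2)).sup fun m => SchwartzMap.seminorm ℝ m.1 m.2) f,
    by positivity, fun i hi x => ?_⟩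
  have := SchwartzMap.one_add_le_sup_seminorm_apply (𝕜 := ℝ) (m := (4, 2)) (k := 4) le_rfl hi f x
  rw [weight, ← div_eq_mul_inv, le_div_iff₀ (by positivity), mul_comm]
  exact this

theorem SchwartzMap.exists_le_weight {F : Type*} [NormedAddCommGroup F]
    [NormedSpace ℝ F] (f : 𝓢(R3, F)) :
    ∃ C : ℝ, 0 ≤ C ∧ ∀ x, ‖f x‖ ≤ C * weight x := by
  obtain ⟨C, h0, h⟩ := f.exists_iteratedFDeriv_le_weight
  exact ⟨C, h0, fun x => by simpa using h 0 (by norm_num) x⟩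

/-- Truncation of Schwartz functions: test functions which agree locally with `f` from some index
on, and which are dominated with two derivatives by the weight. -/
theorem SchwartzMap.exists_truncation (f : 𝓢(R3, ℝ)) :
    ∃ (η : ℕ → R3 → ℝ) (C : ℝ), (∀ m, IsTest (η m)) ∧
      (∀ m, ∀ i ≤ 2, ∀ x, ‖iteratedFDeriv ℝ i (η m) x‖ ≤ C * weight x) ∧
      ∀ x, ∀ᶠ m in Filter.atTop, η m =ᶠ[nhds x] f := by
  let θ : ContDiffBump (0 : R3) := ⟨1, 2, by norm_num, by norm_num⟩
  have hθ : ContDiff ℝ ∞ θ := θ.contDiff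
  let θS : 𝓢(R3, ℝ) := θ.hasCompactSupport.toSchwartzMap hθ
  obtain ⟨A, hA0, hA⟩ := θS.exists_iteratedFDeriv_le_weight
  have hA' : ∀ i ≤ 2, ∀ x, ‖iteratedFDeriv ℝ i θ x‖ ≤ A := fun i hi x =>
    (hA i hi x).trans (mul_le_of_le_one_right hA0 (weight_le_one x))
  obtain ⟨B, hB0, hB⟩ := f.exists_iteratedFDeriv_le_weight
  -- Since `c m ≤ 1`, the derivatives of the dilated cutoff `θ (c m • x)` are bounded uniformly in
  -- `m`.
  let c : ℕ → ℝ := fun m => ((m : ℝ) + 1)⁻¹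
  have hc0 : ∀ m, 0 < c m := fun m => by positivity
  have hc1 : ∀ m, c m ≤ 1 := fun m => inv_le_one_of_one_le₀ (by simp)
  have hsm : ∀ m, ContDiff ℝ ∞ fun x : R3 => θ (c m • x) := fun m => hθ.comp (by fun_prop)
  have hf : ContDiff ℝ ∞ f := f.smooth ⊤
  have hθd : ∀ m, ∀ i ≤ 2, ∀ x, ‖iteratedFDeriv ℝ i (fun x : R3 => θ (c m • x)) x‖ ≤ A := by
    intro m i hi x
    rw [iteratedFDeriv_comp_const_smul _ (hθ.of_le (by exact_mod_cast le_top))]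
    simp only [norm_smul, norm_pow]
    rw [Real.norm_of_nonneg (hc0 m).le]
    calc _ ≤ 1 * A := by
          gcongr
          · exact pow_le_one₀ (hc0 m).le (hc1 m)
          · exact hA' i hi _
      _ = A := one_mul A
  -- By Leibniz' rule the binomial coefficients add up to `2 ^ i`, at most `4` for `i ≤ 2`.
  refine ⟨fun m x => θ (c m • x) * f x, 4 * A * B, fun m => ⟨(hsm m).mul hf, ?_⟩, ?_, ?_⟩
  · refine HasCompactSupport.mul_right ?_
    refine HasCompactSupport.of_support_subset_isCompact
      (isCompact_closedBall (0 : R3) (2 * ((m : ℝ) + 1))) fun x hx => ?_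
    have h1 : c m • x ∈ Metric.ball (0 : R3) 2 := by
      have : c m • x ∈ Function.support θ := hx
      rwa [θ.support_eq] at this
    rw [mem_ball_zero_iff, norm_smul, Real.norm_of_nonneg (hc0 m).le,
      inv_mul_lt_iff₀ (by positivity)] at h1
    rw [mem_closedBall_zero_iff]
    linarith
  · intro m i hi x
    have h := norm_iteratedFDeriv_mul_le (hsm m) hf x (n := i) (by exact_mod_cast le_top)
    refine h.trans ?_
    have hw := (weight_pos x).le
    have hterm : ∀ l ∈ Finset.range (i + 1), (i.choose l : ℝ) *
        ‖iteratedFDeriv ℝ l (fun x : R3 => θ (c m • x)) x‖ * ‖iteratedFDeriv ℝ (i - l) f x‖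
        ≤ (i.choose l : ℝ) * (A * (B * weight x)) := by
      intro l hl
      rw [mul_assoc]
      have hl' : l ≤ i := by simpa [Nat.lt_succ_iff] using hl
      gcongr
      · exact hθd m l (hl'.trans hi) x
      · exact hB _ ((Nat.sub_le _ _).trans hi) x
    refine (Finset.sum_le_sum hterm).trans ?_
    rw [← Finset.sum_mul]
    have hsum : (∑ l ∈ Finset.range (i + 1), (i.choose l : ℝ)) = 2 ^ i := by
      exact_mod_cast Nat.sum_range_choose i
    rw [hsum]
    have h4 : (2 : ℝ) ^ i ≤ 4 := by
      calc (2 : ℝ) ^ i ≤ 2 ^ 2 := by gcongr; norm_num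
        _ = 4 := by norm_num
    calc _ ≤ 4 * (A * (B * weight x)) := by gcongr
      _ = _ := by ring
  · intro x
    obtain ⟨N, hN⟩ := exists_nat_gt (‖x‖)
    filter_upwards [Filter.eventually_ge_atTop N] with m hm
    have hx : ‖x‖ < (m : ℝ) + 1 := by
      have : (N : ℝ) ≤ m := by exact_mod_cast hm
      linarith
    have hopen : ∀ᶠ y in nhds x, ‖y‖ < (m : ℝ) + 1 := continuous_norm.continuousAt.eventually_lt
      continuousAt_const hx
    filter_upwards [hopen] with y hy
    have : θ (c m • y) = 1 := by
      apply θ.one_of_mem_closedBall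
      rw [mem_closedBall_zero_iff, norm_smul, Real.norm_of_nonneg (hc0 m).le,
        inv_mul_le_iff₀ (by positivity)]
      change ‖y‖ ≤ ((m : ℝ) + 1) * 1
      simpa using hy.le
    rw [this, one_mul]

theorem abs_fderiv_stdVec_le (η : R3 → ℝ) (x : R3) (j : Fin 3) :
    |fderiv ℝ η x (stdVec j)| ≤ ‖iteratedFDeriv ℝ 1 η x‖ := by
  rw [norm_iteratedFDeriv_one]
  have := (fderiv ℝ η x).le_opNorm (stdVec j)
  simpa [stdVec] using this

theorem laplacian_eq_sum_stdVec (η : R3 → ℝ) (x : R3) :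
    Laplacian.laplacian η x = ∑ j, iteratedFDeriv ℝ 2 η x ![stdVec j, stdVec j] := by
  rw [InnerProductSpace.laplacian_eq_iteratedFDeriv_orthonormalBasis η
    (EuclideanSpace.basisFun (Fin 3) ℝ)]
  simp [stdVec]

theorem abs_laplacian_le (η : R3 → ℝ) (x : R3) :
    |Laplacian.laplacian η x| ≤ 3 * ‖iteratedFDeriv ℝ 2 η x‖ := by
  rw [laplacian_eq_sum_stdVec]
  refine (Finset.abs_sum_le_sum_abs _ _).trans ?_
  have : ∀ j ∈ Finset.univ, |iteratedFDeriv ℝ 2 η x ![stdVec j, stdVec j]| ≤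
      ‖iteratedFDeriv ℝ 2 η x‖ := by
    intro j _
    have := (iteratedFDeriv ℝ 2 η x).le_opNorm ![stdVec j, stdVec j]
    simpa [stdVec] using this
  refine (Finset.sum_le_sum this).trans ?_
  simp

/-- An identity tested with functions in `C_c^∞` extends to Schwartz functions. -/
theorem integral_test_schwartz_real {a c : R3 → ℝ} {b : Fin 3 → R3 → ℝ}
    (ha : Integrable fun x => weight x * a x) (hb : ∀ j, Integrable fun x => weight x * b j x)
    (hc : Integrable fun x => weight x * c x)
    (h : ∀ η, IsTest η → ∫ x, (a x * η x + ∑ j, b j x * fderiv ℝ η x (stdVec j)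
      + c x * Laplacian.laplacian η x) = 0) (f : 𝓢(R3, ℝ)) :
    ∫ x, (a x * f x + ∑ j, b j x * fderiv ℝ f x (stdVec j)
      + c x * Laplacian.laplacian (f : R3 → ℝ) x) = 0 := by
  obtain ⟨η, C, h1, h2, h3⟩ := f.exists_truncation
  have hwm : AEStronglyMeasurable (fun x => (weight x)⁻¹) (volume : Measure R3) :=
    (continuous_weight.inv₀ fun x => (weight_pos x).ne').aestronglyMeasurable
  have hm : ∀ {p : R3 → ℝ}, Integrable (fun x => weight x * p x) →
      AEStronglyMeasurable p (volume : Measure R3) := by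
    intro p hp
    refine (hwm.mul hp.1).congr (Filter.Eventually.of_forall fun x => ?_)
    simp [(weight_pos x).ne']
  -- The three weighted integrability assumptions provide the majorant. Pointwise convergence holds
  -- because the truncations agree with `f` near each point from some index on.
  have hlim := tendsto_integral_of_dominated_convergence
    (F := fun m x => a x * η m x + ∑ j, b j x * fderiv ℝ (η m) x (stdVec j)
      + c x * Laplacian.laplacian (η m) x)
    (f := fun x => a x * f x + ∑ j, b j x * fderiv ℝ f x (stdVec j)
      + c x * Laplacian.laplacian (f : R3 → ℝ) x) (μ := volume)
    (fun x => |C| * (|weight x * a x| + ∑ j, |weight x * b j x| + 3 * |weight x * c x|))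
    ?_ ?_ ?_ ?_
  · exact tendsto_nhds_unique (hlim.congr fun m => h _ (h1 m)) tendsto_const_nhds
  · intro m
    have hs := (h1 m).1
    refine AEStronglyMeasurable.add (AEStronglyMeasurable.add ?_ ?_) ?_
    · exact (hm ha).mul hs.continuous.aestronglyMeasurable
    · refine Finset.aestronglyMeasurable_fun_sum _ fun j _ => (hm (hb j)).mul ?_
      exact ((hs.continuous_fderiv (by simp)).clm_apply continuous_const).aestronglyMeasurable
    · refine (hm hc).mul (Continuous.aestronglyMeasurable ?_)
      change Continuous fun x => Laplacian.laplacian (η m) x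
      simp only [laplacian_eq_sum_stdVec]
      refine continuous_finsetSum _ fun j _ => ?_
      have h2 : Continuous (iteratedFDeriv ℝ 2 (η m)) :=
        hs.continuous_iteratedFDeriv (m := 2) (WithTop.coe_le_coe.2 le_top)
      exact (ContinuousMultilinearMap.apply ℝ (fun _ : Fin 2 => R3) ℝ
        ![stdVec j, stdVec j]).continuous.comp h2
  · exact ((ha.abs.add (integrable_finsetSum _ fun j _ => (hb j).abs)).add
      (hc.abs.const_mul 3)).const_mul _
  · intro m
    refine Filter.Eventually.of_forall fun x => ?_
    have hw := (weight_pos x).le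
    have hC : ∀ i ≤ 2, ‖iteratedFDeriv ℝ i (η m) x‖ ≤ |C| * weight x := fun i hi =>
      (h2 m i hi x).trans (by gcongr; exact le_abs_self C)
    have e0 : |η m x| ≤ |C| * weight x := by simpa using hC 0 (by norm_num)
    have e1 : ∀ j, |fderiv ℝ (η m) x (stdVec j)| ≤ |C| * weight x := fun j =>
      (abs_fderiv_stdVec_le _ _ _).trans (hC 1 (by norm_num))
    have e2 : |Laplacian.laplacian (η m) x| ≤ 3 * (|C| * weight x) :=
      (abs_laplacian_le _ _).trans (by gcongr; exact hC 2 le_rfl)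
    rw [Real.norm_eq_abs]
    calc _ ≤ |a x| * |η m x| + ∑ j, |b j x| * |fderiv ℝ (η m) x (stdVec j)|
          + |c x| * |Laplacian.laplacian (η m) x| := by
          refine (abs_add_le _ _).trans ?_
          rw [abs_mul]
          gcongr
          refine (abs_add_le _ _).trans ?_
          rw [abs_mul]
          gcongr
          refine (Finset.abs_sum_le_sum_abs _ _).trans (le_of_eq ?_)
          simp only [abs_mul]
      _ ≤ |a x| * (|C| * weight x) + ∑ j, |b j x| * (|C| * weight x)
          + |c x| * (3 * (|C| * weight x)) := by
          gcongr with j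
          exact e1 j
      _ = _ := by
          simp only [abs_mul, abs_of_pos (weight_pos x), Fin.sum_univ_three]
          ring
  · refine Filter.Eventually.of_forall fun x => ?_
    refine tendsto_const_nhds.congr' ?_
    filter_upwards [h3 x] with m hm
    rw [hm.eq_of_nhds, hm.fderiv_eq, (InnerProductSpace.laplacian_congr_nhds hm).eq_of_nhds]

theorem lineDeriv_postcomp (L : ℂ →L[ℝ] ℝ) (g : 𝓢(R3, ℂ)) (v : R3) :
    ∂_{v} (SchwartzMap.postcompCLM (𝕜 := ℝ) L g) =
      SchwartzMap.postcompCLM (𝕜 := ℝ) L (∂_{v} g) := by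
  ext x
  rw [SchwartzMap.lineDerivOp_apply_eq_fderiv, SchwartzMap.postcompCLM_apply,
    SchwartzMap.lineDerivOp_apply_eq_fderiv]
  have : (SchwartzMap.postcompCLM (𝕜 := ℝ) L g : R3 → ℝ) = L ∘ g := by
    ext y; simp
  rw [this, (L.hasFDerivAt.comp x (g.hasFDerivAt x)).fderiv]
  rfl

theorem laplacian_postcomp (L : ℂ →L[ℝ] ℝ) (g : 𝓢(R3, ℂ)) (x : R3) :
    Laplacian.laplacian (SchwartzMap.postcompCLM (𝕜 := ℝ) L g : R3 → ℝ) x = L (lapK g x) := by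
  rw [← SchwartzMap.laplacian_apply,
    SchwartzMap.laplacian_eq_sum (EuclideanSpace.basisFun (Fin 3) ℝ), lapK_apply, map_sum]
  have : ∀ j, EuclideanSpace.basisFun (Fin 3) ℝ j = stdVec j := fun j => by simp [stdVec]
  simp only [this, lineDeriv_postcomp, sum_apply, SchwartzMap.postcompCLM_apply]

theorem aestronglyMeasurable_of_weight {p : R3 → ℝ} (hp : Integrable fun x => weight x * p x) :
    AEStronglyMeasurable p (volume : Measure R3) := by
  have hwm : AEStronglyMeasurable (fun x => (weight x)⁻¹) (volume : Measure R3) :=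
    (continuous_weight.inv₀ fun x => (weight_pos x).ne').aestronglyMeasurable
  refine (hwm.mul hp.1).congr (Filter.Eventually.of_forall fun x => ?_)
  simp [(weight_pos x).ne']

theorem integrable_mul_schwartz {p : R3 → ℝ} (hp : Integrable fun x => weight x * p x)
    (g : 𝓢(R3, ℂ)) : Integrable fun x => (p x : ℂ) * g x := by
  obtain ⟨C, h0, h⟩ := g.exists_le_weight
  refine (hp.norm.const_mul C).mono' ?_ (Filter.Eventually.of_forall fun x => ?_)
  · exact (Complex.continuous_ofReal.comp_aestronglyMeasurable
      (aestronglyMeasurable_of_weight hp)).mul g.continuous.aestronglyMeasurable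
  · rw [norm_mul, Complex.norm_real, norm_mul, Real.norm_of_nonneg (weight_pos x).le]
    calc _ ≤ ‖p x‖ * (C * weight x) := by gcongr; exact h x
      _ = _ := by ring

/-- An identity tested with real functions in `C_c^∞` extends to complex Schwartz functions. -/
theorem integral_test_schwartz {a c : R3 → ℝ} {b : Fin 3 → R3 → ℝ}
    (ha : Integrable fun x => weight x * a x) (hb : ∀ j, Integrable fun x => weight x * b j x)
    (hc : Integrable fun x => weight x * c x)
    (h : ∀ η, IsTest η → ∫ x, (a x * η x + ∑ j, b j x * fderiv ℝ η x (stdVec j)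
      + c x * Laplacian.laplacian η x) = 0) (g : 𝓢(R3, ℂ)) :
    ∫ x, ((a x : ℂ) * g x + ∑ j, (b j x : ℂ) * (∂_{stdVec j} g) x + (c x : ℂ) * lapK g x) = 0 := by
  have hint : Integrable fun x =>
      ((a x : ℂ) * g x + ∑ j, (b j x : ℂ) * (∂_{stdVec j} g) x + (c x : ℂ) * lapK g x) :=
    ((integrable_mul_schwartz ha g).add (integrable_finsetSum _ fun j _ =>
      integrable_mul_schwartz (hb j) _)).add (integrable_mul_schwartz hc _)
  -- A real linear functional commutes with derivatives and with the real coefficients, so the real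
  -- identity applies to `L ∘ g`. Real and imaginary parts then determine the complex integral.
  have key : ∀ L : ℂ →L[ℝ] ℝ, L (∫ x, ((a x : ℂ) * g x + ∑ j, (b j x : ℂ) * (∂_{stdVec j} g) x
      + (c x : ℂ) * lapK g x)) = 0 := by
    intro L
    rw [← L.integral_comp_comm hint]
    have e := integral_test_schwartz_real ha hb hc h (SchwartzMap.postcompCLM (𝕜 := ℝ) L g)
    refine Eq.trans (integral_congr_ae (Filter.Eventually.of_forall fun x => ?_)) e
    have hm : ∀ (r : ℝ) (z : ℂ), L ((r : ℂ) * z) = r * L z := fun r z => by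
      rw [← Complex.real_smul, map_smul, smul_eq_mul]
    simp only [map_add, map_sum, hm, laplacian_postcomp, SchwartzMap.postcompCLM_apply]
    congr 2
    refine Finset.sum_congr rfl fun j _ => ?_
    rw [← SchwartzMap.lineDerivOp_apply_eq_fderiv, lineDeriv_postcomp,
      SchwartzMap.postcompCLM_apply]
  exact Complex.ext (key Complex.reCLM) (key Complex.imCLM)

/-! ### Divergence, curl and weak derivatives against Schwartz functions -/

/-- The components of `w` are integrable against the weight. -/
def WeightIntegrable (w : R3 → R3) : Prop := ∀ i, Integrable fun x => weight x * w x i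

theorem abs_apply_le_norm (a : R3) (i : Fin 3) : |a i| ≤ ‖a‖ :=
  PiLp.norm_apply_le a i

theorem memLp_apply {w : R3 → R3} {p : ℝ≥0∞} (hw : MemLp w p (volume : Measure R3)) (i : Fin 3) :
    MemLp (fun x => w x i) p (volume : Measure R3) :=
  hw.of_le ((EuclideanSpace.proj (𝕜 := ℝ) i).continuous.comp_aestronglyMeasurable hw.1)
    (Filter.Eventually.of_forall fun _ => abs_apply_le_norm _ _)

theorem weightIntegrable_of_two {w : R3 → R3} (hw : MemLp w 2 (volume : Measure R3)) :
    WeightIntegrable w := fun i =>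
  memLp_one_iff_integrable.1 ((memLp_apply hw i).smul (p := 2) (q := 2) (r := 1) memLp_weight_two)

theorem weightIntegrable_of_top {w : R3 → R3} (hw : MemLp w ∞ (volume : Measure R3)) :
    WeightIntegrable w := fun i =>
  memLp_one_iff_integrable.1 ((memLp_apply hw i).smul (p := 1) (q := ∞) (r := 1)
    (memLp_one_iff_integrable.2 integrable_weight))

/-- The pairing of the `i`-th component of a vector field with a Schwartz function. -/
noncomputable def pair (w : R3 → R3) (i : Fin 3) (g : 𝓢(R3, ℂ)) : ℂ := ∫ x, (w x i : ℂ) * g x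

theorem pair_add {w : R3 → R3} (hw : WeightIntegrable w) (i : Fin 3) (g h : 𝓢(R3, ℂ)) :
    pair w i (g + h) = pair w i g + pair w i h := by
  rw [pair, pair, pair, ← integral_add (integrable_mul_schwartz (hw i) g)
    (integrable_mul_schwartz (hw i) h)]
  simp [mul_add]

theorem pair_neg (w : R3 → R3) (i : Fin 3) (g : 𝓢(R3, ℂ)) : pair w i (-g) = -pair w i g := by
  simp [pair, integral_neg]

theorem pair_lapK {w : R3 → R3} (hw : WeightIntegrable w) (i : Fin 3) (g : 𝓢(R3, ℂ)) :
    pair w i (lapK g) = ∑ j, pair w i (∂_{stdVec j} (∂_{stdVec j} g)) := by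
  rw [lapK, Fin.sum_univ_three, Fin.sum_univ_three, pair_add hw, pair_add hw]

theorem integral_pair_sum {w : Fin 3 → R3 → R3} (hw : ∀ j, WeightIntegrable (w j)) (i : Fin 3 → Fin 3)
    (g : Fin 3 → 𝓢(R3, ℂ)) :
    ∫ x, ∑ j, (w j x (i j) : ℂ) * g j x = ∑ j, pair (w j) (i j) (g j) :=
  integral_finsetSum _ fun j _ => integrable_mul_schwartz (hw j (i j)) (g j)

theorem lineDeriv_comm (g : 𝓢(R3, ℂ)) (i j : Fin 3) :
    ∂_{stdVec i} (∂_{stdVec j} g) = ∂_{stdVec j} (∂_{stdVec i} g) := by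
  apply (FourierTransform.fourierEquiv ℂ 𝓢(R3, ℂ)).injective
  ext k
  change 𝓕 (∂_{stdVec i} (∂_{stdVec j} g)) k = 𝓕 (∂_{stdVec j} (∂_{stdVec i} g)) k
  simp only [fourier_lineDeriv_apply]
  ring

theorem IsWeaklyDivFree.pair_eq_zero {u : R3 → R3} (h : IsWeaklyDivFree u)
    (hu : WeightIntegrable u) (g : 𝓢(R3, ℂ)) : ∑ j, pair u j (∂_{stdVec j} g) = 0 := by
  have := integral_test_schwartz (a := 0) (c := 0) (b := fun j x => u x j) (by simp) hu (by simp)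
    (fun η hη => by
      refine Eq.trans (integral_congr_ae (Filter.Eventually.of_forall fun x => ?_)) (h.2 η hη)
      have e : u x = ∑ j, u x j • stdVec j := by
        ext l
        fin_cases l <;> simp [stdVec, Fin.sum_univ_three]
      conv_rhs => rw [e]
      simp [map_sum]) g
  rw [← integral_pair_sum (fun _ => hu)]
  simpa using this

theorem IsTest.fderiv_apply {η : R3 → ℝ} (h : IsTest η) (v : R3) :
    IsTest fun x => fderiv ℝ η x v :=
  ⟨h.1.fderiv_right (m := ∞) (by simp) |>.clm_apply contDiff_const,
    h.2.fderiv_apply (𝕜 := ℝ) v⟩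

theorem IsTest.integrable_mul {η p : R3 → ℝ} (h : IsTest η)
    (hp : Integrable fun x => weight x * p x) : Integrable fun x => p x * η x := by
  obtain ⟨C, h0, hC⟩ := (h.2.toSchwartzMap h.1).exists_le_weight
  refine (hp.norm.const_mul C).mono' ((aestronglyMeasurable_of_weight hp).mul
    h.1.continuous.aestronglyMeasurable) (Filter.Eventually.of_forall fun x => ?_)
  rw [norm_mul, norm_mul, Real.norm_of_nonneg (weight_pos x).le]
  calc _ ≤ ‖p x‖ * (C * weight x) := by gcongr; exact hC x
    _ = _ := by ring

theorem IsWeakCurl.pair_eq {u v : R3 → R3} (h : IsWeakCurl u v) (hu : WeightIntegrable u)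
    (hv : WeightIntegrable v) (i : Fin 3) (g : 𝓢(R3, ℂ)) :
    pair v i g = pair u (i + 1) (∂_{stdVec (i + 2)} g) - pair u (i + 2) (∂_{stdVec (i + 1)} g) := by
  -- Coefficients of the first order operator whose pairing with the gradient of the test function
  -- is the `i`-th curl component.
  let b : Fin 3 → R3 → ℝ := fun j x =>
    if j = i + 1 then u x (i + 2) else if j = i + 2 then -u x (i + 1) else 0
  have hb : ∀ j, Integrable fun x => weight x * b j x := by
    intro j
    by_cases h1 : j = i + 1
    · simpa [b, h1] using hu (i + 2)
    by_cases h2 : j = i + 2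
    · have h3 : i + 2 ≠ i + 1 := by rw [← h2]; exact h1
      simpa [b, h2, h3] using (hu (i + 1)).neg
    · simp [b, h1, h2]
  have hsum : ∀ (x : R3) (G : Fin 3 → ℂ), ∑ j, (b j x : ℂ) * G j =
      (u x (i + 2) : ℂ) * G (i + 1) - (u x (i + 1) : ℂ) * G (i + 2) := by
    intro x G
    fin_cases i <;> simp [b, Fin.sum_univ_three] <;> ring
  have hsumR : ∀ (x : R3) (G : Fin 3 → ℝ), ∑ j, b j x * G j =
      u x (i + 2) * G (i + 1) - u x (i + 1) * G (i + 2) := by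
    intro x G
    have := hsum x (fun j => (G j : ℂ))
    exact_mod_cast this
  have := integral_test_schwartz (a := fun x => v x i) (c := 0) (b := b) (hv i) hb (by simp)
    (fun η hη => by
      have e := h.2.2 η hη i
      have i1 : Integrable fun x => v x i * η x := hη.integrable_mul (hv i)
      have i2 : Integrable fun x => u x (i + 2) * fderiv ℝ η x (stdVec (i + 1))
          - u x (i + 1) * fderiv ℝ η x (stdVec (i + 2)) :=
        ((hη.fderiv_apply _).integrable_mul (hu _)).sub
          ((hη.fderiv_apply _).integrable_mul (hu _))
      simp only [hsumR, Pi.zero_apply, zero_mul, add_zero]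
      rw [integral_add i1 i2, e, neg_add_cancel]) g
  simp only [hsum, Pi.zero_apply, Complex.ofReal_zero, zero_mul, add_zero] at this
  have i1 := integrable_mul_schwartz (hv i) g
  have i2 := integrable_mul_schwartz (hu (i + 2)) (∂_{stdVec (i + 1)} g)
  have i3 := integrable_mul_schwartz (hu (i + 1)) (∂_{stdVec (i + 2)} g)
  have i4 : Integrable fun x => (u x (i + 2) : ℂ) * (∂_{stdVec (i + 1)} g) x
      - (u x (i + 1) : ℂ) * (∂_{stdVec (i + 2)} g) x := i2.sub i3
  rw [integral_add i1 i4, integral_sub i2 i3] at this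
  rw [pair, pair, pair]
  linear_combination this

/-- `-Δ u = curl v` if `v = curl u` and `div u = 0`. -/
theorem pair_laplacian_eq {u v : R3 → R3} (hd : IsWeaklyDivFree u) (hc : IsWeakCurl u v)
    (hu : WeightIntegrable u) (hv : WeightIntegrable v) (i : Fin 3) (g : 𝓢(R3, ℂ)) :
    pair u i (lapK g) =
      pair v (i + 2) (∂_{stdVec (i + 1)} g) - pair v (i + 1) (∂_{stdVec (i + 2)} g) := by
  -- The identity `curl curl = ∇ div - Δ`: testing the divergence with `∂_i g` removes the gradient
  -- term, and commuting mixed derivatives does the rest.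
  have h0 := hd.pair_eq_zero hu (∂_{stdVec i} g)
  rw [pair_lapK hu, hc.pair_eq hu hv, hc.pair_eq hu hv]
  fin_cases i <;> simp [Fin.sum_univ_three] at h0 ⊢
  · rw [lineDeriv_comm g 0 1, lineDeriv_comm g 0 2]
    linear_combination h0
  · rw [lineDeriv_comm g 1 2, lineDeriv_comm g 1 0]
    linear_combination h0
  · rw [lineDeriv_comm g 2 0, lineDeriv_comm g 2 1]
    linear_combination h0

theorem lineDeriv_reflShift (K : 𝓢(R3, ℂ)) (x v : R3) :
    ∂_{v} (reflShift K x) = -reflShift (∂_{v} K) x := by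
  ext y
  rw [SchwartzMap.lineDerivOp_apply_eq_fderiv, neg_apply, reflShift_apply,
    SchwartzMap.lineDerivOp_apply_eq_fderiv]
  have h1 : HasFDerivAt (fun y : R3 => x - y) (-ContinuousLinearMap.id ℝ R3) y :=
    (hasFDerivAt_id y).const_sub x
  have h2 := (K.hasFDerivAt (x - y)).comp y h1
  have h3 : (reflShift K x : R3 → ℂ) = K ∘ fun y => x - y := by ext y; simp
  rw [h3, h2.fderiv]
  simp

theorem lapK_reflShift (K : 𝓢(R3, ℂ)) (x : R3) :
    lapK (reflShift K x) = reflShift (lapK K) x := by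
  ext y
  have : ∀ v w : R3, ∂_{v} (-reflShift (∂_{w} K) x) = reflShift (∂_{v} (∂_{w} K)) x := fun v w => by
    rw [LineDeriv.lineDerivOp_neg, lineDeriv_reflShift, neg_neg]
  simp only [lapK_apply, lineDeriv_reflShift, this, reflShift_apply]

theorem integrable_smul_complexify {w : R3 → R3} (hw : WeightIntegrable w) (g : 𝓢(R3, ℂ)) :
    Integrable fun y => g y • complexify w y := by
  have h : ∀ i, Integrable fun y => (g y • complexify w y) i := fun i => by
    refine (integrable_mul_schwartz (hw i) g).congr (Filter.Eventually.of_forall fun y => ?_)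
    simp [complexify, mul_comm]
  have e : (fun y => g y • complexify w y) = fun y =>
      ∑ i, EuclideanSpace.single i ((g y • complexify w y) i) := by
    ext y l
    simp
  rw [e]
  refine integrable_finsetSum _ fun i _ => ?_
  refine ((h i).smul_const (EuclideanSpace.single i (1 : ℂ) : C3)).congr
    (Filter.Eventually.of_forall fun y => ?_)
  ext l
  simp

theorem integral_smul_complexify_apply {w : R3 → R3} (hw : WeightIntegrable w) (g : 𝓢(R3, ℂ))
    (i : Fin 3) : (∫ y, g y • complexify w y) i = pair w i g := by
  have := (EuclideanSpace.proj (𝕜 := ℂ) i).integral_comp_comm (integrable_smul_complexify hw g)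
  refine this.symm.trans (integral_congr_ae (Filter.Eventually.of_forall fun y => ?_))
  simp [complexify, mul_comm]

theorem conv_complexify_apply {w : R3 → R3} (hw : WeightIntegrable w) (K : 𝓢(R3, ℂ)) (x : R3)
    (i : Fin 3) : conv K (complexify w) x i = pair w i (reflShift K x) := by
  rw [← integral_smul_complexify_apply hw]
  simp [conv]

/-- `K * v = curl (K * u)`. -/
theorem conv_curl_apply {u v : R3 → R3} (hc : IsWeakCurl u v)
    (hu : WeightIntegrable u) (hv : WeightIntegrable v) (K : 𝓢(R3, ℂ)) (x : R3) (i : Fin 3) :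
    conv K (complexify v) x i = conv (∂_{stdVec (i + 1)} K : 𝓢(R3, ℂ)) (complexify u) x (i + 2)
      - conv (∂_{stdVec (i + 2)} K : 𝓢(R3, ℂ)) (complexify u) x (i + 1) := by
  rw [conv_complexify_apply hv, conv_complexify_apply hu, conv_complexify_apply hu,
    hc.pair_eq hu hv, lineDeriv_reflShift, lineDeriv_reflShift, pair_neg, pair_neg]
  ring

/-- `Δ K * u = -curl (K * v)`. -/
theorem conv_lapK_apply {u v : R3 → R3} (hd : IsWeaklyDivFree u) (hc : IsWeakCurl u v)
    (hu : WeightIntegrable u) (hv : WeightIntegrable v) (K : 𝓢(R3, ℂ)) (x : R3) (i : Fin 3) :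
    conv (lapK K) (complexify u) x i =
      conv (∂_{stdVec (i + 2)} K : 𝓢(R3, ℂ)) (complexify v) x (i + 1)
      - conv (∂_{stdVec (i + 1)} K : 𝓢(R3, ℂ)) (complexify v) x (i + 2) := by
  rw [conv_complexify_apply hv, conv_complexify_apply hv, conv_complexify_apply hu,
    ← lapK_reflShift, pair_laplacian_eq hd hc hu hv, lineDeriv_reflShift, lineDeriv_reflShift,
    pair_neg, pair_neg]
  ring

theorem norm_conv_le {u : R3 → R3} {U : ℝ} (hU : ∀ᵐ x, ‖u x‖ ≤ U) (K : 𝓢(R3, ℂ)) (x : R3) :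
    ‖conv K (complexify u) x‖ ≤ U * ∫ y, ‖K y‖ := by
  rw [← integral_sub_left_eq_self (fun y => ‖K y‖) _ x, ← integral_const_mul]
  refine norm_integral_le_of_norm_le ?_ ?_
  · refine Integrable.const_mul ?_ _
    have := (reflShift K x).integrable (μ := (volume : Measure R3)) |>.norm
    simpa using this
  · filter_upwards [hU] with y hy
    rw [norm_smul, norm_complexify, mul_comm]
    gcongr

/-- The Fourier transform of a weak derivative. -/
theorem HasWeakPartial.fPair {w g : R3 → R3} {j : Fin 3} (h : HasWeakPartial j w g)
    (hw : MemLp w 2 (volume : Measure R3)) (hg : MemLp g 2 (volume : Measure R3))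
    {V : R3 → C3} (hV : FPair (complexify w) V) :
    FPair (complexify g) fun k => (2 * Real.pi * Complex.I * (k j : ℂ)) • V k := by
  obtain ⟨G, hG⟩ := FPair.exists_right (memLp_complexify hg)
  have hwi := weightIntegrable_of_two hw
  have hgi := weightIntegrable_of_two hg
  have key : ∀ (i : Fin 3) (φ : 𝓢(R3, ℂ)), pair g i φ = -pair w i (∂_{stdVec j} φ) := by
    intro i φ
    let b : Fin 3 → R3 → ℝ := fun l x => if l = j then w x i else 0
    have hb : ∀ l, Integrable fun x => weight x * b l x := fun l => by
      by_cases hl : l = j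
      · simpa [b, hl] using hwi i
      · simp [b, hl]
    have := integral_test_schwartz (a := fun x => g x i) (c := 0) (b := b) (hgi i) hb (by simp)
      (fun η hη => by
        have e := congrArg (fun a : R3 => a i) (h.2.2 η hη)
        have i1 := hη.integrable_mul (hgi i)
        have i2 := (hη.fderiv_apply (stdVec j)).integrable_mul (hwi i)
        have hwj : Integrable fun x => fderiv ℝ η x (stdVec j) • w x :=
          h.1.integrable_smul_left_of_hasCompactSupport
            (hη.fderiv_apply _).1.continuous (hη.fderiv_apply _).2
        have hgj : Integrable fun x => η x • g x :=
          h.2.1.integrable_smul_left_of_hasCompactSupport hη.1.continuous hη.2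
        have e1 : ∫ x, fderiv ℝ η x (stdVec j) * w x i =
            (∫ x, fderiv ℝ η x (stdVec j) • w x : R3) i :=
          (EuclideanSpace.proj (𝕜 := ℝ) i).integral_comp_comm hwj
        have e2 : ∫ x, η x * g x i = (∫ x, η x • g x : R3) i :=
          (EuclideanSpace.proj (𝕜 := ℝ) i).integral_comp_comm hgj
        simp only [PiLp.neg_apply] at e
        simp only [b, ite_mul, zero_mul, Finset.sum_ite_eq', Finset.mem_univ, if_true,
          Pi.zero_apply, add_zero]
        rw [integral_add i1 i2]
        simp only [mul_comm (g _ i), mul_comm (w _ i)]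
        rw [e2, e1, e, add_neg_cancel]) φ
    have e : ∀ x, ∑ l, (b l x : ℂ) * (∂_{stdVec l} φ) x = (w x i : ℂ) * (∂_{stdVec j} φ) x := by
      intro x
      rw [Finset.sum_eq_single j] <;> simp +contextual [b]
    simp only [e, Pi.zero_apply, Complex.ofReal_zero, zero_mul, add_zero] at this
    rw [integral_add (integrable_mul_schwartz (hgi i) φ) (integrable_mul_schwartz (hwi i) _)]
      at this
    exact eq_neg_of_add_eq_zero_left this
  refine hG.congr (Filter.EventuallyEq.refl _ _) ?_
  refine ae_eq_of_schwartz (hG.memLp_right.locallyIntegrable (by norm_num)) ?_ fun φ => ?_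
  · have := hV.memLp_right.locallyIntegrable (by norm_num)
    exact this.continuous_smul (g := fun k : R3 => 2 * Real.pi * Complex.I * (k j : ℂ))
      (by fun_prop)
  -- The factor `2πi k_j` is put on the test function. By duality, multiplication by it before
  -- transforming is minus a derivative afterwards, which is the sign in the definition of a weak
  -- derivative.
  · let ψ : 𝓢(R3, ℂ) :=
      (2 * Real.pi * Complex.I) • SchwartzMap.smulLeftCLM ℂ (fun k : R3 => inner ℝ k (stdVec j)) φ
    have hψ : ∀ k, ψ k = (2 * Real.pi * Complex.I * (k j : ℂ)) * φ k := fun k => by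
      have : inner ℝ k (stdVec j) = k j := by
        simp [stdVec, EuclideanSpace.inner_single_right]
      simp only [ψ]
      rw [smul_apply, SchwartzMap.smulLeftCLM_apply_apply (by fun_prop), this]
      simp [mul_assoc]
    have hψ' : ∂_{stdVec j} (𝓕 φ) = -𝓕 ψ := by
      rw [SchwartzMap.lineDerivOp_fourier_eq, ← FourierTransform.fourier_neg]
      congr 1
      simp [ψ]
    have e1 : ∫ k, φ k • (2 * Real.pi * Complex.I * (k j : ℂ)) • V k = ∫ k, ψ k • V k := by
      refine integral_congr_ae (Filter.Eventually.of_forall fun k => ?_)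
      simp only [hψ, smul_smul, mul_comm]
    rw [e1, ← hG.pairing, ← hV.pairing]
    ext i
    rw [integral_smul_complexify_apply hgi, integral_smul_complexify_apply hwi, key, hψ', pair_neg,
      neg_neg]

/-! ### Products of band limited functions -/

theorem continuous_fourierInv {a : R3 → ℂ} (ha : Integrable a) : Continuous (𝓕⁻ a) := by
  have : Continuous (𝓕 a) := VectorFourier.fourierIntegral_continuous Real.continuous_fourierChar
    (by exact continuous_inner) ha
  have e : 𝓕⁻ a = fun x => 𝓕 a (-x) := by
    ext1 x; exact Real.fourierInv_eq_fourier_neg a x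
  rw [e]
  exact this.comp continuous_neg

theorem norm_fourierInv_le (a : R3 → ℂ) (x : R3) : ‖𝓕⁻ a x‖ ≤ ∫ k, ‖a k‖ := by
  rw [Real.fourierInv_eq]
  refine (norm_integral_le_integral_norm _).trans (le_of_eq ?_)
  simp [Circle.smul_def, Circle.norm_coe]

theorem integral_fourierInv_mul {a h : R3 → ℂ} (ha : Integrable a) (hh : Integrable h) :
    ∫ y, 𝓕⁻ a y * h y = ∫ k, a k * 𝓕⁻ h k := by
  have e4 := VectorFourier.integral_fourierIntegral_smul_eq_flip
    (μ := (volume : Measure R3)) (ν := (volume : Measure R3)) (L := -innerₗ R3)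
    (f := a) (g := h) Real.continuous_fourierChar
    (by simpa [Pi.neg_def] using (continuous_inner (𝕜 := ℝ) (E := R3)).fun_neg) ha hh
  have e5 : (-innerₗ R3).flip = -innerₗ R3 := by
    ext x y
    simp [real_inner_comm]
  rw [e5] at e4
  exact e4

theorem integral_conj_fourierInv_mul {b g : R3 → ℂ} (hb : Integrable b) (hg : Integrable g) :
    ∫ y, conj (𝓕⁻ b y) * g y = ∫ l, conj (b l) * 𝓕 g l := by
  have h1 := integral_fourierInv_mul hb (h := fun y => conj (g y))
    (Complex.conjCLE.integrable_comp_iff.2 hg)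
  have h2 := congrArg conj h1
  rw [← integral_conj, ← integral_conj] at h2
  simp only [map_mul, Complex.conj_conj] at h2
  rw [h2]
  refine integral_congr_ae (Filter.Eventually.of_forall fun l => ?_)
  simp only
  rw [Real.fourierInv_eq, ← integral_conj, Real.fourier_eq]
  congr 2
  ext y
  simp only [Circle.smul_def, smul_eq_mul, map_mul, Complex.conj_conj]
  rw [← Circle.coe_inv_eq_conj, ← AddChar.map_neg_eq_inv]

/-- Multiplication of two band limited functions: if the symbol of `R` is one on the difference of
the spectra then averaging against `R` reproduces the product. -/
theorem integral_bandlimited_mul_kernel {a b : R3 → ℂ} (ha : Integrable a) (hb : Integrable b)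
    (R : 𝓢(R3, ℂ)) (hR : ∀ k l, a k ≠ 0 → b l ≠ 0 → 𝓕 R (l - k) = 1) (x : R3) :
    ∫ y, (𝓕⁻ a y * conj (𝓕⁻ b y)) * R (y - x) = 𝓕⁻ a x * conj (𝓕⁻ b x) := by
  have hRx : Integrable fun y => R (y - x) := R.integrable.comp_sub_right x
  have hh : Integrable fun y => conj (𝓕⁻ b y) * R (y - x) := by
    refine (hRx.norm.const_mul (∫ k, ‖b k‖)).mono' ?_ (Filter.Eventually.of_forall fun y => ?_)
    · have hc := Complex.continuous_conj.comp (continuous_fourierInv hb)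
      exact (hc.mul (R.continuous.comp (by fun_prop))).aestronglyMeasurable
    · rw [norm_mul, RCLike.norm_conj]
      gcongr
      exact norm_fourierInv_le b y
  simp only [mul_assoc]
  rw [integral_fourierInv_mul ha hh, Real.fourierInv_eq a, ← integral_mul_const]
  refine integral_congr_ae (Filter.Eventually.of_forall fun k => ?_)
  simp only [Circle.smul_def, smul_eq_mul]
  by_cases hk : a k = 0
  · simp [hk]
  rw [mul_comm (_ : ℂ) (a k), mul_assoc]
  congr 1
  have hg : Integrable fun y => (Real.fourierChar (inner ℝ y k) : ℂ) * R (y - x) := by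
    refine hRx.mono ?_ (Filter.Eventually.of_forall fun y => by
      simp [Circle.norm_coe])
    refine Continuous.aestronglyMeasurable ?_
    refine Continuous.mul ?_ (R.continuous.comp (by fun_prop))
    exact continuous_subtype_val.comp
      (Real.continuous_fourierChar.comp (continuous_id.inner continuous_const))
  have e1 : 𝓕⁻ (fun y => conj (𝓕⁻ b y) * R (y - x)) k =
      ∫ y, conj (𝓕⁻ b y) * ((Real.fourierChar (inner ℝ y k) : ℂ) * R (y - x)) := by
    rw [Real.fourierInv_eq]
    congr 1
    ext y
    simp only [Circle.smul_def, smul_eq_mul]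
    ring
  rw [e1, integral_conj_fourierInv_mul hb hg, Real.fourierInv_eq b, ← integral_conj,
    ← integral_const_mul]
  refine integral_congr_ae (Filter.Eventually.of_forall fun l => ?_)
  simp only [Circle.smul_def, smul_eq_mul, map_mul]
  by_cases hl : b l = 0
  · simp [hl]
  -- Modulation by `k` shifts the spectrum, so the symbol of `R` is read at `l - k`, where it equals
  -- one. The remaining characters rebuild the values at `x`.
  have e2 : 𝓕 (fun y => (Real.fourierChar (inner ℝ y k) : ℂ) * R (y - x)) l =
      (Real.fourierChar (inner ℝ k x) : ℂ) * (Real.fourierChar (-inner ℝ l x) : ℂ) *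
        𝓕 R (l - k) := by
    rw [SchwartzMap.fourier_coe, Real.fourier_eq, Real.fourier_eq, ← integral_const_mul,
      ← integral_add_right_eq_self _ x]
    congr 1
    ext y
    simp only [Circle.smul_def, smul_eq_mul, add_sub_cancel_right, ← mul_assoc, ← Circle.coe_mul,
      ← AddChar.map_add_eq_mul]
    congr 3
    simp only [inner_add_left, inner_sub_right, real_inner_comm x]
    ring
  rw [e2, hR k l hk hl, mul_one, ← Circle.coe_inv_eq_conj, ← AddChar.map_neg_eq_inv]
  ring

/-- Pairing a bounded function with a product of band limited functions only sees the part of the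
bounded function in the band. -/
theorem integral_mul_bandlimited {a b : R3 → ℂ} (ha : Integrable a) (hb : Integrable b)
    (R : 𝓢(R3, ℂ)) (hR : ∀ k l, a k ≠ 0 → b l ≠ 0 → 𝓕 R (l - k) = 1)
    (hP : Integrable fun x => 𝓕⁻ a x * conj (𝓕⁻ b x)) {u : R3 → ℝ} {U : ℝ}
    (hu : AEStronglyMeasurable u (volume : Measure R3)) (hU : ∀ᵐ x, |u x| ≤ U) :
    ∫ x, (u x : ℂ) * (𝓕⁻ a x * conj (𝓕⁻ b x)) =
      ∫ y, (𝓕⁻ a y * conj (𝓕⁻ b y)) * ∫ x, (u x : ℂ) * R (y - x) := by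
  have huc : AEStronglyMeasurable (fun x => (u x : ℂ)) (volume : Measure R3) :=
    Complex.continuous_ofReal.comp_aestronglyMeasurable hu
  -- The product is replaced by its average against `R`; Fubini then moves `R` onto `u`. No Fourier
  -- transform of the merely bounded `u` is needed.
  have h1 : ∀ x, (u x : ℂ) * (𝓕⁻ a x * conj (𝓕⁻ b x)) =
      ∫ y, (u x : ℂ) * ((𝓕⁻ a y * conj (𝓕⁻ b y)) * R (y - x)) := fun x => by
    rw [integral_const_mul, integral_bandlimited_mul_kernel ha hb R hR]
  simp only [h1]
  rw [integral_integral_swap]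
  · refine integral_congr_ae (Filter.Eventually.of_forall fun y => ?_)
    simp only
    rw [← integral_const_mul]
    congr 1
    ext x
    ring
  · have hprod : Integrable (fun p : R3 × R3 => (𝓕⁻ a p.2 * conj (𝓕⁻ b p.2)) * R (p.2 - p.1))
        ((volume : Measure R3).prod volume) := by
      have h2 := Integrable.convolution_integrand (ContinuousLinearMap.mul ℝ ℂ) hP
        (R.integrable (μ := (volume : Measure R3))).comp_neg
      simpa using h2
    refine (hprod.norm.const_mul U).mono' ?_ ?_
    · exact huc.comp_fst.mul hprod.1
    · have : ∀ᵐ p : R3 × R3 ∂((volume : Measure R3).prod volume), |u p.1| ≤ U :=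
        Measure.quasiMeasurePreserving_fst.ae hU
      filter_upwards [this] with p hp
      simp only [Function.uncurry]
      rw [norm_mul, Complex.norm_real]
      gcongr
      exact hp

/-! ### Low-pass and band-pass kernels -/

/-- The bump function `θ` of the low frequency cutoff `θ (2⁻ⁿ k)`. -/
noncomputable def lowBump : ContDiffBump (0 : R3) where
  rIn := 1 / (32 * Real.pi)
  rOut := 1 / (16 * Real.pi)
  rIn_pos := by positivity
  rIn_lt_rOut := by
    have := Real.pi_pos
    gcongr
    norm_num

theorem lowBump_eq_one {k : R3} (h : 2 * Real.pi * ‖k‖ ≤ 1 / 16) : lowBump k = 1 := by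
  apply lowBump.one_of_mem_closedBall
  rw [mem_closedBall_zero_iff]
  change ‖k‖ ≤ 1 / (32 * Real.pi)
  rw [le_div_iff₀ (by positivity)]
  linarith

theorem norm_le_of_lowBump_ne_zero {k : R3} (h : lowBump k ≠ 0) : 2 * Real.pi * ‖k‖ ≤ 1 / 8 := by
  have h1 : k ∈ Metric.ball (0 : R3) (1 / (16 * Real.pi)) := by
    have : k ∈ Function.support lowBump := h
    rwa [lowBump.support_eq] at this
  rw [mem_ball_zero_iff, lt_div_iff₀ (by positivity)] at h1
  linarith

/-- Smooth functions of compact support as complex valued Schwartz functions. -/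
noncomputable def IsTest.toSchwartz {η : R3 → ℝ} (h : IsTest η) : 𝓢(R3, ℂ) :=
  (h.2.comp_left (g := Complex.ofRealCLM) rfl : HasCompactSupport (Complex.ofRealCLM ∘ η)).toSchwartzMap
    (Complex.ofRealCLM.contDiff.comp h.1)

theorem IsTest.toSchwartz_apply {η : R3 → ℝ} (h : IsTest η) (x : R3) :
    h.toSchwartz x = (η x : ℂ) := rfl

theorem isTest_bump (θ : ContDiffBump (0 : R3)) : IsTest θ := ⟨θ.contDiff, θ.hasCompactSupport⟩

/-- Dilation by `2ⁿ`. -/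
noncomputable def dil (n : ℕ) : R3 ≃L[ℝ] R3 :=
  ContinuousLinearEquiv.smulLeft (Units.mk0 ((2 : ℝ) ^ n) (by positivity))

theorem dil_apply (n : ℕ) (x : R3) : dil n x = (2 : ℝ) ^ n • x := rfl

/-- The kernel of the low frequency cutoff `θ (2⁻ⁿ k)`. -/
noncomputable def lowKern (n : ℕ) : 𝓢(R3, ℂ) :=
  (8 : ℂ) ^ n • SchwartzMap.compCLMOfContinuousLinearEquiv ℂ (dil n)
    (𝓕⁻ (isTest_bump lowBump).toSchwartz)

theorem lowKern_apply (n : ℕ) (x : R3) :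
    lowKern n x = (8 : ℂ) ^ n * (𝓕⁻ (isTest_bump lowBump).toSchwartz) ((2 : ℝ) ^ n • x) := by
  simp [lowKern, dil_apply]

theorem fourier_lowKern (n : ℕ) (k : R3) :
    𝓕 (lowKern n) k = (lowBump (((2 : ℝ) ^ n)⁻¹ • k) : ℂ) := by
  set G := 𝓕⁻ (isTest_bump lowBump).toSchwartz with hG
  have h1 : ∀ l, 𝓕 G l = (lowBump l : ℂ) := fun l => by
    rw [hG, FourierTransform.fourier_fourierInv_eq, IsTest.toSchwartz_apply]
  rw [← h1, SchwartzMap.fourier_coe, SchwartzMap.fourier_coe, Real.fourier_eq, Real.fourier_eq]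
  have h2 := Measure.integral_comp_smul (volume : Measure R3) (fun y : R3 =>
    Real.fourierChar (-inner ℝ y (((2 : ℝ) ^ n)⁻¹ • k)) • G y) ((2 : ℝ) ^ n)
  have h3 : |(((2 : ℝ) ^ n) ^ Module.finrank ℝ R3)⁻¹| = ((8 : ℝ) ^ n)⁻¹ := by
    rw [abs_of_pos (by positivity), finrank_euclideanSpace_fin, ← pow_mul, mul_comm, pow_mul]
    norm_num
  rw [h3, eq_inv_smul_iff₀ (by positivity), ← integral_smul] at h2
  rw [← h2]
  refine integral_congr_ae (Filter.Eventually.of_forall fun y => ?_)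
  simp only [lowKern_apply, ← hG, Circle.smul_def, smul_eq_mul, Complex.real_smul,
    inner_smul_left, inner_smul_right]
  have h4 : (2 : ℝ) ^ n ≠ 0 := by positivity
  simp only [RCLike.conj_to_real]
  rw [inv_mul_cancel_left₀ h4]
  push_cast
  ring

/-- Scaling: the factor `8 ^ n` keeps the `L¹` norm of the kernel constant, and one derivative costs
`2 ^ n`. -/
theorem exists_integral_lineDeriv_lowKern_le : ∃ C : ℝ, 0 ≤ C ∧ ∀ (n : ℕ) (j : Fin 3),
    ∫ x, ‖(∂_{stdVec j} (lowKern n)) x‖ ≤ C * 2 ^ n := by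
  set G := 𝓕⁻ (isTest_bump lowBump).toSchwartz with hG
  refine ⟨∑ j, ∫ x, ‖(∂_{stdVec j} G) x‖, by positivity, fun n j => ?_⟩
  have h1 : ∀ x, ‖(∂_{stdVec j} (lowKern n)) x‖ =
      8 ^ n * 2 ^ n * ‖(∂_{stdVec j} G) ((2 : ℝ) ^ n • x)‖ := by
    intro x
    rw [SchwartzMap.lineDerivOp_apply_eq_fderiv, SchwartzMap.lineDerivOp_apply_eq_fderiv]
    have e : (lowKern n : R3 → ℂ) = fun x => (8 : ℂ) ^ n * G ((2 : ℝ) ^ n • x) := by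
      ext x; exact lowKern_apply n x
    have h2 : HasFDerivAt (fun x : R3 => (2 : ℝ) ^ n • x)
      ((2 : ℝ) ^ n • ContinuousLinearMap.id ℝ R3) x :=
        ((2 : ℝ) ^ n • ContinuousLinearMap.id ℝ R3).hasFDerivAt
    have h3 : HasFDerivAt (fun x : R3 => (8 : ℂ) ^ n * G ((2 : ℝ) ^ n • x))
        ((8 : ℂ) ^ n • (fderiv ℝ G ((2 : ℝ) ^ n • x)).comp
          ((2 : ℝ) ^ n • ContinuousLinearMap.id ℝ R3)) x :=
      ((G.hasFDerivAt ((2 : ℝ) ^ n • x)).comp x h2).const_mul ((8 : ℂ) ^ n)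
    rw [e, h3.fderiv]
    simp [mul_assoc]
  have h2 := Measure.integral_comp_smul (volume : Measure R3)
    (fun y : R3 => ‖(∂_{stdVec j} G) y‖) ((2 : ℝ) ^ n)
  have h3 : |(((2 : ℝ) ^ n) ^ Module.finrank ℝ R3)⁻¹| = ((8 : ℝ) ^ n)⁻¹ := by
    rw [abs_of_pos (by positivity), finrank_euclideanSpace_fin, ← pow_mul, mul_comm, pow_mul]
    norm_num
  simp only [h1]
  rw [integral_const_mul, h2, h3, smul_eq_mul]
  have h4 : ∫ y, ‖(∂_{stdVec j} G) y‖ ≤ ∑ j, ∫ x, ‖(∂_{stdVec j} G) x‖ :=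
    Finset.single_le_sum (f := fun j => ∫ x, ‖(∂_{stdVec j} G) x‖) (fun _ _ => by positivity)
      (Finset.mem_univ j)
  calc _ = (∫ y, ‖(∂_{stdVec j} G) y‖) * 2 ^ n := by
        field_simp
    _ ≤ _ := by gcongr

/-- A kernel whose Laplacian is a bandpass filter. -/
theorem exists_bandpass (n : ℕ) : ∃ Q : 𝓢(R3, ℂ),
    (∀ k, 2 ^ n / 4 ≤ 2 * Real.pi * ‖k‖ → 2 * Real.pi * ‖k‖ ≤ 2 * 2 ^ n → 𝓕 (lapK Q) k = 1) ∧
    (∀ k, ‖𝓕 Q k‖ * (2 * Real.pi * ‖k‖) ≤ 8 * (2 ^ n)⁻¹) ∧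
    ∀ k, 𝓕 Q k ≠ 0 → 2 ^ n / 8 ≤ 2 * Real.pi * ‖k‖ := by
  have hpi := Real.pi_pos
  have h2n : (0 : ℝ) < 2 ^ n := by positivity
  -- In angular frequency `β` is one up to `2^n / 8` and vanishes from `2^n / 4`, while `γ` is one
  -- up to `2 · 2^n` and vanishes from `4 · 2^n`.
  let β : ContDiffBump (0 : R3) := ⟨2 ^ n / (16 * Real.pi), 2 ^ n / (8 * Real.pi), by positivity, by
    gcongr; norm_num⟩
  let γ : ContDiffBump (0 : R3) := ⟨2 ^ n / Real.pi, 2 * 2 ^ n / Real.pi, by positivity, by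
    gcongr; linarith⟩
  -- The symbol of the inverse Laplacian, cut off to the band; the factor `1 - β` removes the
  -- singularity at the origin.
  let q : R3 → ℝ := fun k => -(γ k * (1 - β k) / ((2 * Real.pi) ^ 2 * ‖k‖ ^ 2))
  have hlow : ∀ k, 2 * Real.pi * ‖k‖ ≤ 2 ^ n / 8 → β k = 1 := by
    intro k hk
    apply β.one_of_mem_closedBall
    rw [mem_closedBall_zero_iff]
    change ‖k‖ ≤ 2 ^ n / (16 * Real.pi)
    rw [le_div_iff₀ (by positivity)]
    linarith
  have hq : IsTest q := by
    constructor
    · refine contDiff_iff_contDiffAt.2 fun k => ?_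
      by_cases hk : k = 0
      · have : q =ᶠ[nhds k] fun _ => 0 := by
          have hb : ∀ᶠ l : R3 in nhds k, 2 * Real.pi * ‖l‖ < 2 ^ n / 8 := by
            have hc : Continuous fun l : R3 => 2 * Real.pi * ‖l‖ := by fun_prop
            refine hc.continuousAt.eventually_lt continuousAt_const ?_
            simp [hk]
          filter_upwards [hb] with l hl
          simp [q, hlow l hl.le]
        exact contDiffAt_const.congr_of_eventuallyEq this
      · have hk' : (2 * Real.pi) ^ 2 * ‖k‖ ^ 2 ≠ 0 := by
          have : ‖k‖ ≠ 0 := by simpa using hk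
          positivity
        have h1 : ContDiffAt ℝ ∞ (fun k : R3 => (2 * Real.pi) ^ 2 * ‖k‖ ^ 2) k :=
          (contDiff_const.mul (contDiff_norm_sq ℝ)).contDiffAt
        exact ((γ.contDiff.contDiffAt.mul
          (contDiffAt_const.sub β.contDiff.contDiffAt)).div h1 hk').neg
    · refine HasCompactSupport.of_support_subset_isCompact γ.hasCompactSupport fun k hk => ?_
      refine subset_tsupport _ fun h0 => hk ?_
      simp [q, h0]
  have hqQ : ∀ k, 𝓕 (𝓕⁻ hq.toSchwartz) k = (q k : ℂ) := fun k => by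
    rw [FourierTransform.fourier_fourierInv_eq, IsTest.toSchwartz_apply]
  have hsupp : ∀ k, q k ≠ 0 → 2 ^ n / 8 < 2 * Real.pi * ‖k‖ := by
    intro k hk
    by_contra hc
    exact hk (by simp [q, hlow k (not_lt.1 hc)])
  refine ⟨𝓕⁻ hq.toSchwartz, fun k h1 h2 => ?_, fun k => ?_, fun k hk => ?_⟩
  · have hk0 : 0 < ‖k‖ := by
      by_contra hc
      have : ‖k‖ = 0 := le_antisymm (not_lt.1 hc) (norm_nonneg k)
      rw [this] at h1
      linarith
    have hγ : γ k = 1 := by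
      apply γ.one_of_mem_closedBall
      rw [mem_closedBall_zero_iff]
      change ‖k‖ ≤ 2 ^ n / Real.pi
      rw [le_div_iff₀ (by positivity)]
      linarith
    have hβ : β k = 0 := by
      apply β.zero_of_le_dist
      rw [dist_zero_right]
      change 2 ^ n / (8 * Real.pi) ≤ ‖k‖
      rw [div_le_iff₀ (by positivity)]
      linarith
    rw [fourier_lapK_apply, hqQ]
    have : q k = -((2 * Real.pi) ^ 2 * ‖k‖ ^ 2)⁻¹ := by
      simp [q, hγ, hβ]
    rw [this]
    norm_cast
    field_simp
  · rw [hqQ, Complex.norm_real]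
    by_cases hk : q k = 0
    · rw [hk]; simp
    have h1 := hsupp k hk
    have h3 : 0 < 2 * Real.pi * ‖k‖ := lt_trans (by positivity) h1
    have h2 : ‖q k‖ ≤ 1 / (2 * Real.pi * ‖k‖) ^ 2 := by
      simp only [q]
      rw [norm_neg, norm_div, mul_pow (2 * Real.pi), Real.norm_of_nonneg (by positivity :
        (0 : ℝ) ≤ (2 * Real.pi) ^ 2 * ‖k‖ ^ 2)]
      gcongr
      rw [Real.norm_of_nonneg (mul_nonneg γ.nonneg (sub_nonneg.2 β.le_one))]
      exact mul_le_one₀ γ.le_one (sub_nonneg.2 β.le_one) (sub_le_self _ β.nonneg)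
    calc _ ≤ 1 / (2 * Real.pi * ‖k‖) ^ 2 * (2 * Real.pi * ‖k‖) := by gcongr
      _ = 1 / (2 * Real.pi * ‖k‖) := by rw [sq]; field_simp
      _ ≤ 1 / (2 ^ n / 8) := by gcongr
      _ = _ := by rw [one_div, inv_div, div_eq_mul_inv]
  · refine (hsupp k fun h0 => hk ?_).le
    rw [hqQ, h0]; simp

/-! ### The flux at a fixed time -/

theorem lintegral_mul_le_sqrt {α : Type*} [MeasurableSpace α] {μ : Measure α} {f g : α → ℝ≥0∞}
    (hf : AEMeasurable f μ) (hg : AEMeasurable g μ) :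
    ∫⁻ x, f x * g x ∂μ ≤ (∫⁻ x, f x ^ 2 ∂μ) ^ (1 / 2 : ℝ) * (∫⁻ x, g x ^ 2 ∂μ) ^ (1 / 2 : ℝ) := by
  have := ENNReal.lintegral_mul_le_Lp_mul_Lq μ (p := 2) (q := 2)
    ⟨by norm_num, by norm_num, by norm_num⟩ hf hg
  simpa using this

theorem fourierInv_apply_apply {a : R3 → C3} (ha : Integrable a) (x : R3) (i : Fin 3) :
    𝓕⁻ a x i = 𝓕⁻ (fun k => a k i) x := by
  rw [Real.fourierInv_eq, Real.fourierInv_eq]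
  have h : Integrable fun k => Real.fourierChar (inner ℝ k x) • a k := by
    refine ha.mono ?_ (Filter.Eventually.of_forall fun k => by simp [Circle.smul_def, norm_smul, Circle.norm_coe])
    have hc : Continuous fun k : R3 => (Real.fourierChar (inner ℝ k x) : ℂ) :=
      continuous_subtype_val.comp
        (Real.continuous_fourierChar.comp (continuous_id.inner continuous_const))
    exact hc.aestronglyMeasurable.smul ha.1
  have := (EuclideanSpace.proj (𝕜 := ℂ) i).integral_comp_comm h
  refine this.symm.trans (integral_congr_ae (Filter.Eventually.of_forall fun k => ?_))
  simp [Circle.smul_def]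

/-- The nonlinearity `u_j z - z_j u`. -/
noncomputable def stretch (u : R3 → R3) (z : R3 → C3) (j : Fin 3) (x : R3) : C3 :=
  (u x j : ℂ) • z x - z x j • complexify u x

theorem stretch_add (u : R3 → R3) (z z' : R3 → C3) (j : Fin 3) (x : R3) :
    stretch u (fun x => z x + z' x) j x = stretch u z j x + stretch u z' j x := by
  simp only [stretch, PiLp.add_apply, smul_add, add_smul]
  abel

theorem norm_stretch_le (u : R3 → R3) (z : R3 → C3) (j : Fin 3) (x : R3) :
    ‖stretch u z j x‖ ≤ 2 * ‖u x‖ * ‖z x‖ := by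
  refine (norm_sub_le _ _).trans ?_
  rw [norm_smul, norm_smul, norm_complexify, Complex.norm_real]
  have h1 : ‖u x j‖ ≤ ‖u x‖ := PiLp.norm_apply_le _ _
  have h2 : ‖z x j‖ ≤ ‖z x‖ := PiLp.norm_apply_le _ _
  calc _ ≤ ‖u x‖ * ‖z x‖ + ‖z x‖ * ‖u x‖ := by gcongr
    _ = _ := by ring

theorem aestronglyMeasurable_stretch {u : R3 → R3} {z : R3 → C3}
    (hu : AEStronglyMeasurable u (volume : Measure R3))
    (hz : AEStronglyMeasurable z (volume : Measure R3)) (j : Fin 3) :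
    AEStronglyMeasurable (stretch u z j) (volume : Measure R3) := by
  have h1 := (EuclideanSpace.proj (𝕜 := ℝ) j).continuous.comp_aestronglyMeasurable hu
  have h2 := (EuclideanSpace.proj (𝕜 := ℂ) j).continuous.comp_aestronglyMeasurable hz
  exact ((Complex.continuous_ofReal.comp_aestronglyMeasurable h1).smul hz).sub
    (h2.smul (continuous_toC3.comp_aestronglyMeasurable hu))

theorem memLp_stretch {u : R3 → R3} {z : R3 → C3} {U : ℝ}
    (hu : AEStronglyMeasurable u (volume : Measure R3)) (hU : ∀ᵐ x, ‖u x‖ ≤ U)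
    (hz : MemLp z 2 (volume : Measure R3)) (j : Fin 3) :
    MemLp (stretch u z j) 2 (volume : Measure R3) := by
  refine MemLp.of_le_mul (c := 2 * U) hz (aestronglyMeasurable_stretch hu hz.1 j) ?_
  filter_upwards [hU] with x hx
  refine (norm_stretch_le u z j x).trans ?_
  gcongr

theorem enorm_integral_inner_stretch_le {u : R3 → R3} {z w : R3 → C3} {U : ℝ}
    (hU : ∀ᵐ x, ‖u x‖ ≤ U) (j : Fin 3) :
    ‖∫ x, inner ℂ (w x) (stretch u z j x)‖ₑ ≤
      2 * ENNReal.ofReal U * ∫⁻ x, ‖w x‖ₑ * ‖z x‖ₑ := by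
  refine (enorm_integral_le_lintegral_enorm _).trans ?_
  rw [← lintegral_const_mul' _ _ (by finiteness)]
  refine lintegral_mono_ae ?_
  filter_upwards [hU] with x hx
  have h0 : 0 ≤ U := (norm_nonneg _).trans hx
  have h : ‖inner ℂ (w x) (stretch u z j x)‖ ≤ 2 * U * (‖w x‖ * ‖z x‖) :=
    calc _ ≤ ‖w x‖ * ‖stretch u z j x‖ := norm_inner_le_norm _ _
      _ ≤ ‖w x‖ * (2 * ‖u x‖ * ‖z x‖) := by gcongr; exact norm_stretch_le u z j x
      _ ≤ ‖w x‖ * (2 * U * ‖z x‖) := by gcongr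
      _ = _ := by ring
  have h2 : 2 * ENNReal.ofReal U = ENNReal.ofReal (2 * U) := by
    rw [ENNReal.ofReal_mul (by norm_num), ENNReal.ofReal_ofNat]
  rw [← ofReal_norm, ← ofReal_norm, ← ofReal_norm, ← ENNReal.ofReal_mul (norm_nonneg _), h2,
    ← ENNReal.ofReal_mul (by positivity)]
  exact ENNReal.ofReal_le_ofReal h

theorem inner_stretch_eq (u : R3 → R3) (z : R3 → C3) (w : C3) (j : Fin 3) (x : R3) :
    inner ℂ w (stretch u z j x) =
      ∑ i, ((u x j : ℂ) * (z x i * conj (w i)) - (u x i : ℂ) * (z x j * conj (w i))) := by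
  rw [PiLp.inner_apply]
  refine Finset.sum_congr rfl fun i _ => ?_
  simp [stretch, complexify]
  ring

/-- The low frequency part of the field only interacts with the part of `u` in the band. -/
theorem enorm_integral_inner_stretch_bandlimited_le {u : R3 → R3} {a b : R3 → C3} {U M : ℝ}
    (hu : AEStronglyMeasurable u (volume : Measure R3)) (hU : ∀ᵐ x, ‖u x‖ ≤ U)
    (ha : Integrable a) (hb : Integrable b)
    (hza : MemLp (𝓕⁻ a) 2 (volume : Measure R3)) (hwb : MemLp (𝓕⁻ b) 2 (volume : Measure R3))
    (hM : ∀ x i, ‖𝓕⁻ a x i‖ ≤ M)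
    (R : 𝓢(R3, ℂ)) (hR : ∀ k l, a k ≠ 0 → b l ≠ 0 → 𝓕 R (l - k) = 1) (j : Fin 3) :
    ‖∫ x, inner ℂ (𝓕⁻ b x) (stretch u (𝓕⁻ a) j x)‖ₑ ≤
      6 * ENNReal.ofReal M * ∫⁻ x, ‖𝓕⁻ b x‖ₑ * ‖conv R (complexify u) x‖ₑ := by
  have hM0 : 0 ≤ M := (norm_nonneg _).trans (hM 0 0)
  have hui : WeightIntegrable u := weightIntegrable_of_top
    (memLp_top_of_bound hu U hU)
  have hai : ∀ i, Integrable fun k => a k i := fun i =>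
    (EuclideanSpace.proj (𝕜 := ℂ) i).integrable_comp ha
  have hbi : ∀ i, Integrable fun k => b k i := fun i =>
    (EuclideanSpace.proj (𝕜 := ℂ) i).integrable_comp hb
  have hz2 : ∀ i, MemLp (fun x => 𝓕⁻ a x i) 2 (volume : Measure R3) := fun i =>
    hza.of_le ((EuclideanSpace.proj (𝕜 := ℂ) i).continuous.comp_aestronglyMeasurable hza.1)
      (Filter.Eventually.of_forall fun x => PiLp.norm_apply_le _ _)
  have hw2 : ∀ i, MemLp (fun x => (starRingEnd ℂ) (𝓕⁻ b x i)) 2 (volume : Measure R3) := fun i =>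
    hwb.of_le (Complex.continuous_conj.comp_aestronglyMeasurable
      ((EuclideanSpace.proj (𝕜 := ℂ) i).continuous.comp_aestronglyMeasurable hwb.1))
      (Filter.Eventually.of_forall fun x => by
        rw [RCLike.norm_conj]; exact PiLp.norm_apply_le _ _)
  have hP : ∀ p q, Integrable fun x => 𝓕⁻ a x p * (starRingEnd ℂ) (𝓕⁻ b x q) := fun p q =>
    (hz2 p).integrable_mul (hw2 q)
  have hUl : ∀ l, ∀ᵐ x, |u x l| ≤ U := fun l => by
    filter_upwards [hU] with x hx
    exact (abs_apply_le_norm _ _).trans hx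
  have hul : ∀ l, AEStronglyMeasurable (fun x => u x l) (volume : Measure R3) := fun l =>
    (EuclideanSpace.proj (𝕜 := ℝ) l).continuous.comp_aestronglyMeasurable hu
  have hint : ∀ l p q, Integrable fun x => (u x l : ℂ) * (𝓕⁻ a x p * (starRingEnd ℂ) (𝓕⁻ b x q)) := by
    intro l p q
    refine ((hP p q).norm.const_mul U).mono'
      ((Complex.continuous_ofReal.comp_aestronglyMeasurable (hul l)).mul (hP p q).1) ?_
    filter_upwards [hUl l] with x hx
    rw [norm_mul, Complex.norm_real]
    gcongr
    exact hx
  set I := ∫⁻ x, ‖𝓕⁻ b x‖ₑ * ‖conv R (complexify u) x‖ₑ with hI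
  -- Band limitation is a statement about scalar products, so the trilinear form is split into
  -- components before `u` is replaced by its filtered part.
  have key : ∀ l p q, ‖∫ x, (u x l : ℂ) * (𝓕⁻ a x p * (starRingEnd ℂ) (𝓕⁻ b x q))‖ₑ ≤
      ENNReal.ofReal M * I := by
    intro l p q
    have h1 := integral_mul_bandlimited (hai p) (hbi q) R
      (fun k l h1 h2 => hR k l (fun h => h1 (by simp [h])) (fun h => h2 (by simp [h])))
      (by simpa only [fourierInv_apply_apply ha, fourierInv_apply_apply hb] using hP p q)
      (hul l) (hUl l)
    simp only [← fourierInv_apply_apply ha, ← fourierInv_apply_apply hb] at h1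
    rw [h1]
    refine (enorm_integral_le_lintegral_enorm _).trans ?_
    rw [hI, ← lintegral_const_mul' _ _ (by finiteness)]
    refine lintegral_mono fun y => ?_
    have h2 : ∫ x, (u x l : ℂ) * R (y - x) = conv R (complexify u) y l := by
      rw [conv_complexify_apply hui]
      simp [pair]
    rw [h2, enorm_mul, enorm_mul]
    have e1 : ‖𝓕⁻ a y p‖ₑ ≤ ENNReal.ofReal M := by
      rw [← ofReal_norm]; exact ENNReal.ofReal_le_ofReal (hM y p)
    have e2 : ‖conj (𝓕⁻ b y q)‖ₑ ≤ ‖𝓕⁻ b y‖ₑ := by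
      rw [← ofReal_norm, ← ofReal_norm, RCLike.norm_conj]
      exact ENNReal.ofReal_le_ofReal (PiLp.norm_apply_le _ _)
    have e3 : ‖conv R (complexify u) y l‖ₑ ≤ ‖conv R (complexify u) y‖ₑ := by
      rw [← ofReal_norm, ← ofReal_norm]
      exact ENNReal.ofReal_le_ofReal (PiLp.norm_apply_le _ _)
    rw [mul_assoc]
    gcongr
  simp only [inner_stretch_eq]
  have hs : ∀ i ∈ (Finset.univ : Finset (Fin 3)), Integrable fun x =>
      ((u x j : ℂ) * (𝓕⁻ a x i * (starRingEnd ℂ) (𝓕⁻ b x i))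
      - (u x i : ℂ) * (𝓕⁻ a x j * (starRingEnd ℂ) (𝓕⁻ b x i))) := fun i _ =>
    (hint j i i).sub (hint i j i)
  rw [integral_finsetSum _ hs]
  refine (enorm_sum_le _ _).trans ?_
  -- Two products for each of three components give the constant `6`.
  have h3 : ∀ i ∈ Finset.univ, ‖∫ x, ((u x j : ℂ) * (𝓕⁻ a x i * conj (𝓕⁻ b x i))
      - (u x i : ℂ) * (𝓕⁻ a x j * conj (𝓕⁻ b x i)))‖ₑ ≤ 2 * (ENNReal.ofReal M * I) := by
    intro i _
    rw [integral_sub (hint j i i) (hint i j i), two_mul]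
    exact (enorm_sub_le).trans (add_le_add (key _ _ _) (key _ _ _))
  refine (Finset.sum_le_sum h3).trans (le_of_eq ?_)
  simp
  ring

namespace LittlewoodPaley

variable (D : LittlewoodPaley)

/-- The kernel of `Δₙ²`. -/
noncomputable def sqKern (n : ℕ) : 𝓢(R3, ℂ) :=
  𝓕⁻ (HasCompactSupport.toSchwartzMap
    (((D.hasCompactSupport_multiplier n).mul_left : HasCompactSupport
      (D.multiplier n * D.multiplier n)))
    ((D.contDiff_multiplier n).mul (D.contDiff_multiplier n)))

theorem fourier_sqKern (n : ℕ) (k : R3) : 𝓕 (D.sqKern n) k = D.multiplier n k ^ 2 := by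
  rw [sqKern, FourierTransform.fourier_fourierInv_eq, sq]
  rfl

/-- The kernel of `-∂_j Δₙ²`. -/
noncomputable def gradKern (n : ℕ) (j : Fin 3) : 𝓢(R3, ℂ) := -∂_{stdVec j} (D.sqKern n)

theorem fourier_gradKern (n : ℕ) (j : Fin 3) (k : R3) :
    𝓕 (D.gradKern n j) k = -(2 * Real.pi * Complex.I * (k j : ℂ)) * D.multiplier n k ^ 2 := by
  rw [gradKern, FourierTransform.fourier_neg, neg_apply, fourier_lineDeriv_apply, fourier_sqKern]
  ring

/-- The block symbol is bounded by one, so squaring it only decreases it. The gradient of `Δ_n² v`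
is therefore controlled by that of `Δ_n v`, to which Bernstein's inequality applies. -/
theorem sum_lintegral_gradKern_le (n : ℕ) {w : R3 → R3} (hw : MemLp w 2 (volume : Measure R3))
    (j : Fin 3) : ∫⁻ x, ‖conv (D.gradKern n j) (complexify w) x‖ₑ ^ 2 ≤
      2 * (4 ^ n * convSq (D.kern n) w) := by
  rw [← mul_assoc]
  refine le_trans ?_ (D.gradSq_le n hw)
  obtain ⟨V, hV⟩ := FPair.exists_right (memLp_complexify hw)
  rw [D.gradSq_eq n hV]
  refine (convSq_eq hV (D.gradKern n j)).trans_le ?_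
  refine lintegral_mono fun k => ?_
  have h1 := sum_enorm_lineDeriv_sq (D.sqKern n) k
  have h2 : ‖𝓕 (D.gradKern n j) k‖ₑ ^ 2 ≤ ∑ j, ‖𝓕 (∂_{stdVec j} (D.sqKern n)) k‖ₑ ^ 2 := by
    have : ‖𝓕 (D.gradKern n j) k‖ₑ = ‖𝓕 (∂_{stdVec j} (D.sqKern n)) k‖ₑ := by
      rw [gradKern, FourierTransform.fourier_neg, neg_apply, enorm_neg]
    rw [this]
    exact Finset.single_le_sum (f := fun j => ‖𝓕 (∂_{stdVec j} (D.sqKern n)) k‖ₑ ^ 2)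
      (fun _ _ => zero_le) (Finset.mem_univ j)
  rw [h1, fourier_sqKern] at h2
  have h3 : ‖D.multiplier n k ^ 2‖ₑ ^ 2 ≤ ‖D.multiplier n k‖ₑ ^ 2 := by
    rw [enorm_pow]
    have := D.enorm_multiplier_le n k
    calc (‖D.multiplier n k‖ₑ ^ 2) ^ 2 = ‖D.multiplier n k‖ₑ ^ 2 * ‖D.multiplier n k‖ₑ ^ 2 := by ring
      _ ≤ ‖D.multiplier n k‖ₑ ^ 2 * 1 := by gcongr; exact pow_le_one₀ zero_le this
      _ = _ := mul_one _
  calc _ ≤ (ENNReal.ofReal ((2 * Real.pi * ‖k‖) ^ 2) * ‖D.multiplier n k ^ 2‖ₑ ^ 2) * ‖V k‖ₑ ^ 2 := by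
        gcongr
    _ ≤ (ENNReal.ofReal ((2 * Real.pi * ‖k‖) ^ 2) * ‖D.multiplier n k‖ₑ ^ 2) * ‖V k‖ₑ ^ 2 := by
        gcongr
    _ = _ := by ring

end LittlewoodPaley

theorem enorm_conv_lapK_sq_le {u v : R3 → R3} (hd : IsWeaklyDivFree u) (hc : IsWeakCurl u v)
    (hu : WeightIntegrable u) (hv : WeightIntegrable v) (K : 𝓢(R3, ℂ)) (x : R3) :
    ‖conv (lapK K) (complexify u) x‖ₑ ^ 2 ≤
      2 * ∑ j, ‖conv (∂_{stdVec j} K : 𝓢(R3, ℂ)) (complexify v) x‖ₑ ^ 2 := by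
  have hab : ∀ a b : ℂ, ‖a - b‖ ^ 2 ≤ 2 * ‖a‖ ^ 2 + 2 * ‖b‖ ^ 2 := fun a b => by
    have h := norm_sub_le a b
    have : ‖a - b‖ ^ 2 ≤ (‖a‖ + ‖b‖) ^ 2 := by gcongr
    nlinarith [sq_nonneg (‖a‖ - ‖b‖)]
  have key : ‖conv (lapK K) (complexify u) x‖ ^ 2 ≤
      2 * ∑ j, ‖conv (∂_{stdVec j} K : 𝓢(R3, ℂ)) (complexify v) x‖ ^ 2 := by
    simp only [EuclideanSpace.norm_sq_eq, conv_lapK_apply hd hc hu hv, Fin.sum_univ_three]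
    have e0 := hab (conv (∂_{stdVec 2} K : 𝓢(R3, ℂ)) (complexify v) x 1)
      (conv (∂_{stdVec 1} K : 𝓢(R3, ℂ)) (complexify v) x 2)
    have e1 := hab (conv (∂_{stdVec 0} K : 𝓢(R3, ℂ)) (complexify v) x 2)
      (conv (∂_{stdVec 2} K : 𝓢(R3, ℂ)) (complexify v) x 0)
    have e2 := hab (conv (∂_{stdVec 1} K : 𝓢(R3, ℂ)) (complexify v) x 0)
      (conv (∂_{stdVec 0} K : 𝓢(R3, ℂ)) (complexify v) x 1)
    have p0 := sq_nonneg ‖conv (∂_{stdVec 0} K : 𝓢(R3, ℂ)) (complexify v) x 0‖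
    have p1 := sq_nonneg ‖conv (∂_{stdVec 1} K : 𝓢(R3, ℂ)) (complexify v) x 1‖
    have p2 := sq_nonneg ‖conv (∂_{stdVec 2} K : 𝓢(R3, ℂ)) (complexify v) x 2‖
    simp only [show (0 + 2 : Fin 3) = 2 from rfl, show (0 + 1 : Fin 3) = 1 from rfl,
      show (1 + 2 : Fin 3) = 0 from rfl, show (1 + 1 : Fin 3) = 2 from rfl,
      show (2 + 2 : Fin 3) = 1 from rfl, show (2 + 1 : Fin 3) = 0 from rfl]
    linarith
  have e := ENNReal.ofReal_le_ofReal key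
  rw [ENNReal.ofReal_mul (by norm_num), ENNReal.ofReal_sum_of_nonneg (fun _ _ => by positivity),
    ENNReal.ofReal_pow (norm_nonneg _), ofReal_norm, ENNReal.ofReal_ofNat] at e
  refine e.trans (le_of_eq ?_)
  congr 1
  refine Finset.sum_congr rfl fun j _ => ?_
  rw [ENNReal.ofReal_pow (norm_nonneg _), ofReal_norm]

theorem measurableSet_high (c : ℝ) : MeasurableSet {k : R3 | c ≤ 2 * Real.pi * ‖k‖} :=
  measurableSet_le measurable_const (by fun_prop)

/-- The filtered velocity is `-curl (Q * v)`. The symbol of `Q` is of order `|ξ|⁻²`, so after one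
derivative a factor of at most `8 · 2^{-n}` remains: this is the gain when `u` is recovered from
`v`. The constant is `128 = 2 · 8²`, the `2` coming from the two terms in each curl component. -/
theorem lintegral_conv_bandpass_le {u v : R3 → R3} (hd : IsWeaklyDivFree u) (hc : IsWeakCurl u v)
    (hu : WeightIntegrable u) (hv : MemLp v 2 (volume : Measure R3)) {V : R3 → C3}
    (hV : FPair (complexify v) V) (n : ℕ) {Q : 𝓢(R3, ℂ)}
    (hQ : ∀ k, ‖𝓕 Q k‖ * (2 * Real.pi * ‖k‖) ≤ 8 * (2 ^ n)⁻¹)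
    (hQ' : ∀ k, 𝓕 Q k ≠ 0 → 2 ^ n / 8 ≤ 2 * Real.pi * ‖k‖) :
    4 ^ n * ∫⁻ x, ‖conv (lapK Q) (complexify u) x‖ₑ ^ 2 ≤
      128 * ∫⁻ k in {k : R3 | 2 ^ n / 16 ≤ 2 * Real.pi * ‖k‖}, ‖V k‖ₑ ^ 2 := by
  have hvi := weightIntegrable_of_two hv
  have h1 : ∫⁻ x, ‖conv (lapK Q) (complexify u) x‖ₑ ^ 2 ≤
      2 * ∑ j, convSq (∂_{stdVec j} Q) v := by
    refine (lintegral_mono fun x => enorm_conv_lapK_sq_le hd hc hu hvi Q x).trans (le_of_eq ?_)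
    rw [lintegral_const_mul' _ _ (by norm_num), lintegral_finsetSum']
    · rfl
    · intro j _
      exact (hV.conv (∂_{stdVec j} Q)).memLp_left.1.enorm.pow_const 2
  have h2 : ∑ j, convSq (∂_{stdVec j} Q) v =
      ∫⁻ k, ENNReal.ofReal ((2 * Real.pi * ‖k‖) ^ 2) * ‖𝓕 Q k‖ₑ ^ 2 * ‖V k‖ₑ ^ 2 := by
    simp only [convSq_eq hV]
    rw [← lintegral_finsetSum']
    · refine lintegral_congr fun k => ?_
      rw [← Finset.sum_mul, sum_enorm_lineDeriv_sq]
    · intro j _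
      exact ((𝓕 (∂_{stdVec j} Q)).continuous.enorm.measurable.pow_const 2).aemeasurable.mul
        hV.aemeasurable_sq
  have h3 : 4 ^ n * ∑ j, convSq (∂_{stdVec j} Q) v ≤
      64 * ∫⁻ k in {k : R3 | 2 ^ n / 16 ≤ 2 * Real.pi * ‖k‖}, ‖V k‖ₑ ^ 2 := by
    rw [h2, ← lintegral_indicator (measurableSet_high _), ← lintegral_const_mul' _ _ (by finiteness),
      ← lintegral_const_mul' _ _ (by finiteness)]
    refine lintegral_mono fun k => ?_
    by_cases hk : 𝓕 Q k = 0
    · simp [hk]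
    have h4 : k ∈ {k : R3 | 2 ^ n / 16 ≤ 2 * Real.pi * ‖k‖} := by
      have := hQ' k hk
      have h2n : (0 : ℝ) < 2 ^ n := by positivity
      simp only [mem_ofPred_eq]
      linarith
    rw [indicator_of_mem h4, ← mul_assoc]
    gcongr
    have e : (4 : ℝ≥0∞) ^ n = ENNReal.ofReal (4 ^ n) := by
      rw [ENNReal.ofReal_pow (by norm_num), ENNReal.ofReal_ofNat]
    have e' : (64 : ℝ≥0∞) = ENNReal.ofReal 64 := by simp
    rw [e, e', ← ofReal_norm (𝓕 Q k), ← ENNReal.ofReal_pow (norm_nonneg _),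
      ← ENNReal.ofReal_mul (by positivity), ← ENNReal.ofReal_mul (by positivity)]
    refine ENNReal.ofReal_le_ofReal ?_
    have h5 : (‖𝓕 Q k‖ * (2 * Real.pi * ‖k‖)) ^ 2 ≤ (8 * ((2 : ℝ) ^ n)⁻¹) ^ 2 := by
      have := Real.pi_pos
      exact pow_le_pow_left₀ (by positivity) (hQ k) 2
    have h6 : (4 : ℝ) ^ n * (8 * ((2 : ℝ) ^ n)⁻¹) ^ 2 = 64 := by
      rw [show (4 : ℝ) = 2 ^ 2 by norm_num, ← pow_mul, mul_comm 2 n, pow_mul]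
      field_simp
      norm_num
    calc _ = 4 ^ n * (‖𝓕 Q k‖ * (2 * Real.pi * ‖k‖)) ^ 2 := by ring
      _ ≤ 4 ^ n * (8 * ((2 : ℝ) ^ n)⁻¹) ^ 2 := by gcongr
      _ = 64 := h6
  calc _ ≤ 4 ^ n * (2 * ∑ j, convSq (∂_{stdVec j} Q) v) := by gcongr
    _ = 2 * (4 ^ n * ∑ j, convSq (∂_{stdVec j} Q) v) := by ring
    _ ≤ 2 * (64 * ∫⁻ k in {k : R3 | 2 ^ n / 16 ≤ 2 * Real.pi * ‖k‖}, ‖V k‖ₑ ^ 2) := by gcongr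
    _ = _ := by rw [← mul_assoc]; norm_num

/-- The part of the field at frequencies above `2ⁿ / 16`. -/
theorem lintegral_sub_lowKern_le {f V : R3 → C3} (hV : FPair f V) (n : ℕ) :
    ∫⁻ x, ‖f x - conv (lowKern n) f x‖ₑ ^ 2 ≤
      ∫⁻ k in {k : R3 | 2 ^ n / 16 ≤ 2 * Real.pi * ‖k‖}, ‖V k‖ₑ ^ 2 := by
  rw [(hV.sub (hV.conv (lowKern n))).lintegral_eq, ← lintegral_indicator (measurableSet_high _)]
  refine lintegral_mono fun k => ?_
  have e : V k - 𝓕 (lowKern n) k • V k = (1 - 𝓕 (lowKern n) k) • V k := by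
    rw [sub_smul, one_smul]
  by_cases hk : k ∈ {k : R3 | 2 ^ n / 16 ≤ 2 * Real.pi * ‖k‖}
  · rw [indicator_of_mem hk, e, enorm_smul, fourier_lowKern]
    have h1 : ‖(1 : ℂ) - (lowBump (((2 : ℝ) ^ n)⁻¹ • k) : ℂ)‖ₑ ≤ 1 := by
      rw [← ofReal_norm, ENNReal.ofReal_le_one]
      norm_cast
      rw [Real.norm_of_nonneg (sub_nonneg.2 lowBump.le_one)]
      exact sub_le_self _ lowBump.nonneg
    calc _ ≤ (1 * ‖V k‖ₑ) ^ 2 := by gcongr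
      _ = _ := by rw [one_mul]
  · rw [indicator_of_notMem hk, e, fourier_lowKern, lowBump_eq_one]
    · simp
    · simp only [mem_ofPred_eq, not_le] at hk
      rw [norm_smul, norm_inv, norm_pow, Real.norm_ofNat]
      have h2n : (0 : ℝ) < 2 ^ n := by positivity
      calc _ = ((2 : ℝ) ^ n)⁻¹ * (2 * Real.pi * ‖k‖) := by ring
        _ ≤ ((2 : ℝ) ^ n)⁻¹ * (2 ^ n / 16) := by gcongr
        _ = 1 / 16 := by field_simp

theorem MeasureTheory.MemLp.integrable_inner_two {f g : R3 → C3} (hf : MemLp f 2 (volume : Measure R3))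
    (hg : MemLp g 2 (volume : Measure R3)) : Integrable fun x => inner ℂ (f x) (g x) := by
  refine (L2.integrable_inner (𝕜 := ℂ) (hf.toLp f) (hg.toLp g)).congr ?_
  filter_upwards [hf.coeFn_toLp, hg.coeFn_toLp] with x h1 h2
  rw [h1, h2]

/-- Since `v = curl u`, the derivative falls on the low-pass kernel, whose gradient has `L¹` norm of
order `2^n`. This converts the bound on `u` into a pointwise bound on the low frequencies of `v`. -/
theorem norm_conv_lowKern_le {u v : R3 → R3} {U C : ℝ} (hc : IsWeakCurl u v)
    (hu : WeightIntegrable u) (hv : WeightIntegrable v) (hU : ∀ᵐ x, ‖u x‖ ≤ U) {n : ℕ}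
    (hC : ∀ j : Fin 3, ∫ x, ‖(∂_{stdVec j} (lowKern n)) x‖ ≤ C * 2 ^ n) (x : R3) (i : Fin 3) :
    ‖conv (lowKern n) (complexify v) x i‖ ≤ 2 * U * C * 2 ^ n := by
  have hU0 : 0 ≤ U := by
    obtain ⟨y, hy⟩ := hU.exists
    exact (norm_nonneg _).trans hy
  have h : ∀ j l, ‖conv (∂_{stdVec j} (lowKern n) : 𝓢(R3, ℂ)) (complexify u) x l‖ ≤
      U * (C * 2 ^ n) := fun j l =>
    (PiLp.norm_apply_le _ _).trans ((norm_conv_le hU _ x).trans (by gcongr; exact hC j))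
  rw [conv_curl_apply hc hu hv]
  refine (norm_sub_le _ _).trans ((add_le_add (h _ _) (h _ _)).trans (le_of_eq ?_))
  ring

theorem ENNReal.mul_rpow_half_le {c : ℝ≥0∞} (hc : 1 ≤ c) (x : ℝ≥0∞) :
    (c * x) ^ (1 / 2 : ℝ) ≤ c * x ^ (1 / 2 : ℝ) := by
  rw [ENNReal.mul_rpow_of_nonneg _ _ (by norm_num)]
  gcongr
  simpa using ENNReal.rpow_le_rpow_of_exponent_le hc (by norm_num : (1 / 2 : ℝ) ≤ 1)

theorem ENNReal.sq_rpow_half (x : ℝ≥0∞) : (x ^ 2) ^ (1 / 2 : ℝ) = x := by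
  rw [← ENNReal.rpow_natCast, ← ENNReal.rpow_mul]
  norm_num

namespace LittlewoodPaley

/-- The decisive cancellation. The low part of `v` is `O(2^n U)` pointwise, and against the `n`-th
block it only meets frequencies of `u` near `2^n`; those are `2^{-n}` times high frequencies of `v`
in `L²`. Only blocks with index at least `n - 4` survive on the right. -/
theorem enorm_integral_stretch_low_le (D : LittlewoodPaley) {u v : R3 → R3} {U C : ℝ} (hC0 : 0 ≤ C)
    (hu : AEStronglyMeasurable u (volume : Measure R3)) (hU : ∀ᵐ x, ‖u x‖ ≤ U)
    (hv : MemLp v 2 (volume : Measure R3)) (hd : IsWeaklyDivFree u) (hc : IsWeakCurl u v)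
    {V : R3 → C3} (hV : FPair (complexify v) V) {n : ℕ} (hn : n ≠ 0)
    (hC : ∀ j : Fin 3, ∫ x, ‖(∂_{stdVec j} (lowKern n)) x‖ ≤ C * 2 ^ n) (j : Fin 3) :
    ‖∫ x, inner ℂ (conv (D.gradKern n j) (complexify v) x)
      (stretch u (conv (lowKern n) (complexify v)) j x)‖ₑ ≤
      ENNReal.ofReal (3072 * C) * ENNReal.ofReal U *
        ((4 ^ n * convSq (D.kern n) v) ^ (1 / 2 : ℝ) *
        (∫⁻ k in {k : R3 | 2 ^ n / 16 ≤ 2 * Real.pi * ‖k‖}, ‖V k‖ₑ ^ 2) ^ (1 / 2 : ℝ)) := by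
  have hU0 : 0 ≤ U := by
    obtain ⟨y, hy⟩ := hU.exists
    exact (norm_nonneg _).trans hy
  obtain ⟨Q, hQ1, hQ2, hQ3⟩ := exists_bandpass n
  have hui : WeightIntegrable u := weightIntegrable_of_top (memLp_top_of_bound hu U hU)
  have hvi := weightIntegrable_of_two hv
  have h2n : (0 : ℝ) < 2 ^ n := by positivity
  have hpi := Real.pi_pos
  have hlow := hV.conv (lowKern n)
  have hgr := hV.conv (D.gradKern n j)
  have key := enorm_integral_inner_stretch_bandlimited_le (u := u)
    (a := fun k => 𝓕 (lowKern n) k • V k) (b := fun k => 𝓕 (D.gradKern n j) k • V k)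
    (M := 2 * U * C * 2 ^ n) hu hU
    ((𝓕 (lowKern n)).integrable_smul_memLp_two hV.memLp_right)
    ((𝓕 (D.gradKern n j)).integrable_smul_memLp_two hV.memLp_right)
    (by rw [← conv_eq_fourierInv _ hV]; exact hlow.memLp_left)
    (by rw [← conv_eq_fourierInv _ hV]; exact hgr.memLp_left)
    (by rw [← conv_eq_fourierInv _ hV]; exact norm_conv_lowKern_le hc hui hvi hU hC)
    (lapK Q) (fun k l hk hl => by
      have h1 : lowBump (((2 : ℝ) ^ n)⁻¹ • k) ≠ 0 := fun h0 => hk (by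
        rw [fourier_lowKern, h0]; simp)
      have h2 : D.multiplier n l ≠ 0 := fun h0 => hl (by rw [fourier_gradKern, h0]; simp)
      have h3 := norm_le_of_lowBump_ne_zero h1
      rw [norm_smul, norm_inv, norm_pow, Real.norm_ofNat] at h3
      have h3' : 2 * Real.pi * ‖k‖ ≤ 1 / 8 * 2 ^ n := by
        calc 2 * Real.pi * ‖k‖ = (2 * Real.pi * (((2 : ℝ) ^ n)⁻¹ * ‖k‖)) * 2 ^ n := by field_simp
          _ ≤ _ := by gcongr
      have h4 := D.le_norm_of_multiplier_ne_zero h2 hn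
      have h5 := D.norm_le_of_multiplier_ne_zero h2
      have h6 : 2 * Real.pi * (‖l‖ - ‖k‖) ≤ 2 * Real.pi * ‖l - k‖ := by
        gcongr; exact norm_sub_norm_le l k
      have h7 : 2 * Real.pi * ‖l - k‖ ≤ 2 * Real.pi * (‖l‖ + ‖k‖) := by
        gcongr; exact norm_sub_le l k
      -- In units of `2^n` the low part lies below `1/8` and the block between `3/8` and `4/3`.
      -- Differences have size at least `1/4` and at most `35/24 ≤ 2`, inside the band where the
      -- symbol of `lapK Q` is one.
      exact hQ1 _ (by linarith) (by linarith)) j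
  rw [← conv_eq_fourierInv _ hV, ← conv_eq_fourierInv _ hV] at key
  refine key.trans ?_
  set H := ∫⁻ k in {k : R3 | 2 ^ n / 16 ≤ 2 * Real.pi * ‖k‖}, ‖V k‖ₑ ^ 2 with hH
  set A := 4 ^ n * convSq (D.kern n) v with hA
  have hcu : AEStronglyMeasurable (conv (lapK Q) (complexify u)) (volume : Measure R3) := by
    have h1 := conv_lapK_apply hd hc hui hvi Q
    have e : conv (lapK Q) (complexify u) = fun x => WithLp.toLp 2 fun i =>
        (conv (∂_{stdVec (i + 2)} Q : 𝓢(R3, ℂ)) (complexify v) x (i + 1)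
          - conv (∂_{stdVec (i + 1)} Q : 𝓢(R3, ℂ)) (complexify v) x (i + 2)) := by
      ext x i
      exact h1 x i
    rw [e]
    refine (PiLp.continuous_toLp 2 (fun _ : Fin 3 => ℂ)).comp_aestronglyMeasurable
      (aemeasurable_pi_iff.2 fun i => ?_).aestronglyMeasurable
    have hm : ∀ j l, AEStronglyMeasurable (fun x =>
        conv (∂_{stdVec j} Q : 𝓢(R3, ℂ)) (complexify v) x l) (volume : Measure R3) := fun j l =>
      (EuclideanSpace.proj (𝕜 := ℂ) l).continuous.comp_aestronglyMeasurable
        (hV.conv (∂_{stdVec j} Q)).memLp_left.1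
    exact ((hm _ _).sub (hm _ _)).aemeasurable
  have h1 : ∫⁻ x, ‖conv (D.gradKern n j) (complexify v) x‖ₑ * ‖conv (lapK Q) (complexify u) x‖ₑ ≤
      (2 * A) ^ (1 / 2 : ℝ) *
        (∫⁻ x, ‖conv (lapK Q) (complexify u) x‖ₑ ^ 2) ^ (1 / 2 : ℝ) := by
    refine (lintegral_mul_le_sqrt hgr.memLp_left.1.enorm hcu.enorm).trans ?_
    gcongr
    exact D.sum_lintegral_gradKern_le n hv j
  -- The `2 ^ n` from the pointwise bound on the low part is spent here. The factor `2 ^ n` of the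
  -- differentiated block stays inside `A`.
  have h2 : 2 ^ n * (∫⁻ x, ‖conv (lapK Q) (complexify u) x‖ₑ ^ 2) ^ (1 / 2 : ℝ) ≤
      128 * H ^ (1 / 2 : ℝ) := by
    calc _ = (4 ^ n * ∫⁻ x, ‖conv (lapK Q) (complexify u) x‖ₑ ^ 2) ^ (1 / 2 : ℝ) := by
          rw [ENNReal.mul_rpow_of_nonneg _ _ (by norm_num),
            show (4 : ℝ≥0∞) ^ n = (2 ^ n) ^ 2 by rw [← pow_mul, mul_comm, pow_mul]; norm_num,
            ENNReal.sq_rpow_half]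
      _ ≤ (128 * H) ^ (1 / 2 : ℝ) := by
          refine ENNReal.rpow_le_rpow ?_ (by norm_num)
          exact lintegral_conv_bandpass_le hd hc hui hv hV n hQ2 hQ3
      _ ≤ _ := ENNReal.mul_rpow_half_le (by norm_num) _
  have e : ENNReal.ofReal (2 * U * C * 2 ^ n) =
      2 * ENNReal.ofReal U * ENNReal.ofReal C * 2 ^ n := by
    rw [ENNReal.ofReal_mul (by positivity), ENNReal.ofReal_mul (by positivity),
      ENNReal.ofReal_mul (by positivity), ENNReal.ofReal_pow (by norm_num), ENNReal.ofReal_ofNat]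
  rw [e, ENNReal.ofReal_mul (by norm_num), ENNReal.ofReal_ofNat]
  calc _ ≤ 6 * (2 * ENNReal.ofReal U * ENNReal.ofReal C * 2 ^ n) * ((2 * A) ^ (1 / 2 : ℝ) *
        (∫⁻ x, ‖conv (lapK Q) (complexify u) x‖ₑ ^ 2) ^ (1 / 2 : ℝ)) := by gcongr
    _ = 12 * ENNReal.ofReal U * ENNReal.ofReal C * ((2 * A) ^ (1 / 2 : ℝ) * (2 ^ n *
        (∫⁻ x, ‖conv (lapK Q) (complexify u) x‖ₑ ^ 2) ^ (1 / 2 : ℝ))) := by ring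
    _ ≤ 12 * ENNReal.ofReal U * ENNReal.ofReal C *
        ((2 * A ^ (1 / 2 : ℝ)) * (128 * H ^ (1 / 2 : ℝ))) := by
        gcongr
        exact ENNReal.mul_rpow_half_le (by norm_num) _
    _ = _ := by ring

theorem enorm_integral_stretch_high_le (D : LittlewoodPaley) {u v : R3 → R3} {U : ℝ}
    (hU : ∀ᵐ x, ‖u x‖ ≤ U) (hv : MemLp v 2 (volume : Measure R3)) (n : ℕ) (j : Fin 3)
    {z : R3 → C3} (hz : MemLp z 2 (volume : Measure R3)) :
    ‖∫ x, inner ℂ (conv (D.gradKern n j) (complexify v) x) (stretch u z j x)‖ₑ ≤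
      4 * ENNReal.ofReal U * ((4 ^ n * convSq (D.kern n) v) ^ (1 / 2 : ℝ) *
        (∫⁻ x, ‖z x‖ₑ ^ 2) ^ (1 / 2 : ℝ)) := by
  obtain ⟨V, hV⟩ := FPair.exists_right (memLp_complexify hv)
  refine (enorm_integral_inner_stretch_le hU j).trans ?_
  have h1 := lintegral_mul_le_sqrt (hV.conv (D.gradKern n j)).memLp_left.1.enorm hz.1.enorm
  calc _ ≤ 2 * ENNReal.ofReal U * ((2 * (4 ^ n * convSq (D.kern n) v)) ^ (1 / 2 : ℝ) *
        (∫⁻ x, ‖z x‖ₑ ^ 2) ^ (1 / 2 : ℝ)) := by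
        gcongr
        refine h1.trans ?_
        gcongr
        exact D.sum_lintegral_gradKern_le n hv j
    _ ≤ 2 * ENNReal.ofReal U * ((2 * (4 ^ n * convSq (D.kern n) v) ^ (1 / 2 : ℝ)) *
        (∫⁻ x, ‖z x‖ₑ ^ 2) ^ (1 / 2 : ℝ)) := by
        gcongr
        exact ENNReal.mul_rpow_half_le (by norm_num) _
    _ = _ := by ring

/-- The flux of the nonlinear term through the `n`-th block. -/
noncomputable def flux (D : LittlewoodPaley) (n : ℕ) (u v : R3 → R3) : ℂ :=
  ∑ j, ∫ x, inner ℂ (conv (D.gradKern n j) (complexify v) x) (stretch u (complexify v) j x)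

theorem exists_enorm_flux_le : ∃ C : ℝ≥0, ∀ (D : LittlewoodPaley) (n : ℕ) (u v : R3 → R3) (U : ℝ),
    AEStronglyMeasurable u (volume : Measure R3) → (∀ᵐ x, ‖u x‖ ≤ U) →
    MemLp v 2 (volume : Measure R3) → IsWeaklyDivFree u → IsWeakCurl u v →
    ‖D.flux n u v‖ₑ ≤ C * ENNReal.ofReal U * ((4 ^ n * convSq (D.kern n) v) ^ (1 / 2 : ℝ) *
      (∑' j, if n ≤ j + 4 then convSq (D.kern j) v else 0) ^ (1 / 2 : ℝ)) := by
  obtain ⟨C, hC0, hC⟩ := exists_integral_lineDeriv_lowKern_le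
  -- The factor `9` is three columns `j` times the `3` of almost orthogonality.
  refine ⟨9 * (Real.toNNReal (3072 * C) + 4), fun D n u v U hu hU hv hd hc => ?_⟩
  obtain ⟨V, hV⟩ := FPair.exists_right (memLp_complexify hv)
  set A := 4 ^ n * convSq (D.kern n) v with hA
  set S := ∑' j, if n ≤ j + 4 then convSq (D.kern j) v else 0 with hS
  have h3S : (3 * S) ^ (1 / 2 : ℝ) ≤ 3 * S ^ (1 / 2 : ℝ) :=
    ENNReal.mul_rpow_half_le (by norm_num) _
  have main : ∀ j, ‖∫ x, inner ℂ (conv (D.gradKern n j) (complexify v) x)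
      (stretch u (complexify v) j x)‖ₑ ≤ (ENNReal.ofReal (3072 * C) + 4) * ENNReal.ofReal U *
        (A ^ (1 / 2 : ℝ) * (3 * S ^ (1 / 2 : ℝ))) := by
    intro j
    -- For the lowest block there is nothing to split off: all of `v` counts as high frequency.
    by_cases hn : n = 0
    · have h1 := D.enorm_integral_stretch_high_le hU hv n j (memLp_complexify hv)
      rw [hV.lintegral_eq] at h1
      have h2 := D.lintegral_high_le n hV MeasurableSet.univ fun k _ => Or.inl hn
      rw [Measure.restrict_univ] at h2
      calc _ ≤ 4 * ENNReal.ofReal U * (A ^ (1 / 2 : ℝ) * (3 * S) ^ (1 / 2 : ℝ)) := by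
            refine h1.trans ?_
            gcongr
        _ ≤ _ := by gcongr; exact le_add_self
    · set H := ∫⁻ k in {k : R3 | 2 ^ n / 16 ≤ 2 * Real.pi * ‖k‖}, ‖V k‖ₑ ^ 2 with hH
      have hHS : H ≤ 3 * S := D.lintegral_high_le n hV (measurableSet_high _) fun k hk => Or.inr hk
      have hl := hV.conv (lowKern n)
      have hh := hV.sub hl
      have hg := (hV.conv (D.gradKern n j)).memLp_left
      have h1 := D.enorm_integral_stretch_low_le hC0 hu hU hv hd hc hV hn (hC n) j
      have h2 := D.enorm_integral_stretch_high_le hU hv n j hh.memLp_left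
      have e : ∫ x, inner ℂ (conv (D.gradKern n j) (complexify v) x) (stretch u (complexify v) j x) =
          (∫ x, inner ℂ (conv (D.gradKern n j) (complexify v) x)
            (stretch u (conv (lowKern n) (complexify v)) j x)) +
          ∫ x, inner ℂ (conv (D.gradKern n j) (complexify v) x)
            (stretch u (fun x => complexify v x - conv (lowKern n) (complexify v) x) j x) := by
        rw [← integral_add (hg.integrable_inner_two (memLp_stretch hu hU hl.memLp_left j))
          (hg.integrable_inner_two (memLp_stretch hu hU hh.memLp_left j))]
        refine integral_congr_ae (Filter.Eventually.of_forall fun x => ?_)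
        simp only
        rw [← inner_add_right, ← stretch_add]
        simp
      rw [e]
      calc _ ≤ ENNReal.ofReal (3072 * C) * ENNReal.ofReal U * (A ^ (1 / 2 : ℝ) * H ^ (1 / 2 : ℝ)) +
            4 * ENNReal.ofReal U * (A ^ (1 / 2 : ℝ) * H ^ (1 / 2 : ℝ)) := by
            refine (enorm_add_le _ _).trans (add_le_add h1 (h2.trans ?_))
            gcongr
            exact lintegral_sub_lowKern_le hV n
        _ = (ENNReal.ofReal (3072 * C) + 4) * ENNReal.ofReal U *
            (A ^ (1 / 2 : ℝ) * H ^ (1 / 2 : ℝ)) := by ring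
        _ ≤ _ := by
            gcongr
            exact (by gcongr : H ^ (1 / 2 : ℝ) ≤ (3 * S) ^ (1 / 2 : ℝ)).trans h3S
  calc _ ≤ ∑ j : Fin 3, (ENNReal.ofReal (3072 * C) + 4) * ENNReal.ofReal U *
        (A ^ (1 / 2 : ℝ) * (3 * S ^ (1 / 2 : ℝ))) := by
        rw [flux]
        exact (enorm_sum_le _ _).trans (Finset.sum_le_sum fun j _ => main j)
    _ = _ := by
        rw [Finset.sum_const, Finset.card_univ, Fintype.card_fin, nsmul_eq_mul]
        push_cast
        rw [ENNReal.ofReal]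
        ring

end LittlewoodPaley

/-! ### The evolution equation against Schwartz functions -/

section Fubini

variable {E : Type*} [NormedAddCommGroup E] [NormedSpace ℝ E] {ν : Measure ℝ}

theorem integrable_prod_smul_schwartz {P : ℝ → R3 → ℝ}
    (hP : Integrable (fun p : ℝ × R3 => weight p.2 * P p.1 p.2) (ν.prod volume)) (g : 𝓢(R3, E)) :
    Integrable (fun p : ℝ × R3 => P p.1 p.2 • g p.2) (ν.prod volume) := by
  obtain ⟨C, h0, h⟩ := g.exists_le_weight
  have hw : Continuous fun p : ℝ × R3 => (weight p.2)⁻¹ :=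
    (continuous_weight.inv₀ fun x => (weight_pos x).ne').comp continuous_snd
  have hPm : AEStronglyMeasurable (fun p : ℝ × R3 => P p.1 p.2) (ν.prod volume) := by
    refine (hw.aestronglyMeasurable.mul hP.1).congr (Filter.Eventually.of_forall fun p => ?_)
    simp [(weight_pos p.2).ne']
  refine (hP.norm.const_mul C).mono' (hPm.smul
    (g.continuous.comp continuous_snd).aestronglyMeasurable)
    (Filter.Eventually.of_forall fun p => ?_)
  rw [norm_smul, norm_mul, Real.norm_of_nonneg (weight_pos p.2).le]
  calc _ ≤ ‖P p.1 p.2‖ * (C * weight p.2) := by gcongr; exact h p.2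
    _ = _ := by ring

/-- Carrying the time integral onto the coefficients turns the evolution equation into one identity
in `x`, to which the extension from test functions applies directly. -/
theorem integral_integral_smul_schwartz [SFinite ν] {P : ℝ → R3 → ℝ} {B : Fin 3 → ℝ → R3 → ℝ}
    (hP : Integrable (fun p : ℝ × R3 => weight p.2 * P p.1 p.2) (ν.prod volume))
    (hB : ∀ j, Integrable (fun p : ℝ × R3 => weight p.2 * B j p.1 p.2) (ν.prod volume))
    (l : 𝓢(R3, E)) (d : Fin 3 → 𝓢(R3, E)) [CompleteSpace E] :
    ∫ s, (∫ x, (P s x • l x + ∑ j, B j s x • d j x)) ∂ν =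
      ∫ x, ((∫ s, P s x ∂ν) • l x + ∑ j, (∫ s, B j s x ∂ν) • d j x) := by
  have h1 := integrable_prod_smul_schwartz hP l
  have h2 := fun j => integrable_prod_smul_schwartz (hB j) (d j)
  have h3 : Integrable (fun p : ℝ × R3 => P p.1 p.2 • l p.2 + ∑ j, B j p.1 p.2 • d j p.2)
      (ν.prod volume) := h1.add (integrable_finsetSum _ fun j _ => h2 j)
  refine (integral_integral_swap (f := fun s x => P s x • l x + ∑ j, B j s x • d j x) h3).trans ?_
  refine integral_congr_ae ?_
  have h4 := ae_all_iff.2 fun j => (h2 j).prod_left_ae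
  filter_upwards [h1.prod_left_ae, h4] with x hx1 hx2
  rw [integral_add hx1 (integrable_finsetSum _ fun j _ => hx2 j),
    integral_finsetSum _ fun j _ => hx2 j, integral_smul_const]
  simp only [integral_smul_const]

theorem integrable_weight_mul_integral [SFinite ν] {P : ℝ → R3 → ℝ}
    (hP : Integrable (fun p : ℝ × R3 => weight p.2 * P p.1 p.2) (ν.prod volume)) :
    Integrable fun x => weight x * ∫ s, P s x ∂ν := by
  refine hP.integral_prod_right.congr (Filter.Eventually.of_forall fun x => ?_)
  simp only [integral_const_mul]

/-- A time integrated evolution equation extends from test functions to Schwartz functions. -/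
theorem integral_evolution_schwartz [SFinite ν] {a : R3 → ℝ} {P : ℝ → R3 → ℝ} {B : Fin 3 → ℝ → R3 → ℝ}
    (ha : Integrable fun x => weight x * a x)
    (hP : Integrable (fun p : ℝ × R3 => weight p.2 * P p.1 p.2) (ν.prod volume))
    (hB : ∀ j, Integrable (fun p : ℝ × R3 => weight p.2 * B j p.1 p.2) (ν.prod volume))
    (h : ∀ η, IsTest η → ∫ x, a x * η x = ∫ s, (∫ x, (P s x * Laplacian.laplacian η x +
      ∑ j, B j s x * fderiv ℝ η x (stdVec j))) ∂ν) (g : 𝓢(R3, ℂ)) :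
    ∫ x, (a x : ℂ) * g x = ∫ s, (∫ x, ((P s x : ℂ) * lapK g x +
      ∑ j, (B j s x : ℂ) * (∂_{stdVec j} g) x)) ∂ν := by
  have hc := integrable_weight_mul_integral hP
  have hb := fun j => integrable_weight_mul_integral (hB j)
  have key := integral_test_schwartz (a := a) (b := fun j x => -∫ s, B j s x ∂ν)
    (c := fun x => -∫ s, P s x ∂ν) ha (fun j => by simpa using (hb j).neg) (by simpa using hc.neg)
    (fun η hη => by
      have e := h η hη
      set f : 𝓢(R3, ℝ) := hη.2.toSchwartzMap hη.1 with hf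
      have e1 : ∀ x, Laplacian.laplacian η x = (Laplacian.laplacian f : 𝓢(R3, ℝ)) x := fun x => by
        rw [SchwartzMap.laplacian_apply]; rfl
      have e2 : ∀ j x, fderiv ℝ η x (stdVec j) = (∂_{stdVec j} f : 𝓢(R3, ℝ)) x := fun j x => by
        rw [SchwartzMap.lineDerivOp_apply_eq_fderiv]; rfl
      have e3 := integral_integral_smul_schwartz hP hB (Laplacian.laplacian f : 𝓢(R3, ℝ))
        (fun j => (∂_{stdVec j} f : 𝓢(R3, ℝ)))
      simp only [smul_eq_mul] at e3
      simp only [e1, e2] at e ⊢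
      rw [e3] at e
      have i1 := hη.integrable_mul ha
      have i2 : Integrable fun x => (∫ s, P s x ∂ν) * (Laplacian.laplacian f : 𝓢(R3, ℝ)) x +
          ∑ j, (∫ s, B j s x ∂ν) * (∂_{stdVec j} f : 𝓢(R3, ℝ)) x := by
        have aux : ∀ {p : R3 → ℝ} (_ : Integrable fun x => weight x * p x) (q : 𝓢(R3, ℝ)),
            Integrable fun x => p x * q x := fun {p} hp q => by
          obtain ⟨C, h0, h⟩ := q.exists_le_weight
          refine (hp.norm.const_mul C).mono' ((aestronglyMeasurable_of_weight hp).mul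
            q.continuous.aestronglyMeasurable) (Filter.Eventually.of_forall fun x => ?_)
          rw [norm_mul, norm_mul, Real.norm_of_nonneg (weight_pos x).le]
          calc _ ≤ ‖p x‖ * (C * weight x) := by gcongr; exact h x
            _ = _ := by ring
        exact (aux hc _).add (integrable_finsetSum _ fun j _ => aux (hb j) _)
      rw [← sub_eq_zero, ← integral_sub i1 i2] at e
      rw [← e]
      refine integral_congr_ae (Filter.Eventually.of_forall fun x => ?_)
      simp only [neg_mul, Finset.sum_neg_distrib]
      ring) g
  have e3 := integral_integral_smul_schwartz hP hB (lapK g) (fun j => (∂_{stdVec j} g : 𝓢(R3, ℂ)))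
  simp only [Complex.real_smul] at e3
  rw [e3]
  have i1 := integrable_mul_schwartz ha g
  have i2 : Integrable fun x => ((∫ s, P s x ∂ν : ℝ) : ℂ) * lapK g x +
      ∑ j, ((∫ s, B j s x ∂ν : ℝ) : ℂ) * (∂_{stdVec j} g) x :=
    (integrable_mul_schwartz hc _).add
      (integrable_finsetSum _ fun j _ => integrable_mul_schwartz (hb j) _)
  rw [← sub_eq_zero, ← integral_sub i1 i2, ← key]
  refine integral_congr_ae (Filter.Eventually.of_forall fun x => ?_)
  simp only [Complex.ofReal_neg, neg_mul, Finset.sum_neg_distrib]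
  ring

end Fubini

/-! ### Calculus in time and the source term -/

theorem sq_primitive_eq {x y : ℝ → ℝ} {c t : ℝ} (ht : 0 ≤ t) (hy : IntervalIntegrable y volume 0 t)
    (hx : ∀ r ∈ Icc 0 t, x r = c + ∫ s in (0 : ℝ)..r, y s) :
    x t ^ 2 = c ^ 2 + 2 * ∫ s in (0 : ℝ)..t, x s * y s := by
  set X : ℝ → ℝ := fun r => c + ∫ s in (0 : ℝ)..r, y s with hX
  have h0 : (0 : ℝ) ∈ uIcc 0 t := left_mem_uIcc
  have hac : AbsolutelyContinuousOnInterval X 0 t :=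
    (LipschitzOnWith.absolutelyContinuousOnInterval
      (LipschitzWith.const c).lipschitzOnWith).fun_add
      (hy.absolutelyContinuousOnInterval_intervalIntegral h0)
  have h1 := hac.integral_deriv_mul_eq_sub hac
  have h2 : ∫ s in (0 : ℝ)..t, (deriv X s * X s + X s * deriv X s) =
      ∫ s in (0 : ℝ)..t, 2 * (x s * y s) := by
    refine intervalIntegral.integral_congr_ae ?_
    filter_upwards [hy.ae_hasDerivAt_integral] with s hs hst
    have hs' := uIoc_subset_uIcc hst
    have hd : HasDerivAt X (y s) s := (hs hs' 0 h0).const_add c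
    rw [hd.deriv, hx s (by rwa [uIcc_of_le ht] at hs')]
    ring
  rw [h2, intervalIntegral.integral_const_mul] at h1
  rw [h1, hx t ⟨ht, le_rfl⟩]
  simp [hX]
  ring

/-- The six real coordinates are treated separately by `sq_primitive_eq`. The derivative `ψ` is only
integrable, so the path is absolutely continuous rather than `C¹`, and the product rule is used
almost everywhere. -/
theorem norm_sq_primitive_eq {φ ψ : ℝ → C3} {c : C3} {t : ℝ} (ht : 0 ≤ t)
    (hψ : IntervalIntegrable ψ volume 0 t)
    (hφ : ∀ r ∈ Icc 0 t, φ r = c + ∫ s in (0 : ℝ)..r, ψ s) :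
    ‖φ t‖ ^ 2 = ‖c‖ ^ 2 + 2 * ∫ s in (0 : ℝ)..t, (inner ℂ (φ s) (ψ s)).re := by
  have hpart : ∀ (L : C3 →L[ℝ] ℝ),
      L (φ t) ^ 2 = L c ^ 2 + 2 * ∫ s in (0 : ℝ)..t, L (φ s) * L (ψ s) ∧
      IntervalIntegrable (fun s => L (φ s) * L (ψ s)) volume 0 t := by
    intro L
    have hi : IntervalIntegrable (fun s => L (ψ s)) volume 0 t :=
      ⟨L.integrable_comp hψ.1, L.integrable_comp hψ.2⟩
    have hx : ∀ r ∈ Icc 0 t, L (φ r) = L c + ∫ s in (0 : ℝ)..r, L (ψ s) := fun r hr => by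
      rw [hφ r hr, map_add, L.intervalIntegral_comp_comm]
      exact hψ.mono_set (by rw [uIcc_of_le hr.1, uIcc_of_le ht]; exact Icc_subset_Icc_right hr.2)
    refine ⟨sq_primitive_eq ht hi hx, ?_⟩
    have hcont : ContinuousOn (fun r => L (φ r)) (uIcc 0 t) := by
      rw [uIcc_of_le ht]
      refine ContinuousOn.congr (f := fun r => L c + ∫ s in (0 : ℝ)..r, L (ψ s)) ?_ hx
      have := intervalIntegral.continuousOn_primitive_interval' hi left_mem_uIcc
      rw [uIcc_of_le ht] at this
      exact continuousOn_const.add this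
    exact hi.continuousOn_mul hcont
  let Re : Fin 3 → C3 →L[ℝ] ℝ := fun i =>
    Complex.reCLM.comp ((EuclideanSpace.proj (𝕜 := ℂ) i).restrictScalars ℝ)
  let Im : Fin 3 → C3 →L[ℝ] ℝ := fun i =>
    Complex.imCLM.comp ((EuclideanSpace.proj (𝕜 := ℂ) i).restrictScalars ℝ)
  have hn : ∀ z : C3, ‖z‖ ^ 2 = ∑ i, (Re i z ^ 2 + Im i z ^ 2) := fun z => by
    rw [EuclideanSpace.norm_sq_eq]
    refine Finset.sum_congr rfl fun i _ => ?_
    rw [← Complex.normSq_eq_norm_sq, Complex.normSq_apply]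
    simp [Re, Im, sq]
  have hin : ∀ z w : C3, (inner ℂ z w).re = ∑ i, (Re i z * Re i w + Im i z * Im i w) := fun z w => by
    rw [PiLp.inner_apply, Complex.re_sum]
    refine Finset.sum_congr rfl fun i _ => ?_
    simp [Re, Im]
    ring
  simp only [hn, hin]
  rw [intervalIntegral.integral_finsetSum fun i _ => (hpart (Re i)).2.add (hpart (Im i)).2,
    Finset.mul_sum, ← Finset.sum_add_distrib]
  refine Finset.sum_congr rfl fun i _ => ?_
  rw [intervalIntegral.integral_add (hpart (Re i)).2 (hpart (Im i)).2, (hpart (Re i)).1,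
    (hpart (Im i)).1]
  ring

/-- The `j`-th column of the tensor `v ⊗ u - u ⊗ v`. -/
def stretchField (u v : R3 → R3) (j : Fin 3) (x : R3) : R3 := u x j • v x - v x j • u x

theorem complexify_stretchField (u v : R3 → R3) (j : Fin 3) :
    complexify (stretchField u v j) = stretch u (complexify v) j := by
  ext x i
  simp [complexify, stretchField, stretch]

theorem memLp_stretchField {u v : R3 → R3} {U : ℝ} (hu : AEStronglyMeasurable u (volume : Measure R3))
    (hU : ∀ᵐ x, ‖u x‖ ≤ U) (hv : MemLp v 2 (volume : Measure R3)) (j : Fin 3) :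
    MemLp (stretchField u v j) 2 (volume : Measure R3) := by
  have hp := fun w : R3 → R3 => fun hw : AEStronglyMeasurable w (volume : Measure R3) =>
    (EuclideanSpace.proj (𝕜 := ℝ) j).continuous.comp_aestronglyMeasurable hw
  refine (memLp_stretch hu hU (memLp_complexify hv) j).of_le
    (((hp u hu).smul hv.1).sub ((hp v hv.1).smul hu)) (Filter.Eventually.of_forall fun x => ?_)
  rw [← complexify_stretchField, norm_complexify]

theorem eLpNorm_stretch_le {u : R3 → R3} {z : R3 → C3} {U : ℝ} (hU : ∀ᵐ x, ‖u x‖ ≤ U) (j : Fin 3) :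
    eLpNorm (stretch u z j) 2 (volume : Measure R3) ≤
      2 * ENNReal.ofReal U * eLpNorm z 2 (volume : Measure R3) := by
  obtain ⟨y, hy⟩ := hU.exists
  have hU0 : 0 ≤ U := (norm_nonneg _).trans hy
  have := eLpNorm_le_mul_eLpNorm_of_ae_le_mul (f := stretch u z j) (g := z) (c := 2 * U)
    (μ := (volume : Measure R3)) (by
      filter_upwards [hU] with x hx
      exact (norm_stretch_le u z j x).trans (by gcongr)) 2
  rwa [ENNReal.ofReal_mul (by norm_num), ENNReal.ofReal_ofNat] at this

theorem eLpNorm_two_sq {E : Type*} [NormedAddCommGroup E] (f : R3 → E) :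
    eLpNorm f 2 (volume : Measure R3) ^ 2 = ∫⁻ x, ‖f x‖ₑ ^ 2 := by
  simpa using eLpNorm_nnreal_pow_eq_lintegral (f := f) (μ := (volume : Measure R3)) (p := 2)
    (by norm_num)

theorem lintegral_enorm_sq_rpow {E : Type*} [NormedAddCommGroup E] (f : R3 → E) :
    (∫⁻ x, ‖f x‖ₑ ^ 2) ^ (1 / 2 : ℝ) = eLpNorm f 2 (volume : Measure R3) := by
  rw [← eLpNorm_two_sq, ENNReal.sq_rpow_half]

theorem eLpNorm_complexify (w : R3 → R3) :
    eLpNorm (complexify w) 2 (volume : Measure R3) = eLpNorm w 2 (volume : Measure R3) :=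
  eLpNorm_congr_norm_ae (Filter.Eventually.of_forall fun x => norm_complexify w x)

theorem exists_eLpNorm_conv_le (K : 𝓢(R3, ℂ)) : ∃ κ : ℝ≥0, ∀ f : R3 → C3,
    MemLp f 2 (volume : Measure R3) → MemLp (conv K f) 2 (volume : Measure R3) ∧
      eLpNorm (conv K f) 2 (volume : Measure R3) ≤ κ * eLpNorm f 2 (volume : Measure R3) := by
  obtain ⟨C, h0, hC⟩ := (𝓕 K).exists_le_weight
  refine ⟨Real.toNNReal C, fun f hf => ?_⟩
  obtain ⟨F, hF⟩ := FPair.exists_right hf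
  refine ⟨(hF.conv K).memLp_left, ?_⟩
  rw [← lintegral_enorm_sq_rpow, ← lintegral_enorm_sq_rpow f, (hF.conv K).lintegral_eq,
    hF.lintegral_eq, lintegral_enorm_sq_rpow, lintegral_enorm_sq_rpow]
  refine eLpNorm_le_mul_eLpNorm_of_ae_le_mul (Filter.Eventually.of_forall fun k => ?_) 2
  rw [norm_smul]
  gcongr
  exact (hC k).trans (mul_le_of_le_one_right h0 (weight_le_one k))

theorem lintegral_enorm_mul_le_eLpNorm {E F : Type*} [NormedAddCommGroup E] [NormedAddCommGroup F]
    {f : R3 → E} {g : R3 → F} (hf : AEStronglyMeasurable f (volume : Measure R3))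
    (hg : AEStronglyMeasurable g (volume : Measure R3)) :
    ∫⁻ x, ‖f x‖ₑ * ‖g x‖ₑ ≤ eLpNorm f 2 (volume : Measure R3) * eLpNorm g 2 (volume : Measure R3) := by
  rw [← lintegral_enorm_sq_rpow f, ← lintegral_enorm_sq_rpow g]
  exact lintegral_mul_le_sqrt hf.enorm hg.enorm

/-- The time derivative of `K * v` along the vorticity equation. -/
noncomputable def source (K : 𝓢(R3, ℂ)) (u v : R3 → R3) (x : R3) : C3 :=
  conv (lapK K) (complexify v) x -
    ∑ j, conv (∂_{stdVec j} K : 𝓢(R3, ℂ)) (stretch u (complexify v) j) x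

/-- A crude bound with a constant depending on the kernel. It serves only to justify Fubini's
theorem and does not enter the final estimate. -/
theorem exists_eLpNorm_source_le (K : 𝓢(R3, ℂ)) : ∃ κ : ℝ≥0, ∀ (u v : R3 → R3) (U : ℝ),
    AEStronglyMeasurable u (volume : Measure R3) → (∀ᵐ x, ‖u x‖ ≤ U) →
    MemLp v 2 (volume : Measure R3) → MemLp (source K u v) 2 (volume : Measure R3) ∧
      eLpNorm (source K u v) 2 (volume : Measure R3) ≤
        κ * (1 + ENNReal.ofReal U) * eLpNorm v 2 (volume : Measure R3) := by
  obtain ⟨κ, hκ⟩ := exists_eLpNorm_conv_le (lapK K)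
  choose l hl using fun j => exists_eLpNorm_conv_le (∂_{stdVec j} K : 𝓢(R3, ℂ))
  refine ⟨κ + ∑ j, l j * 2, fun u v U hu hU hv => ?_⟩
  have h1 := hκ _ (memLp_complexify hv)
  have h2 := fun j => hl j _ (memLp_stretch hu hU (memLp_complexify hv) j)
  have h3 := memLp_finsetSum Finset.univ fun j _ => (h2 j).1
  refine ⟨h1.1.sub h3, ?_⟩
  have h4 : eLpNorm (fun x => ∑ j, conv (∂_{stdVec j} K : 𝓢(R3, ℂ)) (stretch u (complexify v) j) x)
      2 (volume : Measure R3) ≤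
      ∑ j, (l j : ℝ≥0∞) * (2 * ENNReal.ofReal U * eLpNorm v 2 (volume : Measure R3)) := by
    have := eLpNorm_sum_le (p := 2) (μ := (volume : Measure R3)) (s := Finset.univ) (f := fun j =>
      conv (∂_{stdVec j} K : 𝓢(R3, ℂ)) (stretch u (complexify v) j))
      (fun j _ => (h2 j).1.1) (by norm_num)
    refine (eLpNorm_congr_ae (Filter.Eventually.of_forall fun x => ?_)).trans_le (this.trans
      (Finset.sum_le_sum fun j _ => ?_))
    · simp
    · refine (h2 j).2.trans ?_
      gcongr
      refine (eLpNorm_stretch_le hU j).trans ?_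
      rw [eLpNorm_complexify]
  calc _ ≤ eLpNorm (conv (lapK K) (complexify v)) 2 (volume : Measure R3) +
        eLpNorm (fun x => ∑ j, conv (∂_{stdVec j} K : 𝓢(R3, ℂ)) (stretch u (complexify v) j) x)
          2 (volume : Measure R3) := eLpNorm_sub_le h1.1.1 h3.1 (by norm_num)
    _ ≤ κ * eLpNorm v 2 (volume : Measure R3) +
        ∑ j, (l j : ℝ≥0∞) * (2 * ENNReal.ofReal U * eLpNorm v 2 (volume : Measure R3)) := by
        gcongr
        exact h1.2.trans_eq (by rw [eLpNorm_complexify])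
    _ ≤ κ * (1 + ENNReal.ofReal U) * eLpNorm v 2 (volume : Measure R3) +
        ∑ j, (l j : ℝ≥0∞) * (2 * (1 + ENNReal.ofReal U) * eLpNorm v 2 (volume : Measure R3)) := by
        gcongr
        · exact le_mul_of_one_le_right zero_le le_self_add
        · exact le_add_self
    _ = _ := by
        push_cast
        rw [add_mul, add_mul, Finset.sum_mul, Finset.sum_mul]
        congr 1
        exact Finset.sum_congr rfl fun j _ => by ring

section Joint

variable {ν : Measure ℝ}

theorem aestronglyMeasurable_prod_conv [SFinite ν] (K : 𝓢(R3, ℂ)) {w : ℝ → R3 → C3}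
    (hw : AEStronglyMeasurable (fun p : ℝ × R3 => w p.1 p.2) (ν.prod volume)) :
    AEStronglyMeasurable (fun p : ℝ × R3 => conv K (w p.1) p.2) (ν.prod volume) := by
  refine ⟨fun p => ∫ y, K (p.2 - y) • hw.mk _ (p.1, y), ?_, ?_⟩
  · refine StronglyMeasurable.integral_prod_right' (f := fun q : (ℝ × R3) × R3 =>
      K (q.1.2 - q.2) • hw.mk _ (q.1.1, q.2)) ?_
    have hc : Continuous fun q : (ℝ × R3) × R3 => K (q.1.2 - q.2) := K.continuous.comp (by fun_prop)
    exact hc.stronglyMeasurable.smul (hw.stronglyMeasurable_mk.comp_measurable (by fun_prop))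
  · have h1 := Measure.ae_ae_of_ae_prod hw.ae_eq_mk
    have h2 := (Measure.quasiMeasurePreserving_fst (μ := ν) (ν := (volume : Measure R3))).ae h1
    filter_upwards [h2] with p hp
    refine integral_congr_ae ?_
    filter_upwards [hp] with y hy
    exact congrArg (K (p.2 - y) • ·) hy

theorem aestronglyMeasurable_prod_complexify {v : ℝ → R3 → R3}
    (hv : AEStronglyMeasurable (fun p : ℝ × R3 => v p.1 p.2) (ν.prod volume)) :
    AEStronglyMeasurable (fun p : ℝ × R3 => complexify (v p.1) p.2) (ν.prod volume) :=
  continuous_toC3.comp_aestronglyMeasurable hv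

theorem aestronglyMeasurable_prod_stretchField {u v : ℝ → R3 → R3}
    (hu : AEStronglyMeasurable (fun p : ℝ × R3 => u p.1 p.2) (ν.prod volume))
    (hv : AEStronglyMeasurable (fun p : ℝ × R3 => v p.1 p.2) (ν.prod volume)) (j : Fin 3) :
    AEStronglyMeasurable (fun p : ℝ × R3 => stretchField (u p.1) (v p.1) j p.2)
      (ν.prod volume) := by
  have hp := fun {w : ℝ → R3 → R3} (hw : AEStronglyMeasurable (fun p : ℝ × R3 => w p.1 p.2)
    (ν.prod volume)) => (EuclideanSpace.proj (𝕜 := ℝ) j).continuous.comp_aestronglyMeasurable hw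
  exact ((hp hu).smul hv).sub ((hp hv).smul hu)

theorem aestronglyMeasurable_prod_source [SFinite ν] (K : 𝓢(R3, ℂ)) {u v : ℝ → R3 → R3}
    (hu : AEStronglyMeasurable (fun p : ℝ × R3 => u p.1 p.2) (ν.prod volume))
    (hv : AEStronglyMeasurable (fun p : ℝ × R3 => v p.1 p.2) (ν.prod volume)) :
    AEStronglyMeasurable (fun p : ℝ × R3 => source K (u p.1) (v p.1) p.2) (ν.prod volume) := by
  have h1 := aestronglyMeasurable_prod_conv (lapK K) (w := fun s => complexify (v s))
    (aestronglyMeasurable_prod_complexify hv)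
  have h2 : ∀ j, AEStronglyMeasurable (fun p : ℝ × R3 =>
      conv (∂_{stdVec j} K : 𝓢(R3, ℂ)) (stretch (u p.1) (complexify (v p.1)) j) p.2)
      (ν.prod volume) := fun j => by
    refine aestronglyMeasurable_prod_conv (∂_{stdVec j} K : 𝓢(R3, ℂ))
      (w := fun s => stretch (u s) (complexify (v s)) j) ?_
    simp only [← complexify_stretchField]
    exact aestronglyMeasurable_prod_complexify (v := fun s => stretchField (u s) (v s) j)
      (aestronglyMeasurable_prod_stretchField hu hv j)
  exact h1.sub (Finset.aestronglyMeasurable_fun_sum _ fun j _ => h2 j)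

theorem integrable_prod_of_slice_le {E : Type*} [NormedAddCommGroup E] {h : ℝ × R3 → E}
    (hm : AEStronglyMeasurable h (ν.prod volume)) {β : ℝ → ℝ≥0∞}
    (hb : ∀ᵐ s ∂ν, ∫⁻ x, ‖h (s, x)‖ₑ ≤ β s) (hβ : ∫⁻ s, β s ∂ν < ⊤) :
    Integrable h (ν.prod volume) := by
  refine ⟨hm, ?_⟩
  rw [hasFiniteIntegral_iff_enorm, lintegral_prod _ hm.enorm]
  exact (lintegral_mono_ae hb).trans_lt hβ

end Joint

/-! ### The energy identity for a convolution of the solution -/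

/-- A solution of the vorticity equation on `[0, T)`, bounded in `L²` by `B`, for a velocity with
`‖u(t)‖_∞ ≤ U(t)`. -/
structure BoundedFlow (T : ℝ) (u v : ℝ → R3 → R3) (U : ℝ → ℝ) (B : ℝ≥0) : Prop where
  u_meas : SpaceTimeMeasurable T u
  v_meas : SpaceTimeMeasurable T v
  u_le : ∀ᵐ s ∂(volume.restrict (Ioo 0 T)), ∀ᵐ x, ‖u s x‖ ≤ U s
  U_int : IntegrableOn U (Ioo 0 T)
  v_memLp : ∀ t ∈ Ico 0 T, MemLp (v t) 2 volume
  v_le : ∀ t ∈ Ico 0 T, eLpNorm (v t) 2 volume ≤ B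
  div_free : ∀ᵐ t ∂(volume.restrict (Ioo 0 T)), IsWeaklyDivFree (u t)
  curl_eq : ∀ᵐ t ∂(volume.restrict (Ioo 0 T)), IsWeakCurl (u t) (v t)
  equation : ∀ t ∈ Ico 0 T, ∀ η, IsTest η → ∀ i : Fin 3,
    (∫ x, v t x i * η x) = (∫ x, v 0 x i * η x) +
      ∫ s in (0 : ℝ)..t, ∫ x, (v s x i * Laplacian.laplacian η x +
        ∑ j, (v s x i * u s x j - u s x i * v s x j) * fderiv ℝ η x (stdVec j))

/-- Slices in `L²` need not be integrable in `x`, but the weight is itself in `L²`, so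
Cauchy-Schwarz makes the weighted field integrable in space-time. -/
theorem integrable_weight_smul {E : Type*} [NormedAddCommGroup E] [NormedSpace ℝ E] {ν : Measure ℝ}
    {w : ℝ → R3 → E} (hm : AEStronglyMeasurable (fun p : ℝ × R3 => w p.1 p.2) (ν.prod volume))
    {β : ℝ → ℝ≥0∞} (hb : ∀ᵐ s ∂ν, eLpNorm (w s) 2 (volume : Measure R3) ≤ β s)
    (hβ : ∫⁻ s, β s ∂ν < ⊤) :
    Integrable (fun p : ℝ × R3 => weight p.2 • w p.1 p.2) (ν.prod volume) := by
  refine integrable_prod_of_slice_le (β := fun s => eLpNorm weight 2 (volume : Measure R3) * β s)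
    ((continuous_weight.comp continuous_snd).aestronglyMeasurable.smul hm) ?_ ?_
  · filter_upwards [hb, hm.prodMk_left] with s hs hms
    simp only [enorm_smul]
    exact (lintegral_enorm_mul_le_eLpNorm continuous_weight.aestronglyMeasurable hms).trans
      (by gcongr)
  · rw [lintegral_const_mul' _ _ memLp_weight_two.2.ne]
    exact ENNReal.mul_lt_top memLp_weight_two.2 hβ

/-- One derivative of `y ↦ K (x - y)` changes sign and two do not, which explains the minus sign in
front of the first order terms of `source`. -/
theorem source_apply {u v : R3 → R3} {U : ℝ} (hu : AEStronglyMeasurable u (volume : Measure R3))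
    (hU : ∀ᵐ x, ‖u x‖ ≤ U) (hv : MemLp v 2 (volume : Measure R3)) (K : 𝓢(R3, ℂ)) (x : R3)
    (i : Fin 3) : source K u v x i = ∫ y, ((v y i : ℂ) * lapK (reflShift K x) y +
      ∑ j, (stretchField u v j y i : ℂ) * (∂_{stdVec j} (reflShift K x)) y) := by
  have hs := fun j => weightIntegrable_of_two (memLp_stretchField hu hU hv j)
  have hv' := weightIntegrable_of_two hv
  have h1 : source K u v x i = conv (lapK K) (complexify v) x i -
      ∑ j, conv (∂_{stdVec j} K : 𝓢(R3, ℂ)) (complexify (stretchField u v j)) x i := by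
    simp only [complexify_stretchField]
    simp [source]
  rw [h1, integral_add (integrable_mul_schwartz (hv' i) _) (integrable_finsetSum _ fun j _ =>
    integrable_mul_schwartz (hs j i) _), integral_finsetSum _ fun j _ =>
    integrable_mul_schwartz (hs j i) _, conv_complexify_apply hv', lapK_reflShift, sub_eq_add_neg,
    ← Finset.sum_neg_distrib]
  congr 1
  refine Finset.sum_congr rfl fun j _ => ?_
  rw [conv_complexify_apply (hs j), lineDeriv_reflShift, ← pair_neg]
  rfl

namespace BoundedFlow

variable {T : ℝ} {u v : ℝ → R3 → R3} {U : ℝ → ℝ} {B : ℝ≥0}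

theorem ae_slice (h : BoundedFlow T u v U B) : ∀ᵐ s ∂(volume.restrict (Ioo 0 T)),
    AEStronglyMeasurable (u s) (volume : Measure R3) ∧ (∀ᵐ x, ‖u s x‖ ≤ U s) ∧
      MemLp (v s) 2 (volume : Measure R3) ∧ eLpNorm (v s) 2 (volume : Measure R3) ≤ B := by
  filter_upwards [h.u_meas.prodMk_left, h.u_le, ae_restrict_mem measurableSet_Ioo] with s h1 h2 h3
  exact ⟨h1, h2, h.v_memLp s (Ioo_subset_Ico_self h3), h.v_le s (Ioo_subset_Ico_self h3)⟩

theorem lintegral_lt_top (h : BoundedFlow T u v U B) (c : ℝ≥0) :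
    ∫⁻ s in Ioo 0 T, c * (1 + ENNReal.ofReal (U s)) * B < ⊤ := by
  rw [lintegral_mul_const' _ _ ENNReal.coe_ne_top, lintegral_const_mul' _ _ ENNReal.coe_ne_top,
    lintegral_add_left measurable_const]
  refine ENNReal.mul_lt_top (ENNReal.mul_lt_top ENNReal.coe_lt_top (ENNReal.add_lt_top.2 ⟨?_, ?_⟩))
    ENNReal.coe_lt_top
  · simp
  · exact h.U_int.lintegral_lt_top

theorem integrable_weight_v (h : BoundedFlow T u v U B) (i : Fin 3) :
    Integrable (fun p : ℝ × R3 => weight p.2 * v p.1 p.2 i)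
      ((volume.restrict (Ioo 0 T)).prod volume) := by
  have := integrable_weight_smul (ν := volume.restrict (Ioo 0 T)) (w := v) h.v_meas
    (β := fun _ => B) (by filter_upwards [h.ae_slice] with s hs using hs.2.2.2) (by
      rw [lintegral_const]
      exact ENNReal.mul_lt_top ENNReal.coe_lt_top (by simp))
  exact (EuclideanSpace.proj (𝕜 := ℝ) i).integrable_comp this

theorem integrable_weight_stretchField (h : BoundedFlow T u v U B) (i j : Fin 3) :
    Integrable (fun p : ℝ × R3 => weight p.2 * stretchField (u p.1) (v p.1) j p.2 i)
      ((volume.restrict (Ioo 0 T)).prod volume) := by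
  have := integrable_weight_smul (ν := volume.restrict (Ioo 0 T))
    (w := fun s => stretchField (u s) (v s) j)
    (aestronglyMeasurable_prod_stretchField h.u_meas h.v_meas j)
    (β := fun s => (2 : ℝ≥0) * (1 + ENNReal.ofReal (U s)) * B) (by
      filter_upwards [h.ae_slice] with s hs
      rw [← eLpNorm_complexify, complexify_stretchField]
      refine (eLpNorm_stretch_le hs.2.1 j).trans ?_
      rw [eLpNorm_complexify]
      push_cast
      gcongr
      · exact le_add_self
      · exact hs.2.2.2) (h.lintegral_lt_top 2)
  exact (EuclideanSpace.proj (𝕜 := ℝ) i).integrable_comp this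

theorem restrict_Ioc_le {t : ℝ} (ht : t ∈ Ico 0 T) :
    (volume : Measure ℝ).restrict (Ioc 0 t) ≤ volume.restrict (Ioo 0 T) :=
  Measure.restrict_mono (Ioc_subset_Ioo_right ht.2) le_rfl

/-- The equation tested with `y ↦ K (x - y)`, which is Schwartz but usually not compactly supported.
The result is an ordinary differential equation in integrated form at each fixed `x`. -/
theorem conv_eq_add_integral (h : BoundedFlow T u v U B) (K : 𝓢(R3, ℂ)) {t : ℝ} (ht : t ∈ Ico 0 T)
    (x : R3) (i : Fin 3) : conv K (complexify (v t)) x i = conv K (complexify (v 0)) x i +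
      ∫ s in (0 : ℝ)..t, source K (u s) (v s) x i := by
  have h0 : (0 : ℝ) ∈ Ico 0 T := ⟨le_rfl, ht.1.trans_lt ht.2⟩
  have hwt := weightIntegrable_of_two (h.v_memLp t ht)
  have hw0 := weightIntegrable_of_two (h.v_memLp 0 h0)
  have hle := Measure.prod_mono (restrict_Ioc_le ht) (le_refl (volume : Measure R3))
  have hi := integral_evolution_schwartz (ν := volume.restrict (Ioc 0 t))
    (a := fun x => v t x i - v 0 x i) (P := fun s x => v s x i)
    (B := fun j s x => stretchField (u s) (v s) j x i)
    (by simp only [mul_sub]; exact (hwt i).sub (hw0 i))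
    ((h.integrable_weight_v i).mono_measure hle)
    (fun j => (h.integrable_weight_stretchField i j).mono_measure hle)
    (fun η hη => by
      have e := h.equation t ht η hη i
      rw [← sub_eq_iff_eq_add', ← integral_sub (hη.integrable_mul (hwt i))
        (hη.integrable_mul (hw0 i)), intervalIntegral.integral_of_le ht.1] at e
      simp only [sub_mul]
      rw [e]
      congr 1
      ext s
      congr 1
      ext x
      congr 1
      refine Finset.sum_congr rfl fun j _ => ?_
      simp only [stretchField, PiLp.sub_apply, PiLp.smul_apply, smul_eq_mul]
      ring) (reflShift K x)
  rw [conv_complexify_apply hwt, conv_complexify_apply hw0, ← sub_eq_iff_eq_add', pair, pair,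
    ← integral_sub (integrable_mul_schwartz (hwt i) _) (integrable_mul_schwartz (hw0 i) _),
    intervalIntegral.integral_of_le ht.1]
  simp only [Complex.ofReal_sub, sub_mul] at hi
  rw [hi]
  refine integral_congr_ae ?_
  filter_upwards [ae_mono (restrict_Ioc_le ht) h.ae_slice] with s hs
  exact (source_apply hs.1 hs.2.1 hs.2.2.1 K x i).symm

theorem aestronglyMeasurable_source (h : BoundedFlow T u v U B) (K : 𝓢(R3, ℂ)) :
    AEStronglyMeasurable (fun p : ℝ × R3 => source K (u p.1) (v p.1) p.2)
      ((volume.restrict (Ioo 0 T)).prod volume) :=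
  aestronglyMeasurable_prod_source K h.u_meas h.v_meas

theorem aestronglyMeasurable_conv (h : BoundedFlow T u v U B) (K : 𝓢(R3, ℂ)) :
    AEStronglyMeasurable (fun p : ℝ × R3 => conv K (complexify (v p.1)) p.2)
      ((volume.restrict (Ioo 0 T)).prod volume) :=
  aestronglyMeasurable_prod_conv K (w := fun s => complexify (v s))
    (aestronglyMeasurable_prod_complexify h.v_meas)

theorem ae_intervalIntegrable_source (h : BoundedFlow T u v U B) (K : 𝓢(R3, ℂ)) {t : ℝ}
    (ht : t ∈ Ico 0 T) :
    ∀ᵐ x, IntervalIntegrable (fun s => source K (u s) (v s) x) volume 0 t := by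
  obtain ⟨κ, hκ⟩ := exists_eLpNorm_source_le K
  have h1 := integrable_weight_smul (ν := volume.restrict (Ioo 0 T))
    (w := fun s => source K (u s) (v s)) (h.aestronglyMeasurable_source K)
    (β := fun s => κ * (1 + ENNReal.ofReal (U s)) * B) (by
      filter_upwards [h.ae_slice] with s hs
      refine (hκ _ _ _ hs.1 hs.2.1 hs.2.2.1).2.trans ?_
      gcongr
      exact hs.2.2.2) (h.lintegral_lt_top κ)
  have h2 := h1.mono_measure (Measure.prod_mono (restrict_Ioc_le ht) (le_refl (volume : Measure R3)))
  filter_upwards [h2.prod_left_ae] with x hx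
  rw [intervalIntegrable_iff_integrableOn_Ioc_of_le ht.1]
  have := hx.smul (weight x)⁻¹
  refine this.congr (Filter.Eventually.of_forall fun s => ?_)
  simp [smul_smul, (weight_pos x).ne']

theorem integrable_inner_source (h : BoundedFlow T u v U B) (K : 𝓢(R3, ℂ)) :
    Integrable (fun p : ℝ × R3 => inner ℂ (conv K (complexify (v p.1)) p.2)
      (source K (u p.1) (v p.1) p.2)) ((volume.restrict (Ioo 0 T)).prod volume) := by
  obtain ⟨κ, hκ⟩ := exists_eLpNorm_source_le K
  obtain ⟨l, hl⟩ := exists_eLpNorm_conv_le K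
  refine integrable_prod_of_slice_le (β := fun s => (l * B * κ : ℝ≥0) * (1 + ENNReal.ofReal (U s)) * B)
    ((h.aestronglyMeasurable_conv K).inner (h.aestronglyMeasurable_source K)) ?_
    (h.lintegral_lt_top _)
  filter_upwards [h.ae_slice] with s hs
  have h1 := hκ _ _ _ hs.1 hs.2.1 hs.2.2.1
  have h2 := hl _ (memLp_complexify hs.2.2.1)
  rw [eLpNorm_complexify] at h2
  calc _ ≤ ∫⁻ x, ‖conv K (complexify (v s)) x‖ₑ * ‖source K (u s) (v s) x‖ₑ := by
        refine lintegral_mono fun x => ?_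
        rw [← ofReal_norm, ← ofReal_norm, ← ofReal_norm, ← ENNReal.ofReal_mul (norm_nonneg _)]
        exact ENNReal.ofReal_le_ofReal (norm_inner_le_norm _ _)
    _ ≤ (l * B) * (κ * (1 + ENNReal.ofReal (U s)) * B) := by
        refine (lintegral_enorm_mul_le_eLpNorm h2.1.1 h1.1.1).trans ?_
        gcongr
        · exact h2.2.trans (by gcongr; exact hs.2.2.2)
        · exact h1.2.trans (by gcongr; exact hs.2.2.2)
    _ = _ := by push_cast; ring

/-- At almost every `x` the squared norm is differentiated along the pointwise evolution, and the
result is integrated in `x` by Fubini. No time derivative with values in a function space is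
required. -/
theorem integral_norm_sq_conv_eq (h : BoundedFlow T u v U B) (K : 𝓢(R3, ℂ)) {t : ℝ}
    (ht : t ∈ Ico 0 T) : ∫ x, ‖conv K (complexify (v t)) x‖ ^ 2 =
      (∫ x, ‖conv K (complexify (v 0)) x‖ ^ 2) + 2 * ∫ s in Ioc 0 t,
        (∫ x, inner ℂ (conv K (complexify (v s)) x) (source K (u s) (v s) x)).re := by
  have h0 : (0 : ℝ) ∈ Ico 0 T := ⟨le_rfl, ht.1.trans_lt ht.2⟩
  obtain ⟨l, hl⟩ := exists_eLpNorm_conv_le K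
  have hsq : ∀ s ∈ Ico 0 T, Integrable fun x => ‖conv K (complexify (v s)) x‖ ^ 2 := fun s hs => by
    have := (hl _ (memLp_complexify (h.v_memLp s hs))).1
    exact (memLp_two_iff_integrable_sq_norm this.1).1 this
  have hint := (h.integrable_inner_source K).mono_measure
    (Measure.prod_mono (restrict_Ioc_le ht) (le_refl (volume : Measure R3)))
  have hre : Integrable (fun p : ℝ × R3 => (inner ℂ (conv K (complexify (v p.1)) p.2)
      (source K (u p.1) (v p.1) p.2)).re) ((volume.restrict (Ioc 0 t)).prod volume) := hint.re
  have h1 : ∀ᵐ x, ‖conv K (complexify (v t)) x‖ ^ 2 = ‖conv K (complexify (v 0)) x‖ ^ 2 +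
      2 * ∫ s in Ioc 0 t, (inner ℂ (conv K (complexify (v s)) x) (source K (u s) (v s) x)).re := by
    filter_upwards [h.ae_intervalIntegrable_source K ht] with x hx
    have := norm_sq_primitive_eq (φ := fun s => conv K (complexify (v s)) x)
      (c := conv K (complexify (v 0)) x) ht.1 hx (fun r hr => by
        ext i
        have hr' : r ∈ Ico 0 T := ⟨hr.1, hr.2.trans_lt ht.2⟩
        rw [h.conv_eq_add_integral K hr' x i, PiLp.add_apply]
        congr 1
        have hx' : IntervalIntegrable (fun s => source K (u s) (v s) x) volume 0 r :=
          hx.mono_set (by rw [uIcc_of_le hr.1, uIcc_of_le ht.1]; exact Icc_subset_Icc_right hr.2)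
        exact (EuclideanSpace.proj (𝕜 := ℂ) i).intervalIntegral_comp_comm hx')
    rw [intervalIntegral.integral_of_le ht.1] at this
    exact this
  rw [integral_congr_ae h1, integral_add (hsq 0 h0) (hre.integral_prod_right.const_mul 2),
    integral_const_mul]
  congr 2
  rw [← integral_integral_swap (f := fun s x =>
    (inner ℂ (conv K (complexify (v s)) x) (source K (u s) (v s) x)).re) hre]
  refine integral_congr_ae ?_
  filter_upwards [hint.prod_right_ae] with s hs
  exact integral_re hs

end BoundedFlow

/-! ### Energy balance of a single block -/

namespace LittlewoodPaley

variable (D : LittlewoodPaley)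

theorem conj_multiplier (n : ℕ) (k : R3) : conj (D.multiplier n k) = D.multiplier n k :=
  Complex.conj_ofReal _

theorem integral_inner_lapK_kern (n : ℕ) {v : R3 → R3} (hv : MemLp v 2 (volume : Measure R3)) :
    ∫ x, inner ℂ (conv (D.kern n) (complexify v) x) (conv (lapK (D.kern n)) (complexify v) x) =
      -((D.gradSq n v).toReal : ℂ) := by
  obtain ⟨V, hV⟩ := FPair.exists_right (memLp_complexify hv)
  rw [(hV.conv (D.kern n)).inner_integral (hV.conv (lapK (D.kern n))), D.gradSq_eq n hV]
  have hm : AEStronglyMeasurable (fun k => ‖D.multiplier n k‖ ^ 2 *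
      ((2 * Real.pi * ‖k‖) ^ 2 * ‖V k‖ ^ 2)) (volume : Measure R3) :=
    ((D.contDiff_multiplier n).continuous.norm.pow 2).aestronglyMeasurable.mul
      ((by fun_prop : Continuous fun k : R3 => (2 * Real.pi * ‖k‖) ^ 2).aestronglyMeasurable.mul
        (hV.memLp_right.1.norm.pow 2))
  have h1 : (∫⁻ k, ‖D.multiplier n k‖ₑ ^ 2 *
      (ENNReal.ofReal ((2 * Real.pi * ‖k‖) ^ 2) * ‖V k‖ₑ ^ 2)).toReal =
      ∫ k, ‖D.multiplier n k‖ ^ 2 * ((2 * Real.pi * ‖k‖) ^ 2 * ‖V k‖ ^ 2) := by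
    rw [integral_eq_lintegral_of_nonneg_ae (Filter.Eventually.of_forall fun k => by
      dsimp only [Pi.zero_apply]; positivity) hm]
    congr 1
    refine lintegral_congr fun k => ?_
    rw [ENNReal.ofReal_mul (by positivity), ENNReal.ofReal_mul (by positivity),
      ENNReal.ofReal_pow (norm_nonneg _), ENNReal.ofReal_pow (norm_nonneg _), ofReal_norm,
      ofReal_norm]
  rw [h1, ← integral_complex_ofReal, ← integral_neg]
  refine integral_congr_ae (Filter.Eventually.of_forall fun k => ?_)
  simp only [inner_smul_left, inner_smul_right, fourier_lapK_apply, fourier_kern, conj_multiplier,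
    inner_self_eq_norm_sq_to_K]
  have : (‖D.multiplier n k‖ ^ 2 : ℂ) = D.multiplier n k * D.multiplier n k := by
    rw [← Complex.conj_mul', conj_multiplier]
  push_cast
  rw [this]
  simp only [Complex.coe_algebraMap]
  ring

/-- By Parseval the real block symbol and the skew-adjoint `∂_j` pass to the other factor, which
produces the square and the sign in `gradKern`. -/
theorem integral_inner_lineDeriv_kern (n : ℕ) {z w : R3 → C3} (hz : MemLp z 2 (volume : Measure R3))
    (hw : MemLp w 2 (volume : Measure R3)) (j : Fin 3) :
    ∫ x, inner ℂ (conv (D.kern n) z x) (conv (∂_{stdVec j} (D.kern n) : 𝓢(R3, ℂ)) w x) =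
      ∫ x, inner ℂ (conv (D.gradKern n j) z x) (w x) := by
  obtain ⟨V, hV⟩ := FPair.exists_right hz
  obtain ⟨W, hW⟩ := FPair.exists_right hw
  rw [(hV.conv (D.kern n)).inner_integral (hW.conv _), (hV.conv (D.gradKern n j)).inner_integral hW]
  refine integral_congr_ae (Filter.Eventually.of_forall fun k => ?_)
  simp only [inner_smul_left, inner_smul_right, fourier_lineDeriv_apply, fourier_kern,
    fourier_gradKern, conj_multiplier, map_mul, map_neg, map_pow, Complex.conj_I, Complex.conj_ofReal,
    map_ofNat]
  ring

theorem integral_inner_source (n : ℕ) {u v : R3 → R3} {U : ℝ}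
    (hu : AEStronglyMeasurable u (volume : Measure R3))
    (hU : ∀ᵐ x, ‖u x‖ ≤ U) (hv : MemLp v 2 (volume : Measure R3)) :
    ∫ x, inner ℂ (conv (D.kern n) (complexify v) x) (source (D.kern n) u v x) =
      -((D.gradSq n v).toReal : ℂ) - D.flux n u v := by
  obtain ⟨V, hV⟩ := FPair.exists_right (memLp_complexify hv)
  have hS := fun j => memLp_stretch hu hU (memLp_complexify hv) j
  have h1 := (hV.conv (D.kern n)).memLp_left
  have h2 := h1.integrable_inner_two (hV.conv (lapK (D.kern n))).memLp_left
  have h3 : ∀ j, Integrable fun x => inner ℂ (conv (D.kern n) (complexify v) x)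
      (conv (∂_{stdVec j} (D.kern n) : 𝓢(R3, ℂ)) (stretch u (complexify v) j) x) := fun j => by
    obtain ⟨W, hW⟩ := FPair.exists_right (hS j)
    exact h1.integrable_inner_two (hW.conv _).memLp_left
  simp only [source, inner_sub_right, inner_sum]
  rw [integral_sub h2 (integrable_finsetSum _ fun j _ => h3 j), integral_finsetSum _ fun j _ => h3 j,
    D.integral_inner_lapK_kern n hv, flux]
  congr 1
  exact Finset.sum_congr rfl fun j _ =>
    D.integral_inner_lineDeriv_kern n (memLp_complexify hv) (hS j) j

theorem convSq_kern_le (n : ℕ) {w : R3 → R3} (hw : MemLp w 2 (volume : Measure R3)) :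
    convSq (D.kern n) w ≤ eLpNorm w 2 (volume : Measure R3) ^ 2 :=
  (ENNReal.le_tsum n).trans (D.tsum_convSq_le hw)

end LittlewoodPaley

/-- Monotone convergence along times increasing to `T`; the endpoint is excluded because the
equation is only given for `t < T`. -/
theorem setLIntegral_Ioo_le {f : ℝ → ℝ≥0∞} {T : ℝ} {c : ℝ≥0∞}
    (h : ∀ t ∈ Ico 0 T, ∫⁻ s in Ioc 0 t, f s ≤ c) : ∫⁻ s in Ioo 0 T, f s ≤ c := by
  by_cases hT : T ≤ 0
  · simp [Ioo_eq_empty (not_lt.2 hT)]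
  push Not at hT
  obtain ⟨τ, hmono, hlt, hlim⟩ := exists_seq_strictMono_tendsto' hT
  have hU : Ioo 0 T = ⋃ n, Ioc 0 (τ n) := by
    ext s
    simp only [mem_iUnion, mem_Ioc, mem_Ioo]
    constructor
    · rintro ⟨h1, h2⟩
      obtain ⟨n, hn⟩ := (hlim.eventually (lt_mem_nhds h2)).exists
      exact ⟨n, h1, hn.le⟩
    · rintro ⟨n, h1, h2⟩
      exact ⟨h1, h2.trans_lt (hlt n).2⟩
  have hdir : Monotone fun n => Ioc 0 (τ n) := fun m n hmn =>
    Ioc_subset_Ioc_right (hmono.monotone hmn)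
  rw [hU, ← withDensity_apply', hdir.directed_le.measure_iUnion]
  refine iSup_le fun n => ?_
  rw [withDensity_apply']
  exact h _ ⟨(hlt n).1.le, (hlt n).2⟩

namespace BoundedFlow

variable {T : ℝ} {u v : ℝ → R3 → R3} {U : ℝ → ℝ} {B : ℝ≥0}

theorem aemeasurable_convSq (h : BoundedFlow T u v U B) (K : 𝓢(R3, ℂ)) :
    AEMeasurable (fun s => convSq K (v s)) (volume.restrict (Ioo 0 T)) :=
  ((h.aestronglyMeasurable_conv K).enorm.pow_const 2).lintegral_prod_right'

theorem aemeasurable_gradSq (h : BoundedFlow T u v U B) (D : LittlewoodPaley) (n : ℕ) :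
    AEMeasurable (fun s => D.gradSq n (v s)) (volume.restrict (Ioo 0 T)) :=
  Finset.aemeasurable_fun_sum _ fun _ _ => h.aemeasurable_convSq _

theorem gradSq_le (h : BoundedFlow T u v U B) (D : LittlewoodPaley) (n : ℕ) {s : ℝ}
    (hs : s ∈ Ico 0 T) : D.gradSq n (v s) ≤ 2 * 4 ^ n * (B : ℝ≥0∞) ^ 2 := by
  refine (D.gradSq_le n (h.v_memLp s hs)).trans ?_
  gcongr
  refine (D.convSq_kern_le n (h.v_memLp s hs)).trans ?_
  gcongr
  exact h.v_le s hs

/-- The dissipation of one block is finite by Bernstein and the `L²` bound. It can therefore be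
moved to the left in a real identity before returning to `[0, ∞]`. -/
theorem convSq_add_le (h : BoundedFlow T u v U B) (D : LittlewoodPaley) (n : ℕ) {t : ℝ}
    (ht : t ∈ Ico 0 T) : convSq (D.kern n) (v t) + 2 * ∫⁻ s in Ioc 0 t, D.gradSq n (v s) ≤
      convSq (D.kern n) (v 0) + 2 * ∫⁻ s in Ioc 0 t, ‖D.flux n (u s) (v s)‖ₑ := by
  have h0 : (0 : ℝ) ∈ Ico 0 T := ⟨le_rfl, ht.1.trans_lt ht.2⟩
  have hA : ∀ s ∈ Ico 0 T, ENNReal.ofReal (∫ x, ‖conv (D.kern n) (complexify (v s)) x‖ ^ 2) =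
      convSq (D.kern n) (v s) := fun s hs => by
    obtain ⟨V, hV⟩ := FPair.exists_right (memLp_complexify (h.v_memLp s hs))
    have hm := (hV.conv (D.kern n)).memLp_left
    rw [ofReal_integral_eq_lintegral_ofReal ((memLp_two_iff_integrable_sq_norm hm.1).1 hm)
      (Filter.Eventually.of_forall fun x => by positivity)]
    refine lintegral_congr fun x => ?_
    rw [ENNReal.ofReal_pow (norm_nonneg _), ofReal_norm]
  have key := h.integral_norm_sq_conv_eq (D.kern n) ht
  have hle := restrict_Ioc_le ht
  have hint := (h.integrable_inner_source (D.kern n)).mono_measure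
    (Measure.prod_mono hle (le_refl (volume : Measure R3)))
  set I : ℝ → ℝ := fun s => (∫ x, inner ℂ (conv (D.kern n) (complexify (v s)) x)
    (source (D.kern n) (u s) (v s) x)).re with hI
  have hIint : Integrable I (volume.restrict (Ioc 0 t)) := hint.integral_prod_left.re
  have hgm : AEMeasurable (fun s => D.gradSq n (v s)) (volume.restrict (Ioc 0 t)) :=
    (h.aemeasurable_gradSq D n).mono_measure hle
  have hslice := ae_mono hle h.ae_slice
  have hmem : ∀ᵐ s ∂(volume.restrict (Ioc 0 t)), s ∈ Ico 0 T := by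
    filter_upwards [ae_restrict_mem measurableSet_Ioc] with s hs
    exact ⟨hs.1.le, hs.2.trans_lt ht.2⟩
  have hgfin : ∫⁻ s in Ioc 0 t, D.gradSq n (v s) ≠ ⊤ := by
    refine ((lintegral_mono_ae (hmem.mono fun s hs => h.gradSq_le D n hs)).trans_lt ?_).ne
    rw [lintegral_const]
    exact ENNReal.mul_lt_top (by finiteness) (by simp)
  set g : ℝ → ℝ := fun s => (D.gradSq n (v s)).toReal with hg
  have hgint : Integrable g (volume.restrict (Ioc 0 t)) :=
    integrable_toReal_of_lintegral_ne_top hgm hgfin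
  have hgeq : ENNReal.ofReal (∫ s in Ioc 0 t, g s) = ∫⁻ s in Ioc 0 t, D.gradSq n (v s) := by
    rw [ofReal_integral_eq_lintegral_ofReal hgint (Filter.Eventually.of_forall fun s => by
      dsimp only [Pi.zero_apply, hg]; positivity)]
    refine lintegral_congr_ae (hmem.mono fun s hs => ?_)
    exact ENNReal.ofReal_toReal ((h.gradSq_le D n hs).trans_lt (by finiteness)).ne
  have hN : ENNReal.ofReal (∫ s in Ioc 0 t, (I s + g s)) ≤
      ∫⁻ s in Ioc 0 t, ‖D.flux n (u s) (v s)‖ₑ := by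
    refine (ENNReal.ofReal_le_ofReal (Real.le_norm_self _)).trans ?_
    rw [ofReal_norm]
    refine (enorm_integral_le_lintegral_enorm _).trans (lintegral_mono_ae ?_)
    filter_upwards [hslice] with s hs
    -- The viscous part of `I` cancels against `g`, leaving the nonlinear flux alone.
    have e : I s + g s = -(D.flux n (u s) (v s)).re := by
      rw [hI, hg]
      simp only
      rw [D.integral_inner_source n hs.1 hs.2.1 hs.2.2.1]
      simp only [Complex.sub_re, Complex.neg_re, Complex.ofReal_re]
      ring
    rw [e, ← ofReal_norm, ← ofReal_norm, norm_neg]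
    exact ENNReal.ofReal_le_ofReal (Complex.abs_re_le_norm _)
  have h2 : (∫ x, ‖conv (D.kern n) (complexify (v t)) x‖ ^ 2) + 2 * ∫ s in Ioc 0 t, g s =
      (∫ x, ‖conv (D.kern n) (complexify (v 0)) x‖ ^ 2) + 2 * ∫ s in Ioc 0 t, (I s + g s) := by
    rw [key, integral_add hIint hgint]
    ring
  rw [← hA t ht, ← hA 0 h0, ← hgeq]
  have h3 : ENNReal.ofReal (∫ x, ‖conv (D.kern n) (complexify (v t)) x‖ ^ 2) +
      2 * ENNReal.ofReal (∫ s in Ioc 0 t, g s) =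
      ENNReal.ofReal ((∫ x, ‖conv (D.kern n) (complexify (v t)) x‖ ^ 2) +
        2 * ∫ s in Ioc 0 t, g s) := by
    have hg0 : 0 ≤ ∫ s in Ioc 0 t, g s :=
      integral_nonneg fun s => by dsimp only [Pi.zero_apply, hg]; positivity
    rw [ENNReal.ofReal_add (by positivity) (by positivity), ENNReal.ofReal_mul (by norm_num),
      ENNReal.ofReal_ofNat]
  rw [h3, h2]
  refine ENNReal.ofReal_add_le.trans ?_
  gcongr
  rw [ENNReal.ofReal_mul (by norm_num), ENNReal.ofReal_ofNat]
  gcongr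

/-- The energy inequality for one block. -/
theorem energy_le (h : BoundedFlow T u v U B) (D : LittlewoodPaley) (n : ℕ) :
    (⨆ t ∈ Ico 0 T, 2⁻¹ * convSq (D.kern n) (v t)) + ∫⁻ s in Ioo 0 T, D.gradSq n (v s) ≤
      convSq (D.kern n) (v 0) + 2 * ∫⁻ s in Ioo 0 T, ‖D.flux n (u s) (v s)‖ₑ := by
  set c := convSq (D.kern n) (v 0) + 2 * ∫⁻ s in Ioo 0 T, ‖D.flux n (u s) (v s)‖ₑ with hc
  have h1 : ∀ t ∈ Ico 0 T, convSq (D.kern n) (v t) + 2 * ∫⁻ s in Ioc 0 t, D.gradSq n (v s) ≤ c :=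
    fun t ht => (h.convSq_add_le D n ht).trans (by
      rw [hc]
      gcongr
      exact ht.2)
  -- The supremum and the dissipation may be attained at different times, so each is bounded by `c /
  -- 2` separately; the factors `1/2` and `2` make the sum exactly `c`.
  have h2 : (⨆ t ∈ Ico 0 T, 2⁻¹ * convSq (D.kern n) (v t)) ≤ 2⁻¹ * c :=
    iSup₂_le fun t ht => by gcongr; exact le_self_add.trans (h1 t ht)
  have h3 : ∫⁻ s in Ioo 0 T, D.gradSq n (v s) ≤ 2⁻¹ * c := setLIntegral_Ioo_le fun t ht => by
    have := le_add_self.trans (h1 t ht)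
    calc _ = 2⁻¹ * (2 * ∫⁻ s in Ioc 0 t, D.gradSq n (v s)) := by
          rw [← mul_assoc, ENNReal.inv_mul_cancel (by norm_num) (by norm_num), one_mul]
      _ ≤ 2⁻¹ * c := by gcongr
  calc _ ≤ 2⁻¹ * c + 2⁻¹ * c := add_le_add h2 h3
    _ = c := by rw [← add_mul, ENNReal.inv_two_add_inv_two, one_mul]

end BoundedFlow

/-! ### Duality for the Lorentz space in time -/

theorem aemeasurable_eLpNorm_top {ν : Measure ℝ} [SFinite ν] {u : ℝ → R3 → R3}
    (hu : AEStronglyMeasurable (fun p : ℝ × R3 => u p.1 p.2) (ν.prod volume)) :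
    AEMeasurable (fun s => eLpNorm (u s) ⊤ (volume : Measure R3)) ν := by
  refine ⟨fun s => eLpNorm (fun x => hu.mk _ (s, x)) ⊤ (volume : Measure R3), ?_, ?_⟩
  · refine measurable_of_Ioi fun c => ?_
    have hs : MeasurableSet {p : ℝ × R3 | c < ‖hu.mk _ p‖ₑ} :=
      measurableSet_lt measurable_const hu.stronglyMeasurable_mk.enorm
    -- The essential supremum of a slice exceeds `c` exactly when the slice of the superlevel set
    -- has positive measure, and that measure depends measurably on time.
    have hm := measurable_measure_prodMk_left (ν := (volume : Measure R3)) hs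
    convert hm (measurableSet_singleton 0).compl using 1
    ext s
    simp only [mem_preimage, mem_Ioi, mem_compl_iff, mem_singleton_iff, eLpNorm_exponent_top,
      ← not_le]
    refine not_congr ⟨fun h => ?_, fun h => essSup_le_of_ae_le c ?_⟩
    · have := ae_le_eLpNormEssSup (f := fun x => hu.mk _ (s, x)) (μ := (volume : Measure R3))
      refine measure_mono_null ?_ this
      exact fun x hx => not_le.2 (h.trans_lt (not_le.1 hx))
    · exact h
  · filter_upwards [Measure.ae_ae_of_ae_prod hu.ae_eq_mk] with s hs
    exact eLpNorm_congr_ae hs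

theorem setLIntegral_le_lorentzNorm (f : ℝ → ℝ≥0∞) {E : Set ℝ} (hE : MeasurableSet E)
    (hE' : E ⊆ Ioo 0 1) : ∫⁻ t in E, f t ≤ lorentzNorm f * volume E ^ (1 / 2 : ℝ) := by
  by_cases h0 : volume E = 0
  · rw [Measure.restrict_eq_zero.2 h0]; simp
  have hfin : volume E ≠ ⊤ := ((measure_mono hE').trans_lt (by simp)).ne
  rw [← ENNReal.div_le_iff]
  · exact le_iSup₂_of_le E hE (le_iSup₂_of_le hE' (pos_iff_ne_zero.2 h0) le_rfl)
  · exact (ENNReal.rpow_pos (pos_iff_ne_zero.2 h0) hfin).ne'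
  · exact ENNReal.rpow_ne_top_of_nonneg (by norm_num) hfin

/-- A dyadic layer cake with ratio `4`: a nonzero `a` lies between `4^{-k-1} M` and `4^{-k} M` for
some `k`, and that single term already dominates it. Finiteness of `M` makes the levels tend to
zero. -/
theorem le_tsum_four_adic {M a : ℝ≥0∞} (h : a ≤ M) (hM : M ≠ ⊤) :
    a ≤ ∑' k : ℕ, (4⁻¹ : ℝ≥0∞) ^ k * M * (if (4⁻¹ : ℝ≥0∞) ^ (k + 1) * M < a then 1 else 0) := by
  by_cases ha : a = 0
  · simp [ha]
  have hlim : Filter.Tendsto (fun k : ℕ => (4⁻¹ : ℝ≥0∞) ^ (k + 1) * M) Filter.atTop (nhds 0) := by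
    have h1 := (ENNReal.tendsto_pow_atTop_nhds_zero_of_lt_one
      (by norm_num : (4⁻¹ : ℝ≥0∞) < 1)).comp (Filter.tendsto_add_atTop_nat 1)
    have h2 := ENNReal.Tendsto.mul_const h1 (Or.inr hM)
    simpa using h2
  have hex : ∃ k : ℕ, (4⁻¹ : ℝ≥0∞) ^ (k + 1) * M < a :=
    (hlim.eventually (gt_mem_nhds (pos_iff_ne_zero.2 ha))).exists
  classical
  set k := Nat.find hex with hk
  have h1 : (4⁻¹ : ℝ≥0∞) ^ (k + 1) * M < a := Nat.find_spec hex
  have h2 : a ≤ (4⁻¹ : ℝ≥0∞) ^ k * M := by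
    rcases Nat.eq_zero_or_pos k with h0 | h0
    · simpa [h0] using h
    · have := Nat.find_min hex (m := k - 1) (by omega)
      rw [Nat.sub_add_cancel h0] at this
      exact not_lt.1 this
  refine le_trans ?_ (ENNReal.le_tsum k)
  rw [if_pos h1, mul_one]
  exact h2

/-- With Chebyshev's bound `m ≤ 4^{k+1} I / M`, level `k` costs `4^{-k} M m^{1/2} ≤ 2 · 2^{-k} (I
M)^{1/2}`. The ratio `4` leaves the summable factor `2^{-k}` after the square root. -/
theorem four_inv_pow_mul_rpow_le {M I m : ℝ≥0∞} (k : ℕ)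
    (h : (4⁻¹ : ℝ≥0∞) ^ (k + 1) * M * m ≤ I) :
    (4⁻¹ : ℝ≥0∞) ^ k * M * m ^ (1 / 2 : ℝ) ≤ 2 * (I * M) ^ (1 / 2 : ℝ) * 2⁻¹ ^ k := by
  have e4 : (4⁻¹ : ℝ≥0∞) = 2⁻¹ ^ 2 := by
    rw [← ENNReal.inv_pow]; norm_num
  calc (4⁻¹ : ℝ≥0∞) ^ k * M * m ^ (1 / 2 : ℝ)
      = (((4⁻¹ : ℝ≥0∞) ^ k * M) ^ 2 * m) ^ (1 / 2 : ℝ) := by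
        rw [ENNReal.mul_rpow_of_nonneg _ _ (by norm_num), ENNReal.sq_rpow_half]
    _ = ((2 * 2⁻¹ ^ k) ^ 2 * ((4⁻¹ : ℝ≥0∞) ^ (k + 1) * M * m * M)) ^ (1 / 2 : ℝ) := by
        congr 1
        have : (4 : ℝ≥0∞) * 4⁻¹ = 1 := ENNReal.mul_inv_cancel (by norm_num) (by norm_num)
        have h2 : ((2 : ℝ≥0∞) * 2⁻¹ ^ k) ^ 2 = 4 * 4⁻¹ ^ k := by
          rw [mul_pow, ← pow_mul, mul_comm k 2, pow_mul, ← e4]; norm_num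
        rw [h2]
        calc _ = (4 * 4⁻¹) * ((4⁻¹ : ℝ≥0∞) ^ k * (4⁻¹ ^ k * M * m * M)) := by rw [this]; ring
          _ = _ := by ring
    _ ≤ ((2 * 2⁻¹ ^ k) ^ 2 * (I * M)) ^ (1 / 2 : ℝ) := by gcongr
    _ = 2 * 2⁻¹ ^ k * (I * M) ^ (1 / 2 : ℝ) := by
        rw [ENNReal.mul_rpow_of_nonneg _ _ (by norm_num), ENNReal.sq_rpow_half]
    _ = _ := by ring

/-- Hölder's inequality between `L^{2,∞}` and `L^{2,1}`, the latter estimated by interpolation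
between `L¹` and `L^∞`. -/
theorem lintegral_mul_le_lorentzNorm {f g : ℝ → ℝ≥0∞} {T : ℝ} (hT : T ≤ 1) {M I : ℝ≥0∞}
    (hM : M ≠ ⊤) (hf : AEMeasurable f (volume.restrict (Ioo 0 T)))
    (hg : AEMeasurable g (volume.restrict (Ioo 0 T)))
    (hgM : ∀ᵐ s ∂(volume.restrict (Ioo 0 T)), g s ≤ M) (hgI : ∫⁻ s in Ioo 0 T, g s ≤ I) :
    ∫⁻ s in Ioo 0 T, f s * g s ≤ 4 * lorentzNorm f * (I * M) ^ (1 / 2 : ℝ) := by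
  set γ := hg.mk g with hγ
  have hγm : Measurable γ := hg.measurable_mk
  have hγe : g =ᵐ[volume.restrict (Ioo 0 T)] γ := hg.ae_eq_mk
  let S : ℕ → Set ℝ := fun k => {s | (4⁻¹ : ℝ≥0∞) ^ (k + 1) * M < γ s}
  have hS : ∀ k, MeasurableSet (S k) := fun k => measurableSet_lt measurable_const hγm
  have h1 : ∫⁻ s in Ioo 0 T, f s * g s ≤
      ∫⁻ s in Ioo 0 T, ∑' k : ℕ, (4⁻¹ : ℝ≥0∞) ^ k * M * (S k).indicator f s := by
    refine lintegral_mono_ae ?_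
    filter_upwards [hγe, hgM] with s hs hsM
    rw [hs] at hsM ⊢
    calc _ ≤ f s * ∑' k : ℕ, (4⁻¹ : ℝ≥0∞) ^ k * M *
          (if (4⁻¹ : ℝ≥0∞) ^ (k + 1) * M < γ s then 1 else 0) := by
          gcongr; exact le_tsum_four_adic hsM hM
      _ = _ := by
          rw [← ENNReal.tsum_mul_left]
          refine tsum_congr fun k => ?_
          by_cases hk : (4⁻¹ : ℝ≥0∞) ^ (k + 1) * M < γ s
          · rw [if_pos hk, indicator_of_mem (show s ∈ S k from hk)]; ring
          · rw [if_neg hk, indicator_of_notMem (show s ∉ S k from hk)]; ring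
  refine h1.trans ?_
  rw [lintegral_tsum fun k => (hf.indicator (hS k)).const_mul _]
  have h2 : ∀ k, ∫⁻ s in Ioo 0 T, (4⁻¹ : ℝ≥0∞) ^ k * M * (S k).indicator f s ≤
      lorentzNorm f * (2 * (I * M) ^ (1 / 2 : ℝ)) * 2⁻¹ ^ k := by
    intro k
    rw [lintegral_const_mul' _ _ (by finiteness), lintegral_indicator (hS k),
      Measure.restrict_restrict (hS k)]
    -- The Lorentz norm is used only through integrals of `f` over the superlevel sets of `g`, which
    -- is why its definition by sets suffices.
    have h3 := setLIntegral_le_lorentzNorm f ((hS k).inter measurableSet_Ioo)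
      (inter_subset_right.trans (Ioo_subset_Ioo_right hT) : S k ∩ Ioo 0 T ⊆ Ioo 0 1)
    have h4 : (4⁻¹ : ℝ≥0∞) ^ (k + 1) * M * volume (S k ∩ Ioo 0 T) ≤ I := by
      refine le_trans ?_ hgI
      rw [lintegral_congr_ae hγe, ← Measure.restrict_apply (hS k)]
      refine le_trans ?_ (mul_meas_ge_le_lintegral hγm ((4⁻¹ : ℝ≥0∞) ^ (k + 1) * M))
      gcongr
      exact fun s hs => show (4⁻¹ : ℝ≥0∞) ^ (k + 1) * M ≤ γ s from le_of_lt hs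
    calc _ ≤ (4⁻¹ : ℝ≥0∞) ^ k * M * (lorentzNorm f * volume (S k ∩ Ioo 0 T) ^ (1 / 2 : ℝ)) := by
          gcongr
      _ = lorentzNorm f * ((4⁻¹ : ℝ≥0∞) ^ k * M * volume (S k ∩ Ioo 0 T) ^ (1 / 2 : ℝ)) := by ring
      _ ≤ lorentzNorm f * (2 * (I * M) ^ (1 / 2 : ℝ) * 2⁻¹ ^ k) := by
          gcongr lorentzNorm f * ?_
          exact four_inv_pow_mul_rpow_le k h4
      _ = _ := by ring
  refine (ENNReal.tsum_le_tsum h2).trans (le_of_eq ?_)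
  -- The geometric sum of `2^{-k}` is `2`, which doubles the `2` of each level to the constant `4`.
  rw [ENNReal.tsum_mul_left, ENNReal.tsum_geometric, ENNReal.one_sub_inv_two, inv_inv]
  ring

/-! ### Weak gradient and gradients of blocks -/

namespace LittlewoodPaley

variable (D : LittlewoodPaley)

theorem sum_lintegral_weakPartial {v : R3 → R3} {G : Fin 3 → R3 → R3}
    (hv : MemLp v 2 (volume : Measure R3)) (hG : ∀ j, MemLp (G j) 2 (volume : Measure R3))
    (h : ∀ j, HasWeakPartial j v (G j)) {V : R3 → C3} (hV : FPair (complexify v) V) :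
    ∑ j, ∫⁻ x, ‖G j x‖ₑ ^ 2 = ∫⁻ k, ENNReal.ofReal ((2 * Real.pi * ‖k‖) ^ 2) * ‖V k‖ₑ ^ 2 := by
  have h1 : ∀ j, ∫⁻ x, ‖G j x‖ₑ ^ 2 =
      ∫⁻ k, ENNReal.ofReal ((2 * Real.pi * k j) ^ 2) * ‖V k‖ₑ ^ 2 := fun j => by
    have h2 := ((h j).fPair hv (hG j) hV).lintegral_eq
    simp only [enorm_complexify] at h2
    rw [h2]
    refine lintegral_congr fun k => ?_
    rw [enorm_smul, mul_pow, ← ofReal_norm, ← ENNReal.ofReal_pow (norm_nonneg _)]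
    congr 2
    rw [norm_mul, norm_mul, norm_mul, Complex.norm_I, Complex.norm_real, Complex.norm_real,
      Complex.norm_ofNat, mul_one, mul_pow, mul_pow, mul_pow, mul_pow, Real.norm_eq_abs,
      Real.norm_eq_abs, sq_abs, sq_abs]
  simp only [h1]
  rw [← lintegral_finsetSum']
  · refine lintegral_congr fun k => ?_
    rw [← Finset.sum_mul, ← ENNReal.ofReal_sum_of_nonneg fun _ _ => by positivity]
    congr 2
    rw [mul_pow, EuclideanSpace.norm_sq_eq, Finset.mul_sum]
    exact Finset.sum_congr rfl fun j _ => by rw [mul_pow, Real.norm_eq_abs, sq_abs]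
  · intro j _
    exact (ENNReal.continuous_ofReal.comp (by fun_prop : Continuous fun k : R3 =>
      (2 * Real.pi * k j) ^ 2)).measurable.aemeasurable.mul hV.aemeasurable_sq

theorem aemeasurable_gradient {f V : R3 → C3} (hV : FPair f V) :
    AEMeasurable fun k => ENNReal.ofReal ((2 * Real.pi * ‖k‖) ^ 2) * ‖V k‖ₑ ^ 2 :=
  (ENNReal.continuous_ofReal.comp (by fun_prop : Continuous fun k : R3 =>
    (2 * Real.pi * ‖k‖) ^ 2)).measurable.aemeasurable.mul hV.aemeasurable_sq

/-- Any weak gradient bounds the infimum from above. Plancherel and the lower half of almost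
orthogonality then give the factor `3`. -/
theorem gradNormSq_le {v : R3 → R3} {G : Fin 3 → R3 → R3}
    (hv : MemLp v 2 (volume : Measure R3)) (hG : ∀ j, MemLp (G j) 2 (volume : Measure R3))
    (h : ∀ j, HasWeakPartial j v (G j)) : gradNormSq v ≤ 3 * ∑' n, D.gradSq n v := by
  obtain ⟨V, hV⟩ := FPair.exists_right (memLp_complexify hv)
  refine (iInf₂_le G h).trans ?_
  rw [sum_lintegral_weakPartial hv hG h hV]
  simp only [D.gradSq_eq _ hV]
  exact D.lintegral_le_tsum_multiplier (aemeasurable_gradient hV)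

theorem tsum_gradSq_le {v : R3 → R3} {G : Fin 3 → R3 → R3}
    (hv : MemLp v 2 (volume : Measure R3)) (hG : ∀ j, MemLp (G j) 2 (volume : Measure R3))
    (h : ∀ j, HasWeakPartial j v (G j)) :
    ∑' n, D.gradSq n v ≤ ∑ j, ∫⁻ x, ‖G j x‖ₑ ^ 2 := by
  obtain ⟨V, hV⟩ := FPair.exists_right (memLp_complexify hv)
  rw [sum_lintegral_weakPartial hv hG h hV]
  simp only [D.gradSq_eq _ hV]
  exact D.tsum_lintegral_multiplier (aemeasurable_gradient hV)

end LittlewoodPaley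

/-! ### Summation over blocks -/

theorem ENNReal.rpow_half_tsum_le (x : ℕ → ℝ≥0∞) :
    (∑' j, x j) ^ (1 / 2 : ℝ) ≤ ∑' j, x j ^ (1 / 2 : ℝ) := by
  have e : ∀ y : ℝ≥0∞, (y ^ (1 / 2 : ℝ)) ^ 2 = y := fun y => by
    rw [← ENNReal.rpow_natCast, ← ENNReal.rpow_mul]; norm_num
  calc (∑' j, x j) ^ (1 / 2 : ℝ) ≤ ((∑' j, x j ^ (1 / 2 : ℝ)) ^ 2) ^ (1 / 2 : ℝ) := by
        refine ENNReal.rpow_le_rpow ?_ (by norm_num)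
        rw [sq, ← ENNReal.tsum_mul_left]
        refine ENNReal.tsum_le_tsum fun j => ?_
        rw [← e (x j), ENNReal.sq_rpow_half, sq]
        gcongr
        exact ENNReal.le_tsum j
    _ = _ := ENNReal.sq_rpow_half _

theorem ENNReal.tsum_ite_le {p : ℕ → Prop} [DecidablePred p] (hp : ∀ i j, p i → p j → i = j)
    (c : ℝ≥0∞) : ∑' j, (if p j then c else 0) ≤ c := by
  by_cases h : ∃ i, p i
  · obtain ⟨i, hi⟩ := h
    rw [tsum_eq_single i fun j hj => if_neg fun hpj => hj (hp j i hpj hi), if_pos hi]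
  · push Not at h
    simp [h]

/-- Schur's test: for fixed `n` or fixed `j` the exponents `j + 4 - n` are distinct natural numbers,
so every row and every column of the matrix is bounded by the geometric series. -/
theorem tsum_band_le (r : ℝ≥0∞) (e : ℕ → ℝ≥0∞) :
    ∑' n, ∑' j, (if n ≤ j + 4 then r ^ (j + 4 - n) * (e n + e j) else 0) ≤
      2 * (1 - r)⁻¹ * ∑' n, e n := by
  have h1 : ∀ n j, (if n ≤ j + 4 then r ^ (j + 4 - n) else 0) ≤
      ∑' m, (if j + 4 = n + m then r ^ m else 0) := fun n j => by
    by_cases h : n ≤ j + 4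
    · rw [if_pos h]
      refine le_trans ?_ (ENNReal.le_tsum (j + 4 - n))
      rw [if_pos (by omega)]
    · rw [if_neg h]; exact zero_le
  have h2 : ∀ n, ∑' j, (if n ≤ j + 4 then r ^ (j + 4 - n) else 0) ≤ (1 - r)⁻¹ := fun n => by
    refine (ENNReal.tsum_le_tsum (h1 n)).trans ?_
    rw [ENNReal.tsum_comm, ← ENNReal.tsum_geometric]
    exact ENNReal.tsum_le_tsum fun m => ENNReal.tsum_ite_le (fun i j hi hj => by omega) _
  have h3 : ∀ j, ∑' n, (if n ≤ j + 4 then r ^ (j + 4 - n) else 0) ≤ (1 - r)⁻¹ := fun j => by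
    refine (ENNReal.tsum_le_tsum fun n => h1 n j).trans ?_
    rw [ENNReal.tsum_comm, ← ENNReal.tsum_geometric]
    exact ENNReal.tsum_le_tsum fun m => ENNReal.tsum_ite_le (fun i j hi hj => by omega) _
  calc _ = ∑' n, ∑' j, ((if n ≤ j + 4 then r ^ (j + 4 - n) else 0) * e n +
        (if n ≤ j + 4 then r ^ (j + 4 - n) else 0) * e j) := by
        refine tsum_congr fun n => tsum_congr fun j => ?_
        split_ifs
        · ring
        · simp
    _ = (∑' n, (∑' j, (if n ≤ j + 4 then r ^ (j + 4 - n) else 0)) * e n) +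
        ∑' j, (∑' n, (if n ≤ j + 4 then r ^ (j + 4 - n) else 0)) * e j := by
        simp only [ENNReal.tsum_add, ENNReal.tsum_mul_right]
        congr 1
        rw [ENNReal.tsum_comm]
        simp only [ENNReal.tsum_mul_right]
    _ ≤ (∑' n, (1 - r)⁻¹ * e n) + ∑' j, (1 - r)⁻¹ * e j := by
        gcongr with n j
        · exact h2 n
        · exact h3 j
    _ = _ := by rw [ENNReal.tsum_mul_left]; ring

/-- Here `x`, `y` stand for the time integrals of the squared blocks `n`, `j` and `a`, `b` for their
energies. The two square-root factors on the left are the integral and supremum bounds of the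
interpolation. Parabolic smoothing gives `2^{-(n+j)/2}` against `2^n`, hence decay `2^{-(j-n)/2}`;
the shift by `4` is absorbed in the constant. -/
theorem band_rpow_le {x y a b : ℝ≥0∞} {n j : ℕ} (hnj : n ≤ j + 4) (hx : 4 ^ n * x ≤ 10 * a)
    (hy : 4 ^ j * y ≤ 10 * b) :
    2 ^ n * ((x ^ (1 / 2 : ℝ) * y ^ (1 / 2 : ℝ)) *
      (2 * (a ^ (1 / 2 : ℝ) * b ^ (1 / 2 : ℝ)))) ^ (1 / 2 : ℝ) ≤
      320 * (((2⁻¹ : ℝ≥0∞) ^ (1 / 2 : ℝ)) ^ (j + 4 - n) * (a + b)) := by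
  have hmul : ∀ p q : ℝ≥0∞, p ^ (1 / 2 : ℝ) * q ^ (1 / 2 : ℝ) = (p * q) ^ (1 / 2 : ℝ) := fun p q =>
    (ENNReal.mul_rpow_of_nonneg _ _ (by norm_num)).symm
  have hsq : ∀ p : ℝ≥0∞, (p ^ 2) ^ (1 / 2 : ℝ) = p := ENNReal.sq_rpow_half
  have e2 : ∀ m : ℕ, (2 : ℝ≥0∞) ^ m * 2⁻¹ ^ m = 1 := fun m => by
    rw [← mul_pow, ENNReal.mul_inv_cancel (by norm_num) (by norm_num), one_pow]
  set m := j + 4 - n with hm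
  have hmn : j + 4 = n + m := by omega
  have h16 : (16 : ℝ≥0∞) * 2 ^ j * 2⁻¹ ^ m = 2 ^ n := by
    calc (16 : ℝ≥0∞) * 2 ^ j * 2⁻¹ ^ m = 2 ^ (j + 4) * 2⁻¹ ^ m := by rw [pow_add]; ring
      _ = 2 ^ n * (2 ^ m * 2⁻¹ ^ m) := by rw [hmn, pow_add]; ring
      _ = 2 ^ n := by rw [e2, mul_one]
  have e4 : ∀ k : ℕ, (4 : ℝ≥0∞) ^ k = (2 ^ k) ^ 2 := fun k => by
    rw [← pow_mul, mul_comm, pow_mul]; norm_num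
  rw [e4] at hx hy
  have h1 : (2 ^ n) ^ 2 * (x ^ (1 / 2 : ℝ) * y ^ (1 / 2 : ℝ)) ≤
      160 * 2⁻¹ ^ m * (a * b) ^ (1 / 2 : ℝ) := by
    calc (2 ^ n) ^ 2 * (x ^ (1 / 2 : ℝ) * y ^ (1 / 2 : ℝ))
        = 16 * 2⁻¹ ^ m * ((2 ^ n * 2 ^ j) * (x * y) ^ (1 / 2 : ℝ)) := by
          rw [hmul, sq]
          nth_rewrite 2 [← h16]
          ring
      _ = 16 * 2⁻¹ ^ m * (((2 ^ n) ^ 2 * x) * ((2 ^ j) ^ 2 * y)) ^ (1 / 2 : ℝ) := by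
          rw [← hsq (2 ^ n * 2 ^ j), hmul]
          congr 2
          ring
      _ ≤ 16 * 2⁻¹ ^ m * ((10 * a) * (10 * b)) ^ (1 / 2 : ℝ) := by gcongr
      _ = 16 * 2⁻¹ ^ m * (10 ^ 2 * (a * b)) ^ (1 / 2 : ℝ) := by congr 2; ring
      _ = _ := by
          rw [← hmul, hsq]
          ring
  calc _ = ((2 ^ n) ^ 2 * (x ^ (1 / 2 : ℝ) * y ^ (1 / 2 : ℝ)) *
        (2 * (a ^ (1 / 2 : ℝ) * b ^ (1 / 2 : ℝ)))) ^ (1 / 2 : ℝ) := by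
        rw [mul_assoc ((2 ^ n) ^ 2), ← hmul ((2 ^ n) ^ 2), hsq]
    _ ≤ (160 * 2⁻¹ ^ m * (a * b) ^ (1 / 2 : ℝ) * (2 * (a * b) ^ (1 / 2 : ℝ))) ^ (1 / 2 : ℝ) := by
        rw [hmul a b]
        gcongr
    _ = (320 * (2⁻¹ ^ m * (a * b))) ^ (1 / 2 : ℝ) := by
        congr 1
        have : (a * b) ^ (1 / 2 : ℝ) * (a * b) ^ (1 / 2 : ℝ) = a * b := by
          rw [hmul, ← sq, hsq]
        calc _ = 320 * (2⁻¹ ^ m * ((a * b) ^ (1 / 2 : ℝ) * (a * b) ^ (1 / 2 : ℝ))) := by ring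
          _ = _ := by rw [this]
    _ ≤ 320 * (2⁻¹ ^ m * (a * b)) ^ (1 / 2 : ℝ) := ENNReal.mul_rpow_half_le (by norm_num) _
    _ ≤ 320 * (2⁻¹ ^ m * (a + b) ^ 2) ^ (1 / 2 : ℝ) := by
        gcongr
        rw [sq]
        gcongr
        · exact le_self_add
        · exact le_add_self
    _ = _ := by
        rw [← hmul, hsq, ← ENNReal.rpow_natCast, ← ENNReal.rpow_natCast, ← ENNReal.rpow_mul,
          ← ENNReal.rpow_mul, mul_comm (1 / 2 : ℝ)]

/-- The energy of the `n`-th block: its maximal kinetic energy plus its dissipation. -/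
noncomputable def blockEnergy (D : LittlewoodPaley) (T : ℝ) (v : ℝ → R3 → R3) (n : ℕ) : ℝ≥0∞ :=
  (⨆ t ∈ Ico 0 T, 2⁻¹ * convSq (D.kern n) (v t)) + ∫⁻ s in Ioo 0 T, D.gradSq n (v s)

namespace BoundedFlow

variable {T : ℝ} {u v : ℝ → R3 → R3} {U : ℝ → ℝ} {B : ℝ≥0}

theorem convSq_le_blockEnergy (D : LittlewoodPaley) (n : ℕ) {t : ℝ} (ht : t ∈ Ico 0 T) :
    convSq (D.kern n) (v t) ≤ 2 * blockEnergy D T v n := by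
  have h1 : 2⁻¹ * convSq (D.kern n) (v t) ≤ blockEnergy D T v n :=
    (le_iSup₂ (f := fun t (_ : t ∈ Ico 0 T) => 2⁻¹ * convSq (D.kern n) (v t)) t ht).trans le_self_add
  calc _ = 2 * (2⁻¹ * convSq (D.kern n) (v t)) := by
        rw [← mul_assoc, ENNReal.mul_inv_cancel (by norm_num) (by norm_num), one_mul]
    _ ≤ _ := by gcongr

/-- The dissipation controls the weighted integral except for the low frequencies of block `0`.
There the supremum over a time interval of length at most one is used instead, which makes `T ≤ 1`
matter. -/
theorem four_pow_mul_lintegral_le (h : BoundedFlow T u v U B) (D : LittlewoodPaley) (hT : T ≤ 1)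
    (n : ℕ) : 4 ^ n * ∫⁻ s in Ioo 0 T, convSq (D.kern n) (v s) ≤ 10 * blockEnergy D T v n := by
  have hmem : ∀ᵐ s ∂(volume.restrict (Ioo 0 T)), s ∈ Ico 0 T := by
    filter_upwards [ae_restrict_mem measurableSet_Ioo] with s hs using Ioo_subset_Ico_self hs
  rw [← lintegral_const_mul' _ _ (by finiteness)]
  calc _ ≤ ∫⁻ s in Ioo 0 T, (8 * D.gradSq n (v s) + 2 * blockEnergy D T v n) := by
        refine lintegral_mono_ae (hmem.mono fun s hs => ?_)
        exact (D.four_pow_mul_convSq_le n (h.v_memLp s hs)).trans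
          (by gcongr; exact convSq_le_blockEnergy D n hs)
    _ = 8 * (∫⁻ s in Ioo 0 T, D.gradSq n (v s)) +
        2 * blockEnergy D T v n * volume (Ioo 0 T) := by
        rw [lintegral_add_right _ measurable_const, lintegral_const_mul' _ _ (by norm_num),
          lintegral_const, Measure.restrict_apply_univ]
    _ ≤ 8 * blockEnergy D T v n + 2 * blockEnergy D T v n * 1 := by
        gcongr
        · exact le_add_self
        · rw [Real.volume_Ioo, sub_zero]
          exact ENNReal.ofReal_le_one.2 hT
    _ = _ := by ring

/-- Lorentz duality applied to the product of two block norms: Cauchy-Schwarz in time bounds its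
integral, and the two block energies bound its supremum. -/
theorem two_pow_mul_lintegral_le (h : BoundedFlow T u v U B) (D : LittlewoodPaley) (hT : T ≤ 1)
    {f : ℝ → ℝ≥0∞} (hf : AEMeasurable f (volume.restrict (Ioo 0 T)))
    (hfin : ∀ n, blockEnergy D T v n ≠ ⊤) {n j : ℕ} (hnj : n ≤ j + 4) :
    2 ^ n * ∫⁻ s in Ioo 0 T, f s * (convSq (D.kern n) (v s) ^ (1 / 2 : ℝ) *
      convSq (D.kern j) (v s) ^ (1 / 2 : ℝ)) ≤ 1280 * lorentzNorm f *
      (((2⁻¹ : ℝ≥0∞) ^ (1 / 2 : ℝ)) ^ (j + 4 - n) * (blockEnergy D T v n + blockEnergy D T v j)) := by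
  have hmem : ∀ᵐ s ∂(volume.restrict (Ioo 0 T)), s ∈ Ico 0 T := by
    filter_upwards [ae_restrict_mem measurableSet_Ioo] with s hs using Ioo_subset_Ico_self hs
  have hm := fun n => (h.aemeasurable_convSq (D.kern n)).pow_const (1 / 2 : ℝ)
  have e : ∀ y : ℝ≥0∞, (y ^ (1 / 2 : ℝ)) ^ 2 = y := fun y => by
    rw [← ENNReal.rpow_natCast, ← ENNReal.rpow_mul]; norm_num
  have hI := lintegral_mul_le_sqrt (hm n) (hm j)
  simp only [e] at hI
  have key := lintegral_mul_le_lorentzNorm (f := f) hT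
    (M := 2 * (blockEnergy D T v n ^ (1 / 2 : ℝ) * blockEnergy D T v j ^ (1 / 2 : ℝ)))
    (by
      have := fun n => ENNReal.rpow_ne_top_of_nonneg (by norm_num : (0 : ℝ) ≤ 1 / 2) (hfin n)
      exact ENNReal.mul_ne_top (by norm_num) (ENNReal.mul_ne_top (this n) (this j)))
    hf ((hm n).mul (hm j)) (by
      filter_upwards [hmem] with s hs
      have h1 : ∀ n, convSq (D.kern n) (v s) ^ (1 / 2 : ℝ) ≤
          2 ^ (1 / 2 : ℝ) * blockEnergy D T v n ^ (1 / 2 : ℝ) := fun n => by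
        rw [← ENNReal.mul_rpow_of_nonneg _ _ (by norm_num)]
        exact ENNReal.rpow_le_rpow (convSq_le_blockEnergy D n hs) (by norm_num)
      calc _ ≤ (2 ^ (1 / 2 : ℝ) * blockEnergy D T v n ^ (1 / 2 : ℝ)) *
            (2 ^ (1 / 2 : ℝ) * blockEnergy D T v j ^ (1 / 2 : ℝ)) := mul_le_mul' (h1 n) (h1 j)
        _ = (2 ^ (1 / 2 : ℝ)) ^ 2 *
            (blockEnergy D T v n ^ (1 / 2 : ℝ) * blockEnergy D T v j ^ (1 / 2 : ℝ)) := by ring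
        _ = _ := by rw [e]) hI
  refine (mul_le_mul' (le_refl (2 ^ n : ℝ≥0∞)) key).trans ?_
  rw [mul_left_comm]
  refine (mul_le_mul' (le_refl (4 * lorentzNorm f)) (band_rpow_le hnj
    (h.four_pow_mul_lintegral_le D hT n) (h.four_pow_mul_lintegral_le D hT j))).trans (le_of_eq ?_)
  ring

end BoundedFlow

/-- The square root of the high frequency sum is first bounded by the sum of square roots. Each pair
of blocks can then be interpolated in time separately, and the off-diagonal decay makes up for the
loss. -/
theorem exists_tsum_lintegral_flux_le : ∃ C : ℝ≥0, ∀ (D : LittlewoodPaley) (T : ℝ)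
    (u v : ℝ → R3 → R3) (U : ℝ → ℝ) (B : ℝ≥0) (f : ℝ → ℝ≥0∞), BoundedFlow T u v U B → T ≤ 1 →
    AEMeasurable f (volume.restrict (Ioo 0 T)) → (∀ s, ENNReal.ofReal (U s) ≤ f s) →
    (∀ n, blockEnergy D T v n ≠ ⊤) →
    ∑' n, ∫⁻ s in Ioo 0 T, ‖D.flux n (u s) (v s)‖ₑ ≤
      C * lorentzNorm f * ∑' n, blockEnergy D T v n := by
  obtain ⟨C, hC⟩ := LittlewoodPaley.exists_enorm_flux_le
  set r : ℝ≥0∞ := (2⁻¹ : ℝ≥0∞) ^ (1 / 2 : ℝ) with hr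
  have hr1 : r < 1 := ENNReal.rpow_lt_one (by norm_num) (by norm_num)
  have hK : (1 - r)⁻¹ ≠ ⊤ := ENNReal.inv_ne_top.2 (tsub_pos_of_lt hr1).ne'
  refine ⟨C * 1280 * 2 * ((1 - r)⁻¹).toNNReal, fun D T u v U B f h hT hf hUf hfin => ?_⟩
  have hm := fun n => (h.aemeasurable_convSq (D.kern n)).pow_const (1 / 2 : ℝ)
  have h1 : ∀ n, ∫⁻ s in Ioo 0 T, ‖D.flux n (u s) (v s)‖ₑ ≤
      C * 1280 * lorentzNorm f * ∑' j, (if n ≤ j + 4 then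
        r ^ (j + 4 - n) * (blockEnergy D T v n + blockEnergy D T v j) else 0) := by
    intro n
    calc _ ≤ ∫⁻ s in Ioo 0 T, ∑' j, (if n ≤ j + 4 then C * 2 ^ n * (f s *
          (convSq (D.kern n) (v s) ^ (1 / 2 : ℝ) * convSq (D.kern j) (v s) ^ (1 / 2 : ℝ)))
          else 0) := by
          refine lintegral_mono_ae ?_
          filter_upwards [h.ae_slice, h.div_free, h.curl_eq] with s hs hd hc
          refine (hC D n (u s) (v s) (U s) hs.1 hs.2.1 hs.2.2.1 hd hc).trans ?_
          have h2 : ((4 : ℝ≥0∞) ^ n * convSq (D.kern n) (v s)) ^ (1 / 2 : ℝ) =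
              2 ^ n * convSq (D.kern n) (v s) ^ (1 / 2 : ℝ) := by
            rw [ENNReal.mul_rpow_of_nonneg _ _ (by norm_num),
              show (4 : ℝ≥0∞) ^ n = (2 ^ n) ^ 2 by rw [← pow_mul, mul_comm, pow_mul]; norm_num,
              ENNReal.sq_rpow_half]
          calc _ ≤ C * f s * (2 ^ n * convSq (D.kern n) (v s) ^ (1 / 2 : ℝ) *
                ∑' j, (if n ≤ j + 4 then convSq (D.kern j) (v s) else 0) ^ (1 / 2 : ℝ)) := by
                rw [h2]
                gcongr
                · exact hUf s
                · exact ENNReal.rpow_half_tsum_le _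
            _ = _ := by
                rw [← ENNReal.tsum_mul_left, ← ENNReal.tsum_mul_left]
                refine tsum_congr fun j => ?_
                split_ifs
                · ring
                · simp
      _ = ∑' j, (if n ≤ j + 4 then C * (2 ^ n * ∫⁻ s in Ioo 0 T, f s *
          (convSq (D.kern n) (v s) ^ (1 / 2 : ℝ) * convSq (D.kern j) (v s) ^ (1 / 2 : ℝ)))
          else 0) := by
          rw [lintegral_tsum]
          · refine tsum_congr fun j => ?_
            split_ifs
            · rw [lintegral_const_mul' _ _ (by finiteness), mul_assoc]
            · simp
          · intro j
            split_ifs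
            · exact (hf.mul ((hm n).mul (hm j))).const_mul _
            · exact aemeasurable_const
      _ ≤ ∑' j, (if n ≤ j + 4 then C * (1280 * lorentzNorm f *
          (r ^ (j + 4 - n) * (blockEnergy D T v n + blockEnergy D T v j))) else 0) := by
          refine ENNReal.tsum_le_tsum fun j => ?_
          split_ifs with hnj
          · exact mul_le_mul' le_rfl (h.two_pow_mul_lintegral_le D hT hf hfin hnj)
          · exact le_rfl
      _ = _ := by
          rw [← ENNReal.tsum_mul_left]
          refine tsum_congr fun j => ?_
          split_ifs
          · ring
          · simp
  calc _ ≤ ∑' n, C * 1280 * lorentzNorm f * ∑' j, (if n ≤ j + 4 then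
        r ^ (j + 4 - n) * (blockEnergy D T v n + blockEnergy D T v j) else 0) :=
        ENNReal.tsum_le_tsum h1
    _ ≤ C * 1280 * lorentzNorm f * (2 * (1 - r)⁻¹ * ∑' n, blockEnergy D T v n) := by
        rw [ENNReal.tsum_mul_left]
        gcongr
        exact tsum_band_le r _
    _ = _ := by
        push_cast
        rw [ENNReal.coe_toNNReal hK]
        ring

/-! ### A priori finiteness and conclusion -/

theorem le_two_mul_of_absorb {x a : ℝ≥0∞} (hx : x ≠ ⊤) (h : x ≤ a + 2⁻¹ * x) : x ≤ 2 * a := by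
  have h1 : x = 2⁻¹ * x + 2⁻¹ * x := by
    rw [← add_mul, ENNReal.inv_two_add_inv_two, one_mul]
  have h2 : 2⁻¹ * x ≤ a := by
    rw [h1] at h
    refine (ENNReal.add_le_add_iff_right (a := 2⁻¹ * x) (by finiteness)).1 ?_
    simpa [← h1] using h
  calc x = 2 * (2⁻¹ * x) := by
        rw [← mul_assoc, ENNReal.mul_inv_cancel (by norm_num) (by norm_num), one_mul]
    _ ≤ _ := by gcongr

namespace MemVQ

variable {D : LittlewoodPaley} {T : ℝ} {v : ℝ → R3 → R3}

theorem iSup_blockNormSq_eq (h : MemVQ D T v) (n : ℕ) :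
    (⨆ t ∈ Ico 0 T, 2⁻¹ * D.blockNormSq n (v t)) = ⨆ t ∈ Ico 0 T, 2⁻¹ * convSq (D.kern n) (v t) :=
  iSup_congr fun t => iSup_congr fun ht => by rw [D.blockNormSq_eq n (h.2.1 t ht)]

/-- At each time the sum of the squared blocks is dominated by the sum of their suprema, so the norm
of the energy space bounds `v(t)` in `L²` uniformly in time. -/
theorem exists_eLpNorm_le (h : MemVQ D T v) :
    ∃ B : ℝ≥0, ∀ t ∈ Ico 0 T, eLpNorm (v t) 2 (volume : Measure R3) ≤ B := by
  set S := ∑' n : ℕ, ⨆ t ∈ Ico 0 T, 2⁻¹ * D.blockNormSq n (v t) with hS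
  have hfin : 3 * (2 * S) ≠ ⊤ := by
    have : S < ⊤ := le_self_add.trans_lt h.2.2
    finiteness
  refine ⟨((3 * (2 * S)) ^ (1 / 2 : ℝ)).toNNReal, fun t ht => ?_⟩
  rw [ENNReal.coe_toNNReal (ENNReal.rpow_ne_top_of_nonneg (by norm_num) hfin),
    ← lintegral_enorm_sq_rpow]
  refine ENNReal.rpow_le_rpow ((D.lintegral_sq_le_tsum_convSq (h.2.1 t ht)).trans ?_) (by norm_num)
  gcongr
  rw [hS, ← ENNReal.tsum_mul_left]
  refine ENNReal.tsum_le_tsum fun n => ?_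
  rw [h.iSup_blockNormSq_eq]
  calc _ = 2 * (2⁻¹ * convSq (D.kern n) (v t)) := by
        rw [← mul_assoc, ENNReal.mul_inv_cancel (by norm_num) (by norm_num), one_mul]
    _ ≤ _ := by
        gcongr
        exact le_iSup₂ (f := fun t (_ : t ∈ Ico 0 T) => 2⁻¹ * convSq (D.kern n) (v t)) t ht

theorem exists_ae_weakPartial (h : MemVQ D T v) : ∃ G : Fin 3 → ℝ → R3 → R3,
    (∫⁻ t in Ioo 0 T, ∑ j, ∫⁻ x, ‖G j t x‖ₑ ^ 2 < ⊤) ∧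
    ∀ᵐ t ∂(volume.restrict (Ioo 0 T)), (∀ j, MemLp (G j t) 2 (volume : Measure R3)) ∧
      ∀ j, HasWeakPartial j (v t) (G j t) := by
  obtain ⟨⟨hvm, G, hGm, hG, hint⟩, hv, hq⟩ := h
  have hle : ∀ᵐ t ∂(volume.restrict (Ioo 0 T)), (∑ j, ∫⁻ x, ‖G j t x‖ₑ ^ 2) ≤
      ∫⁻ x, (‖v t x‖ₑ ^ 2 + ∑ j, ‖G j t x‖ₑ ^ 2) := by
    filter_upwards [ae_all_iff.2 fun j => (hGm j).prodMk_left] with t ht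
    rw [← lintegral_finsetSum' _ fun j _ => (ht j).enorm.pow_const 2]
    exact lintegral_mono fun x => le_add_self
  have hlt : ∀ᵐ t ∂(volume.restrict (Ioo 0 T)), (∑ j, ∫⁻ x, ‖G j t x‖ₑ ^ 2) < ⊤ := by
    have hm : AEMeasurable (fun t => ∫⁻ x, (‖v t x‖ₑ ^ 2 + ∑ j, ‖G j t x‖ₑ ^ 2))
        (volume.restrict (Ioo 0 T)) :=
      AEMeasurable.lintegral_prod_right' (f := fun p : ℝ × R3 =>
        ‖v p.1 p.2‖ₑ ^ 2 + ∑ j, ‖G j p.1 p.2‖ₑ ^ 2) ((hvm.enorm.pow_const 2).add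
        (Finset.aemeasurable_fun_sum _ fun j _ => (hGm j).enorm.pow_const 2))
    filter_upwards [hle, ae_lt_top' hm hint.ne] with t h1 h2
    exact h1.trans_lt h2
  refine ⟨G, (lintegral_mono_ae hle).trans_lt hint, ?_⟩
  filter_upwards [hlt, hG, ae_all_iff.2 fun j => (hGm j).prodMk_left] with t h1 h2 h3
  refine ⟨fun j => ⟨h3 j, ?_⟩, h2⟩
  have h4 : ∫⁻ x, ‖G j t x‖ₑ ^ 2 < ⊤ :=
    (Finset.single_le_sum (f := fun j => ∫⁻ x, ‖G j t x‖ₑ ^ 2) (fun _ _ => zero_le)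
      (Finset.mem_univ j)).trans_lt h1
  rw [← lintegral_enorm_sq_rpow]
  exact ENNReal.rpow_lt_top_of_nonneg (by norm_num) h4.ne

end MemVQ

namespace BoundedFlow

variable {T : ℝ} {u v : ℝ → R3 → R3} {U : ℝ → ℝ} {B : ℝ≥0}

/-- What permits the absorption: the suprema are summable by the norm of the energy space, the
dissipations because the weak gradient is square integrable in space-time. -/
theorem tsum_blockEnergy_ne_top (h : BoundedFlow T u v U B) {D : LittlewoodPaley}
    (hV : MemVQ D T v) : ∑' n, blockEnergy D T v n ≠ ⊤ := by
  obtain ⟨G, hint, hG⟩ := hV.exists_ae_weakPartial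
  simp only [blockEnergy]
  rw [ENNReal.tsum_add]
  refine ENNReal.add_ne_top.2 ⟨?_, ?_⟩
  · simp only [← hV.iSup_blockNormSq_eq]
    exact (le_self_add.trans_lt hV.2.2).ne
  · rw [← lintegral_tsum fun n => h.aemeasurable_gradSq D n]
    refine ((lintegral_mono_ae ?_).trans_lt hint).ne
    filter_upwards [hG, h.ae_slice] with t ht hs
    exact D.tsum_gradSq_le hs.2.2.1 ht.1 ht.2

theorem qNormSq_le (h : BoundedFlow T u v U B) {D : LittlewoodPaley} (hV : MemVQ D T v) :
    qNormSq D T v ≤ 3 * ∑' n, blockEnergy D T v n := by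
  obtain ⟨G, hint, hG⟩ := hV.exists_ae_weakPartial
  have h1 : ∫⁻ t in Ioo 0 T, gradNormSq (v t) ≤
      3 * ∑' n, ∫⁻ s in Ioo 0 T, D.gradSq n (v s) := by
    rw [← lintegral_tsum fun n => h.aemeasurable_gradSq D n,
      ← lintegral_const_mul' _ _ (by norm_num)]
    refine lintegral_mono_ae ?_
    filter_upwards [hG, h.ae_slice] with t ht hs
    exact D.gradNormSq_le hs.2.2.1 ht.1 ht.2
  simp only [blockEnergy]
  rw [ENNReal.tsum_add, mul_add, qNormSq]
  simp only [hV.iSup_blockNormSq_eq]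
  gcongr
  exact le_mul_of_one_le_left zero_le (by norm_num)

end BoundedFlow

theorem IsVorticitySolution.boundedFlow {T : ℝ} (hT : T ∈ Ioc 0 1) {u v : ℝ → R3 → R3} {v₀ : R3 → R3}
    (h : IsVorticitySolution T u v v₀) (hu : SpaceTimeMeasurable 1 u)
    (huL : lorentzSupNorm u ≠ ⊤) {D : LittlewoodPaley} (hV : MemVQ D T v) :
    ∃ B : ℝ≥0, BoundedFlow T u v (fun s => (eLpNorm (u s) ⊤ volume).toReal) B := by
  obtain ⟨B, hB⟩ := hV.exists_eLpNorm_le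
  have hsub : (volume : Measure ℝ).restrict (Ioo 0 T) ≤ volume.restrict (Ioo 0 1) :=
    Measure.restrict_mono (Ioo_subset_Ioo_right hT.2) le_rfl
  have hm := aemeasurable_eLpNorm_top hu
  -- On a bounded interval `L^{2,∞}` embeds in `L¹`: take the whole interval in the definition of
  -- the norm. Thus `u(s)` is bounded in `x` for almost every `s`, with an integrable bound.
  have hfin : ∫⁻ s in Ioo 0 1, eLpNorm (u s) ⊤ volume ≠ ⊤ := by
    refine ((setLIntegral_le_lorentzNorm (fun s => eLpNorm (u s) ⊤ volume) measurableSet_Ioo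
      le_rfl).trans_lt (ENNReal.mul_lt_top (lt_top_iff_ne_top.2 huL) ?_)).ne
    simp
  refine ⟨B, hu.mono_measure (Measure.prod_mono hsub le_rfl), hV.1.1, ?_, ?_, hV.2.1, hB, h.div_free,
    h.curl_eq, fun t ht η hη i => ?_⟩
  · filter_upwards [ae_mono hsub (ae_lt_top' hm hfin)] with s hs
    have := ae_le_eLpNormEssSup (f := u s) (μ := (volume : Measure R3))
    filter_upwards [this] with x hx
    rw [← toReal_enorm]
    exact ENNReal.toReal_mono hs.ne hx
  · exact (integrable_toReal_of_lintegral_ne_top hm hfin).mono_measure hsub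
  · rw [h.equation t ht η hη i]
    congr 1
    refine integral_congr_ae ?_
    filter_upwards [h.initial] with x hx
    rw [hx]

theorem proposition3p1 (D : LittlewoodPaley) :
    ∃ ε : ℝ, 0 < ε ∧ ∃ C : ℝ≥0,
      ∀ u : ℝ → R3 → R3, SpaceTimeMeasurable 1 u → lorentzSupNorm u ≤ ENNReal.ofReal ε →
        ∀ t₁ ∈ Ioc (0 : ℝ) 1, ∀ (v : ℝ → R3 → R3) (v₀ : R3 → R3),
          MemVQ D t₁ v → IsVorticitySolution t₁ u v v₀ →
            qNormSq D t₁ v ≤ (C : ℝ≥0∞) * eLpNorm v₀ 2 volume ^ 2 := by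
  obtain ⟨C, hC⟩ := exists_tsum_lintegral_flux_le
  -- This `ε` gives `2 C ε ≤ 1/2`. The constant `6` is the `3` relating the norm to the block
  -- energies times the `2` from absorbing one half.
  refine ⟨1 / (4 * (C + 1)), by positivity, 6, fun u hu huε T hT v v₀ hV hsol => ?_⟩
  obtain ⟨B, hB⟩ := hsol.boundedFlow hT hu (huε.trans_lt ENNReal.ofReal_lt_top).ne hV
  have hfin := hB.tsum_blockEnergy_ne_top hV
  set E := ∑' n, blockEnergy D T v n with hE
  have h0 : (0 : ℝ) ∈ Ico 0 T := ⟨le_rfl, hT.1⟩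
  have hsub : (volume : Measure ℝ).restrict (Ioo 0 T) ≤ volume.restrict (Ioo 0 1) :=
    Measure.restrict_mono (Ioo_subset_Ioo_right hT.2) le_rfl
  have hflux := hC D T u v _ B (fun s => eLpNorm (u s) ⊤ volume) hB hT.2
    ((aemeasurable_eLpNorm_top hu).mono_measure hsub) (fun s => ENNReal.ofReal_toReal_le)
    (fun n => ENNReal.ne_top_of_tsum_ne_top hfin n)
  have hinit : ∑' n, convSq (D.kern n) (v 0) ≤ eLpNorm v₀ 2 volume ^ 2 :=
    (D.tsum_convSq_le (hV.2.1 0 h0)).trans_eq (by rw [eLpNorm_congr_ae hsol.initial])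
  have hsmall : 2 * (C * lorentzSupNorm u) ≤ 2⁻¹ := by
    calc _ ≤ 2 * (ENNReal.ofReal C * ENNReal.ofReal (1 / (4 * (C + 1)))) := by
          rw [ENNReal.ofReal_coe_nnreal]
          gcongr
      _ = ENNReal.ofReal (2 * (C * (1 / (4 * (C + 1))))) := by
          rw [ENNReal.ofReal_mul (by norm_num), ENNReal.ofReal_mul (by positivity),
            ENNReal.ofReal_ofNat]
      _ ≤ ENNReal.ofReal (2⁻¹) := by
          refine ENNReal.ofReal_le_ofReal ?_
          have hC0 : (0 : ℝ) ≤ C := C.2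
          rw [mul_one_div, mul_div_assoc', div_le_iff₀ (by positivity)]
          linarith
      _ = 2⁻¹ := by rw [ENNReal.ofReal_inv_of_pos (by norm_num), ENNReal.ofReal_ofNat]
  have hmain : E ≤ eLpNorm v₀ 2 volume ^ 2 + 2⁻¹ * E := by
    calc E ≤ ∑' n, (convSq (D.kern n) (v 0) +
          2 * ∫⁻ s in Ioo 0 T, ‖D.flux n (u s) (v s)‖ₑ) :=
          ENNReal.tsum_le_tsum fun n => hB.energy_le D n
      _ ≤ eLpNorm v₀ 2 volume ^ 2 + 2 * (C * lorentzSupNorm u * E) := by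
          rw [ENNReal.tsum_add, ENNReal.tsum_mul_left]
          gcongr
          exact hflux
      _ = eLpNorm v₀ 2 volume ^ 2 + 2 * (C * lorentzSupNorm u) * E := by ring
      _ ≤ _ := by gcongr
  calc _ ≤ 3 * E := hB.qNormSq_le hV
    _ ≤ 3 * (2 * eLpNorm v₀ 2 volume ^ 2) := by
        gcongr
        exact le_two_mul_of_absorb hfin hmain
    _ = _ := by push_cast; ring
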